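/- \textbf{Conventions.} All complexes are $\mathbb{Z}$-graded and bounded. Let $\mathcal N$ be an exact category (in Quillen's sense) supporting long exact sequences, i.e. such that every retraction in $\mathcal N$ has a kernel. A chain complex in $\mathcal N$ is \emph{acyclic} if it is spliced together from short exact sequences of $\mathcal N$, and a chain map is a \emph{quasi-isomorphism} if its mapping cone is acyclic. A \emph{binary complex} $(N,d,d')$ is a graded object with two differentials; $\top(N,d,d')=(N,d)$ and $\bot(N,d,d')=(N,d')$. Let $C^q\mathcal N$ be the exact category of acyclic chain complexes, and $B^q\mathcal N$ the exact category of binary complexes $X$ with $\top X$ and $\bot X$ acyclic (exactness is degreewise). The functor $\Delta:C^q\mathcal N\to B^q\mathcal N$, $(N,d)\mapsto(N,d,d)$, is split by $\top$, and $\Omega\mathcal N$ denotes the split pair $[C^q\mathcal N\xrightarrow{\Delta}B^q\mathcal N]$. A split $0$-cube in a category is an object; a split $(n+1)$-cube is an arrow $C'\to C$ of split $n$-cubes having a left inverse. A functor $G$ to abelian groups extends to split $n$-cubes by $G[C'\to C]:=\operatorname{coker}(GC'\to GC)$. Iterating $\Omega$ gives a split $n$-cube $\Omega^n\mathcal N$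 of exact categories, whose last vertex is $(B^q)^n\mathcal N$, and we put \[K_n\mathcal N:=K_0(\Omega^n\mathcal N).\] For an exact functor $F:\mathcal M\to\mathcal N$ let $C[F]$ be the category of triples $(M,N,u)$ with $M$ a complex in $\mathcal M$, $N$ a complex in $\mathcal N$ and $u:FM\to N$ a quasi-isomorphism. Let $B[F]$ be the category of triples $(M,N,u)$ with $M=(\top M,\bot M)$ a pair of complexes in $\mathcal M$, $N$ a binary complex in $\mathcal N$ and $u$ a pair of quasi-isomorphisms $F\top M\to\top N$, $F\bot M\to\bot N$; short exact sequences in it are those which are degreewise exact in $M$ and in $N$. The group $K_0\Omega[F]$ is the quotient of $K_0B[F]$ in which the classes of the objects $((M,M),(N,d,d),(u,u))$ with $(M,(N,d),u)\in C[F]$ are set equal to $0$, and the classes of the source and the target of every arrow $(f,g)$ of $B[F]$ with $f$ a pair of quasi-isomorphisms and $g$ an isomorphism are set equal. Then $K_0\Omega$ is a functor on the category of pairs $[F]$ of exact categories, which is extended to split $n$-cubes of pairs, and $\Omega^n[F]:=[\Omega^n\mathcal M\to\Omega^n\mathcal N]$ is a split $n$-cube of pairs. \textbf{Corollary.} Let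 $F:\mathcal M\to\mathcal N$ be an exact functor between exact categories that support long exact sequences. There is a long exact sequence of abelian groups \[\cdots\to K_{n+1}\mathcal M\xrightarrow{F}K_{n+1}\mathcal N\xrightarrow{a_n}(K_0\Omega)(\Omega^n[\mathcal M\xrightarrow{F}\mathcal N])\xrightarrow{b_n}K_n\mathcal M\xrightarrow{F}K_n\mathcal N\to\cdots\to K_0\mathcal M\xrightarrow{F}K_0\mathcal N,\] where, for every $n\ge 0$, on the classes coming from the last vertices of the cubes, $a_n$ is given by $[X]\mapsto[(0,X,0)]$ for $X\in B^q((B^q)^n\mathcal N)$, and $b_n$ is given by $[(M,N,u)]\mapsto\chi(\top M)-\chi(\bot M)$ for $(M,N,u)\in B[(B^q)^nF]$, with $\chi(M)=\sum_i(-1)^i[M_i]$. -/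

import Mathlib

open CategoryTheory CategoryTheory.Limits

set_option linter.checkUnivs false

universe v u w v₁ u₁ v₂ u₂

noncomputable section

/-! ### Exact categories -/

/-- A preadditive category with a distinguished class of sequences `A ⟶ B ⟶ C`, which will play
the role of the short exact sequences. The axioms are in `ConflationCat.IsExactCategory`. -/
structure ConflationCat : Type (max u v + 1) where
  carrier : Type (max u v)
  [category : Category.{v} carrier]
  [preadditive : Preadditive carrier]
  conf : ∀ {A B C : carrier}, (A ⟶ B) → (B ⟶ C) → Prop

namespace ConflationCat

attribute [instance] ConflationCat.category ConflationCat.preadditive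

/-- Admissible monomorphisms. -/
def Inflation (N : ConflationCat.{v, u}) {A B : N.carrier} (i : A ⟶ B) : Prop :=
  ∃ (C : N.carrier) (p : B ⟶ C), N.conf i p

/-- Admissible epimorphisms. -/
def Deflation (N : ConflationCat.{v, u}) {B C : N.carrier} (p : B ⟶ C) : Prop :=
  ∃ (A : N.carrier) (i : A ⟶ B), N.conf i p

/-- The axioms of an exact category in the sense of Quillen. -/
structure IsExactCategory (N : ConflationCat.{v, u}) : Prop where
  hasFiniteBiproducts : HasFiniteBiproducts N.carrier
  conf_of_iso : ∀ {A B C A' B' C' : N.carrier} {i : A ⟶ B} {p : B ⟶ C} {i' : A' ⟶ B'}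
    {p' : B' ⟶ C'} (α : A ≅ A') (β : B ≅ B') (γ : C ≅ C'),
    i ≫ β.hom = α.hom ≫ i' → p ≫ γ.hom = β.hom ≫ p' → N.conf i p → N.conf i' p'
  kernel_cokernel : ∀ {A B C : N.carrier} {i : A ⟶ B} {p : B ⟶ C}, N.conf i p →
    ∃ w : i ≫ p = 0, Nonempty (IsLimit (KernelFork.ofι i w)) ∧
      Nonempty (IsColimit (CokernelCofork.ofπ p w))
  inflation_id : ∀ A : N.carrier, N.Inflation (𝟙 A)
  deflation_id : ∀ A : N.carrier, N.Deflation (𝟙 A)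
  inflation_comp : ∀ {A B C : N.carrier} (i : A ⟶ B) (j : B ⟶ C),
    N.Inflation i → N.Inflation j → N.Inflation (i ≫ j)
  deflation_comp : ∀ {A B C : N.carrier} (p : A ⟶ B) (q : B ⟶ C),
    N.Deflation p → N.Deflation q → N.Deflation (p ≫ q)
  inflation_pushout : ∀ {A B A' : N.carrier} (i : A ⟶ B) (f : A ⟶ A'), N.Inflation i →
    ∃ (B' : N.carrier) (f' : B ⟶ B') (i' : A' ⟶ B'), IsPushout i f f' i' ∧ N.Inflation i'
  deflation_pullback : ∀ {B C C' : N.carrier} (p : B ⟶ C) (f : C' ⟶ C), N.Deflation p →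
    ∃ (B' : N.carrier) (f' : B' ⟶ B) (p' : B' ⟶ C'), IsPullback f' p' p f ∧ N.Deflation p'

/-- An exact category supports long exact sequences if every retraction has a kernel. For exact
categories this is equivalent to asking that `p` is an admissible epimorphism whenever some
composite `f ≫ p` is one (and to the dual condition), and it is what makes the usual facts about
exactness of bounded chain complexes hold. -/
def SupportsLongExactSequences (N : ConflationCat.{v, u}) : Prop :=
  ∀ {B C : N.carrier} (r : B ⟶ C) (s : C ⟶ B), s ≫ r = 𝟙 C → HasKernel r

/-- Exact functors. -/
@[ext]
structure Hom (M N : ConflationCat.{v, u}) where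
  functor : M.carrier ⥤ N.carrier
  additive : functor.Additive
  map_conf : ∀ {A B C : M.carrier} (i : A ⟶ B) (p : B ⟶ C), M.conf i p →
    N.conf (functor.map i) (functor.map p)

attribute [instance] Hom.additive

/-- The category of exact categories and exact functors. -/
instance : Category ConflationCat.{v, u} where
  Hom := Hom
  id M := { functor := 𝟭 _, additive := inferInstance, map_conf := fun _ _ h => h }
  comp F G :=
    { functor := F.functor ⋙ G.functor
      additive := inferInstance
      map_conf := fun _ _ h => G.map_conf _ _ (F.map_conf _ _ h) }

/-- The functor underlying an exact functor. -/
abbrev fn {M N : ConflationCat.{v, u}} (F : M ⟶ N) : M.carrier ⥤ N.carrier :=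
  Hom.functor F

instance {M N : ConflationCat.{v, u}} (F : M ⟶ N) : (fn F).Additive := Hom.additive F

theorem hom_ext {M N : ConflationCat.{v, u}} {F G : M ⟶ N} (h : fn F = fn G) : F = G :=
  Hom.ext h

end ConflationCat

open ConflationCat

/-! ### Chain complexes and binary chain complexes -/

/-- Boundedness of a `ℤ`-graded object. -/
def GradedBounded {C : Type u₁} [Category.{v₁} C] (X : ℤ → C) : Prop :=
  ∃ a b : ℤ, ∀ i, i < a ∨ b < i → IsZero (X i)

/-- A chain complex in an exact category is acyclic (a long exact sequence) if it is obtained by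
splicing short exact sequences `Z i ⟶ X i ⟶ Z (i - 1)`. -/
def Acyclic (N : ConflationCat.{v, u}) (K : ChainComplex N.carrier ℤ) : Prop :=
  ∃ (Z : ℤ → N.carrier) (j : ∀ i, Z i ⟶ K.X i) (q : ∀ i, K.X i ⟶ Z (i - 1)),
    (∀ i, N.conf (j i) (q i)) ∧ ∀ i, K.d i (i - 1) = q i ≫ j (i - 1)

/-- A presentation of the complex `T` as the mapping cone of `f : K ⟶ L`: in each degree, `T i` is
the direct sum of `L i` and `K (i - 1)`, and the differential is `(l, k) ↦ (d l + f k, - d k)`. -/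
structure ConePresentation {C : Type u₁} [Category.{v₁} C] [Preadditive C]
    {K L : ChainComplex C ℤ} (f : K ⟶ L) (T : ChainComplex C ℤ) where
  inl : ∀ i, L.X i ⟶ T.X i
  fst : ∀ i, T.X i ⟶ L.X i
  inr : ∀ i, K.X (i - 1) ⟶ T.X i
  snd : ∀ i, T.X i ⟶ K.X (i - 1)
  inl_fst : ∀ i, inl i ≫ fst i = 𝟙 _
  inr_snd : ∀ i, inr i ≫ snd i = 𝟙 _
  inl_snd : ∀ i, inl i ≫ snd i = 0
  inr_fst : ∀ i, inr i ≫ fst i = 0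
  total : ∀ i, fst i ≫ inl i + snd i ≫ inr i = 𝟙 _
  d_eq : ∀ i, T.d i (i - 1) = fst i ≫ L.d i (i - 1) ≫ inl (i - 1)
    + snd i ≫ f.f (i - 1) ≫ inl (i - 1) - snd i ≫ K.d (i - 1) (i - 1 - 1) ≫ inr (i - 1)

/-- A chain map is a quasi-isomorphism if its mapping cone is acyclic. -/
def IsQuasiIso (N : ConflationCat.{v, u}) {K L : ChainComplex N.carrier ℤ} (f : K ⟶ L) : Prop :=
  ∃ T : ChainComplex N.carrier ℤ, Nonempty (ConePresentation f T) ∧ Acyclic N T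

/-- Binary chain complexes: a graded object with two differentials, the top differential `d` and
the bottom differential `d'`. -/
structure BinaryComplex (C : Type u₁) [Category.{v₁} C] [HasZeroMorphisms C] where
  X : ℤ → C
  d : ∀ i j, X i ⟶ X j
  d' : ∀ i j, X i ⟶ X j
  shape : ∀ i j, ¬ (ComplexShape.down ℤ).Rel i j → d i j = 0
  shape' : ∀ i j, ¬ (ComplexShape.down ℤ).Rel i j → d' i j = 0
  d_comp_d : ∀ i j k, d i j ≫ d j k = 0
  d_comp_d' : ∀ i j k, d' i j ≫ d' j k = 0

namespace BinaryComplex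

variable {C : Type u₁} [Category.{v₁} C] [Preadditive C]
variable {D : Type u₂} [Category.{v₂} D] [Preadditive D]

/-- A map of binary complexes is a map of graded objects commuting with both differentials. -/
@[ext]
structure Hom (K L : BinaryComplex C) where
  f : ∀ i, K.X i ⟶ L.X i
  comm : ∀ i j, f i ≫ L.d i j = K.d i j ≫ f j
  comm' : ∀ i j, f i ≫ L.d' i j = K.d' i j ≫ f j

instance : Category (BinaryComplex C) where
  Hom := Hom
  id K := { f := fun _ => 𝟙 _, comm := by simp, comm' := by simp }
  comp f g :=
    { f := fun i => f.f i ≫ g.f i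
      comm := fun i j => by rw [Category.assoc, g.comm, ← Category.assoc, f.comm, Category.assoc]
      comm' := fun i j => by
        rw [Category.assoc, g.comm', ← Category.assoc, f.comm', Category.assoc] }
  id_comp f := by apply Hom.ext; funext i; exact Category.id_comp _
  comp_id f := by apply Hom.ext; funext i; exact Category.comp_id _
  assoc f g h := by apply Hom.ext; funext i; exact Category.assoc _ _ _

/-- The components of a map of binary complexes. -/
abbrev comp {K L : BinaryComplex C} (f : K ⟶ L) (i : ℤ) : K.X i ⟶ L.X i :=
  Hom.f f i

theorem hom_ext {K L : BinaryComplex C} {f g : K ⟶ L} (h : ∀ i, comp f i = comp g i) : f = g :=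
  Hom.ext (funext h)

instance (K L : BinaryComplex C) : Zero (K ⟶ L) :=
  ⟨{ f := fun _ => 0, comm := by simp, comm' := by simp }⟩

instance (K L : BinaryComplex C) : Add (K ⟶ L) :=
  ⟨fun f g =>
    { f := fun i => Hom.f f i + Hom.f g i
      comm := fun i j => by
        rw [Preadditive.add_comp, Preadditive.comp_add, Hom.comm, Hom.comm]
      comm' := fun i j => by
        rw [Preadditive.add_comp, Preadditive.comp_add, Hom.comm', Hom.comm'] }⟩

instance (K L : BinaryComplex C) : Neg (K ⟶ L) :=
  ⟨fun f =>
    { f := fun i => - Hom.f f i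
      comm := fun i j => by rw [Preadditive.neg_comp, Preadditive.comp_neg, Hom.comm]
      comm' := fun i j => by rw [Preadditive.neg_comp, Preadditive.comp_neg, Hom.comm'] }⟩

instance (K L : BinaryComplex C) : AddCommGroup (K ⟶ L) where
  add_assoc f g h := hom_ext fun i => add_assoc (comp f i) (comp g i) (comp h i)
  zero_add f := hom_ext fun i => zero_add (comp f i)
  add_zero f := hom_ext fun i => add_zero (comp f i)
  add_comm f g := hom_ext fun i => add_comm (comp f i) (comp g i)
  neg_add_cancel f := hom_ext fun i => neg_add_cancel (comp f i)
  nsmul := nsmulRec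
  zsmul := zsmulRec

instance : Preadditive (BinaryComplex C) where
  add_comp K L P f f' g := hom_ext fun i =>
    Preadditive.add_comp _ _ _ (comp f i) (comp f' i) (comp g i)
  comp_add K L P f g g' := hom_ext fun i =>
    Preadditive.comp_add _ _ _ (comp f i) (comp g i) (comp g' i)

/-- The top complex of a binary complex. -/
def top : BinaryComplex C ⥤ ChainComplex C ℤ where
  obj K := { X := K.X, d := K.d, shape := K.shape, d_comp_d' := fun i j k _ _ => K.d_comp_d i j k }
  map f := { f := fun i => Hom.f f i, comm' := fun i j _ => Hom.comm f i j }

/-- The bottom complex of a binary complex. -/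
def bot : BinaryComplex C ⥤ ChainComplex C ℤ where
  obj K :=
    { X := K.X, d := K.d', shape := K.shape', d_comp_d' := fun i j k _ _ => K.d_comp_d' i j k }
  map f := { f := fun i => Hom.f f i, comm' := fun i j _ => Hom.comm' f i j }

/-- The diagonal functor. -/
def diag : ChainComplex C ℤ ⥤ BinaryComplex C where
  obj K :=
    { X := K.X, d := K.d, d' := K.d, shape := K.shape, shape' := K.shape
      d_comp_d := K.d_comp_d, d_comp_d' := K.d_comp_d }
  map f := { f := fun i => f.f i, comm := fun i j => f.comm i j, comm' := fun i j => f.comm i j }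

/-- The functor induced on binary complexes by an additive functor. -/
def map (F : C ⥤ D) [F.Additive] : BinaryComplex C ⥤ BinaryComplex D where
  obj K :=
    { X := fun i => F.obj (K.X i)
      d := fun i j => F.map (K.d i j)
      d' := fun i j => F.map (K.d' i j)
      shape := fun i j h => by rw [K.shape i j h, F.map_zero]
      shape' := fun i j h => by rw [K.shape' i j h, F.map_zero]
      d_comp_d := fun i j k => by rw [← F.map_comp, K.d_comp_d, F.map_zero]
      d_comp_d' := fun i j k => by rw [← F.map_comp, K.d_comp_d', F.map_zero] }
  map f :=
    { f := fun i => F.map (Hom.f f i)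
      comm := fun i j => by rw [← F.map_comp, ← F.map_comp, Hom.comm]
      comm' := fun i j => by rw [← F.map_comp, ← F.map_comp, Hom.comm'] }
  map_id K := hom_ext fun i => F.map_id _
  map_comp f g := hom_ext fun i => F.map_comp _ _

instance (F : C ⥤ D) [F.Additive] : (map F).Additive where
  map_add := hom_ext fun _ => F.map_add

end BinaryComplex

/-- The functor induced on chain complexes by an exact functor. -/
abbrev mapC {M N : ConflationCat.{v, u}} (F : M ⟶ N) :
    ChainComplex M.carrier ℤ ⥤ ChainComplex N.carrier ℤ :=
  (fn F).mapHomologicalComplex (ComplexShape.down ℤ)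

/-- The functor induced on binary complexes by an exact functor. -/
abbrev mapB {M N : ConflationCat.{v, u}} (F : M ⟶ N) :
    BinaryComplex M.carrier ⥤ BinaryComplex N.carrier :=
  BinaryComplex.map (fn F)

theorem GradedBounded.map {M N : ConflationCat.{v, u}} (F : M ⟶ N) {X : ℤ → M.carrier}
    (h : GradedBounded X) : GradedBounded fun i => (fn F).obj (X i) := by
  obtain ⟨a, b, h⟩ := h
  exact ⟨a, b, fun i hi => (fn F).map_isZero (h i hi)⟩

theorem Acyclic.map {M N : ConflationCat.{v, u}} (F : M ⟶ N) {K : ChainComplex M.carrier ℤ}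
    (h : Acyclic M K) : Acyclic N ((mapC F).obj K) := by
  obtain ⟨Z, j, q, h, h'⟩ := h
  refine ⟨fun i => (fn F).obj (Z i), fun i => (fn F).map (j i), fun i => (fn F).map (q i),
    fun i => Hom.map_conf F _ _ (h i), fun i => ?_⟩
  exact ((fn F).congr_map (h' i)).trans ((fn F).map_comp _ _)

/-- The mapping cone is preserved by exact functors. -/
def ConePresentation.map {M N : ConflationCat.{v, u}} (F : M ⟶ N)
    {K L : ChainComplex M.carrier ℤ} {f : K ⟶ L} {T : ChainComplex M.carrier ℤ}
    (c : ConePresentation f T) : ConePresentation ((mapC F).map f) ((mapC F).obj T) where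
  inl i := (fn F).map (c.inl i)
  fst i := (fn F).map (c.fst i)
  inr i := (fn F).map (c.inr i)
  snd i := (fn F).map (c.snd i)
  inl_fst i := ((fn F).map_comp _ _).symm.trans
    (((fn F).congr_map (c.inl_fst i)).trans ((fn F).map_id _))
  inr_snd i := ((fn F).map_comp _ _).symm.trans
    (((fn F).congr_map (c.inr_snd i)).trans ((fn F).map_id _))
  inl_snd i := ((fn F).map_comp _ _).symm.trans
    (((fn F).congr_map (c.inl_snd i)).trans ((fn F).map_zero _ _))
  inr_fst i := ((fn F).map_comp _ _).symm.trans
    (((fn F).congr_map (c.inr_fst i)).trans ((fn F).map_zero _ _))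
  total i := by
    have h := (fn F).congr_map (c.total i)
    rw [(fn F).map_add, (fn F).map_comp, (fn F).map_comp, (fn F).map_id] at h
    exact h
  d_eq i := by
    have h := (fn F).congr_map (c.d_eq i)
    simp only [Functor.map_add, Functor.map_sub, Functor.map_comp] at h
    exact h

theorem IsQuasiIso.map {M N : ConflationCat.{v, u}} (F : M ⟶ N)
    {K L : ChainComplex M.carrier ℤ} {f : K ⟶ L} (h : IsQuasiIso M f) :
    IsQuasiIso N ((mapC F).map f) := by
  obtain ⟨T, ⟨c⟩, hT⟩ := h
  exact ⟨_, ⟨c.map F⟩, hT.map F⟩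

theorem IsQuasiIso.iso_comp (N : ConflationCat.{v, u}) {K K' L : ChainComplex N.carrier ℤ}
    (e : K' ≅ K) {f : K ⟶ L} (h : IsQuasiIso N f) : IsQuasiIso N (e.hom ≫ f) := by
  obtain ⟨T, ⟨c⟩, hT⟩ := h
  have h1 : ∀ i, e.hom.f i ≫ e.inv.f i = 𝟙 _ := fun i => by
    rw [← HomologicalComplex.comp_f, e.hom_inv_id]; rfl
  have h2 : ∀ i, e.inv.f i ≫ e.hom.f i = 𝟙 _ := fun i => by
    rw [← HomologicalComplex.comp_f, e.inv_hom_id]; rfl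
  refine ⟨T, ⟨⟨c.inl, c.fst, fun i => e.hom.f (i - 1) ≫ c.inr i,
    fun i => c.snd i ≫ e.inv.f (i - 1), c.inl_fst, fun i => ?_, fun i => ?_, fun i => ?_,
    fun i => ?_, fun i => ?_⟩⟩, hT⟩
  · rw [Category.assoc, ← Category.assoc (c.inr i), c.inr_snd, Category.id_comp, h1]
  · rw [← Category.assoc, c.inl_snd, zero_comp]
  · rw [Category.assoc, c.inr_fst, comp_zero]
  · rw [Category.assoc, ← Category.assoc (e.inv.f (i - 1)), h2, Category.id_comp, c.total]
  · rw [c.d_eq i, HomologicalComplex.comp_f]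
    have h3 := e.hom.comm (i - 1) (i - 1 - 1)
    simp only [Category.assoc]
    rw [← Category.assoc (K'.d _ _), ← h3]
    simp only [Category.assoc]
    rw [← Category.assoc (e.inv.f _) (e.hom.f _), h2, Category.id_comp,
      ← Category.assoc (e.inv.f _) (e.hom.f _), h2, Category.id_comp]

/-! ### The exact categories of acyclic complexes, and the functor `Ω` -/

/-- Bounded acyclic chain complexes. -/
abbrev CqObj (N : ConflationCat.{v, u}) : Type (max u v) :=
  ObjectProperty.FullSubcategory
    fun K : ChainComplex N.carrier ℤ => GradedBounded K.X ∧ Acyclic N K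

/-- Bounded binary chain complexes whose top and bottom complexes are both acyclic. -/
abbrev BqObj (N : ConflationCat.{v, u}) : Type (max u v) :=
  ObjectProperty.FullSubcategory fun K : BinaryComplex N.carrier =>
    GradedBounded K.X ∧ Acyclic N (BinaryComplex.top.obj K) ∧ Acyclic N (BinaryComplex.bot.obj K)

/-- The exact category `C^q N` of bounded acyclic chain complexes; a sequence is exact if it is so
in each degree. -/
def Cq (N : ConflationCat.{v, u}) : ConflationCat.{v, u} where
  carrier := CqObj N
  conf {A B C : CqObj N} (i : A ⟶ B) (p : B ⟶ C) := ∀ n, N.conf (i.hom.f n) (p.hom.f n)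

/-- The exact category `B^q N` of bounded binary chain complexes whose top and bottom complexes are
both acyclic; a sequence is exact if it is so in each degree. -/
def Bq (N : ConflationCat.{v, u}) : ConflationCat.{v, u} where
  carrier := BqObj N
  conf {A B C : BqObj N} (i : A ⟶ B) (p : B ⟶ C) :=
    ∀ n, N.conf (BinaryComplex.comp i.hom n) (BinaryComplex.comp p.hom n)

/-- The functor `C^q M ⟶ C^q N` induced by an exact functor. -/
def CqObj.map {M N : ConflationCat.{v, u}} (F : M ⟶ N) : CqObj M ⥤ CqObj N where
  obj K := ⟨(mapC F).obj K.obj, K.property.1.map F, K.property.2.map F⟩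
  map f := ObjectProperty.homMk ((mapC F).map f.hom)
  map_id K := ObjectProperty.hom_ext _ ((mapC F).map_id K.obj)
  map_comp f g := ObjectProperty.hom_ext _ ((mapC F).map_comp f.hom g.hom)

/-- The functor `B^q M ⟶ B^q N` induced by an exact functor. -/
def BqObj.map {M N : ConflationCat.{v, u}} (F : M ⟶ N) : BqObj M ⥤ BqObj N where
  obj K := ⟨(mapB F).obj K.obj, K.property.1.map F, K.property.2.1.map F, K.property.2.2.map F⟩
  map f := ObjectProperty.homMk ((mapB F).map f.hom)
  map_id K := ObjectProperty.hom_ext _ ((mapB F).map_id K.obj)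
  map_comp f g := ObjectProperty.hom_ext _ ((mapB F).map_comp f.hom g.hom)

/-- The diagonal functor `C^q N ⟶ B^q N`. -/
def CqObj.diag (N : ConflationCat.{v, u}) : CqObj N ⥤ BqObj N where
  obj K := ⟨BinaryComplex.diag.obj K.obj, K.property.1, K.property.2, K.property.2⟩
  map f := ObjectProperty.homMk (BinaryComplex.diag.map f.hom)

/-- The functor `B^q N ⟶ C^q N` taking the top complex. -/
def BqObj.top (N : ConflationCat.{v, u}) : BqObj N ⥤ CqObj N where
  obj K := ⟨BinaryComplex.top.obj K.obj, K.property.1, K.property.2.1⟩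
  map f := ObjectProperty.homMk (BinaryComplex.top.map f.hom)

/-- `C^q` as a functor of the exact category. -/
def CqFunctor : ConflationCat.{v, u} ⥤ ConflationCat.{v, u} where
  obj := Cq
  map F :=
    { functor := CqObj.map F
      additive := ⟨fun {_ _ f g} =>
        ObjectProperty.hom_ext _ ((mapC F).map_add (f := f.hom) (g := g.hom))⟩
      map_conf := fun _ _ h n => Hom.map_conf F _ _ (h n) }
  map_id _ := rfl
  map_comp _ _ := rfl

/-- `B^q` as a functor of the exact category. -/
def BqFunctor : ConflationCat.{v, u} ⥤ ConflationCat.{v, u} where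
  obj := Bq
  map F :=
    { functor := BqObj.map F
      additive := ⟨fun {_ _ f g} =>
        ObjectProperty.hom_ext _ ((mapB F).map_add (f := f.hom) (g := g.hom))⟩
      map_conf := fun _ _ h n => Hom.map_conf F _ _ (h n) }
  map_id _ := rfl
  map_comp _ _ := rfl

/-- The diagonal `Δ : C^q ⟶ B^q`. -/
def diagNat : CqFunctor.{v, u} ⟶ BqFunctor.{v, u} where
  app N :=
    { functor := CqObj.diag N
      additive := ⟨rfl⟩
      map_conf := fun _ _ h n => h n }
  naturality _ _ _ := rfl

/-- The functor `⊤ : B^q ⟶ C^q`. -/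
def topNat : BqFunctor.{v, u} ⟶ CqFunctor.{v, u} where
  app N :=
    { functor := BqObj.top N
      additive := ⟨rfl⟩
      map_conf := fun _ _ h n => h n }
  naturality _ _ _ := rfl

theorem diagNat_topNat (N : ConflationCat.{v, u}) :
    diagNat.app N ≫ topNat.app N = 𝟙 (CqFunctor.obj N) := rfl

/-! ### Split cubes -/

/-- The category of split pairs in `C`: arrows which admit a splitting. -/
abbrev SplitPair (C : Type u₁) [Category.{v₁} C] : Type (max u₁ v₁) :=
  ObjectProperty.FullSubcategory fun f : Arrow C => IsSplitMono f.hom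

/-- The functor on split pairs induced by a functor. -/
def SplitPair.map {C : Type u₁} [Category.{v₁} C] {D : Type u₂} [Category.{v₂} D] (G : C ⥤ D) :
    SplitPair C ⥤ SplitPair D :=
  ObjectProperty.lift _ (ObjectProperty.ι _ ⋙ G.mapArrow) fun f =>
    haveI : IsSplitMono f.obj.hom := f.property
    inferInstanceAs (IsSplitMono (G.map f.obj.hom))

/-- Split `n`-cubes in `C`: a split `0`-cube is an object of `C`, and a split `(n + 1)`-cube is a
split pair of split `n`-cubes. -/
def SplitCube (C : Type (w + 1)) [LargeCategory.{w} C] : ℕ → Cat.{w, w + 1}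
  | 0 => Cat.of C
  | n + 1 => Cat.of (SplitPair (SplitCube C n))

/-- The extension of a functor `G` to abelian groups to split `n`-cubes, defined by
`G [C' ⟶ C] = coker (G C' ⟶ G C)`. -/
def cubeExt {C : Type (w + 1)} [LargeCategory.{w} C] (G : C ⥤ AddCommGrpCat.{w}) :
    ∀ n, SplitCube C n ⥤ AddCommGrpCat.{w}
  | 0 => G
  | n + 1 => ObjectProperty.ι (C := Arrow (SplitCube C n)) _ ⋙ (cubeExt G n).mapArrow ⋙ coker _

/-- The iterates of a functor `Ω` from `C` to split pairs in `C`, with values in split `n`-cubes: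
`Ω^(n+1) X` is `Ω^n` applied to the split pair `Ω X`. -/
def cubeIter {C : Type (w + 1)} [LargeCategory.{w} C] (Om : C ⥤ SplitPair C) :
    ∀ n, C ⥤ SplitCube C n
  | 0 => 𝟭 C
  | n + 1 => Om ⋙ SplitPair.map (cubeIter Om n)

/-- `Ω N`, the split pair `Δ : C^q N ⟶ B^q N` of exact categories. -/
def Om : ConflationCat.{v, u} ⥤ SplitPair ConflationCat.{v, u} where
  obj N := ⟨Arrow.mk (diagNat.app N), ⟨⟨topNat.app N, diagNat_topNat N⟩⟩⟩
  map F := ObjectProperty.homMk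
    (Arrow.homMk (CqFunctor.map F) (BqFunctor.map F) (diagNat.naturality F))
  map_id N := by
    apply ObjectProperty.hom_ext
    apply Arrow.hom_ext
    · exact CqFunctor.map_id N
    · exact BqFunctor.map_id N
  map_comp F G := by
    apply ObjectProperty.hom_ext
    apply Arrow.hom_ext
    · exact CqFunctor.map_comp F G
    · exact BqFunctor.map_comp F G

/-- `Ω` applied to a pair `F : M ⟶ N`, as a split pair of pairs of exact categories, namely
`Δ : [C^q M ⟶ C^q N] ⟶ [B^q M ⟶ B^q N]`. -/
def OmPair : Arrow ConflationCat.{v, u} ⥤ SplitPair (Arrow ConflationCat.{v, u}) where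
  obj F := ⟨Arrow.mk (((Functor.mapArrowFunctor _ _).map diagNat).app F),
    ⟨⟨((Functor.mapArrowFunctor _ _).map topNat).app F, by
      apply Arrow.hom_ext
      · exact diagNat_topNat _
      · exact diagNat_topNat _⟩⟩⟩
  map s := ObjectProperty.homMk
    (Arrow.homMk (CqFunctor.mapArrow.map s) (BqFunctor.mapArrow.map s)
      (((Functor.mapArrowFunctor _ _).map diagNat).naturality s))
  map_id F := by
    apply ObjectProperty.hom_ext
    apply Arrow.hom_ext
    · exact CqFunctor.mapArrow.map_id F
    · exact BqFunctor.mapArrow.map_id F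
  map_comp s t := by
    apply ObjectProperty.hom_ext
    apply Arrow.hom_ext
    · exact CqFunctor.mapArrow.map_comp s t
    · exact BqFunctor.mapArrow.map_comp s t

/-! ### Grothendieck groups -/

/-- The subgroup of additivity relations of `K_0`, for a category with a class of short exact
sequences. -/
def K0Rel (C : Type u₁) [Category.{v₁} C] (conf : ∀ {A B D : C}, (A ⟶ B) → (B ⟶ D) → Prop) :
    AddSubgroup (FreeAbelianGroup C) :=
  AddSubgroup.closure {x | ∃ (A B D : C) (i : A ⟶ B) (p : B ⟶ D), conf i p ∧
    x = FreeAbelianGroup.of B - (FreeAbelianGroup.of A + FreeAbelianGroup.of D)}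

/-- The Grothendieck group: generated by the objects, with a relation `[B] = [A] + [D]` for each
short exact sequence `A ⟶ B ⟶ D`. -/
abbrev K0Group (C : Type u₁) [Category.{v₁} C]
    (conf : ∀ {A B D : C}, (A ⟶ B) → (B ⟶ D) → Prop) : Type u₁ :=
  FreeAbelianGroup C ⧸ K0Rel C conf

/-- The class of an object in the Grothendieck group of an exact category. -/
def K0Class (N : ConflationCat.{v, u}) (A : N.carrier) : K0Group N.carrier N.conf :=
  QuotientAddGroup.mk (FreeAbelianGroup.of A)

theorem K0Group.map_rel {C : Type u₁} [Category.{v₁} C]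
    {conf : ∀ {A B D : C}, (A ⟶ B) → (B ⟶ D) → Prop} {D : Type u₂} [Category.{v₂} D]
    {conf' : ∀ {A B E : D}, (A ⟶ B) → (B ⟶ E) → Prop} (G : C ⥤ D)
    (hG : ∀ {A B D : C} (i : A ⟶ B) (p : B ⟶ D), conf i p → conf' (G.map i) (G.map p)) :
    K0Rel C conf ≤ (K0Rel D conf').comap (FreeAbelianGroup.map G.obj) := by
  refine (AddSubgroup.closure_le _).2 ?_
  rintro _ ⟨A, B, E, i, p, h, rfl⟩
  refine AddSubgroup.subset_closure ⟨_, _, _, G.map i, G.map p, hG i p h, ?_⟩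
  simp

/-- The functor `K_0` from exact categories to abelian groups. -/
def K0 : ConflationCat.{v, u} ⥤ AddCommGrpCat.{max u v} where
  obj N := AddCommGrpCat.of (K0Group N.carrier N.conf)
  map F := AddCommGrpCat.ofHom
    (QuotientAddGroup.map _ _ (FreeAbelianGroup.map (fn F).obj)
      (K0Group.map_rel (fn F) (Hom.map_conf F)))
  map_id N := by
    ext x
    exact congrArg (QuotientAddGroup.mk (s := K0Rel N.carrier N.conf))
      (FreeAbelianGroup.map_of_apply x)
  map_comp F G := by
    ext x
    rfl

/-! ### The categories `C[F]` and `B[F]`, and the relative Grothendieck group `K_0 Ω[F]` -/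

/-- The objects `(M, N, u)` of `C[F]`: bounded chain complexes `src` of `M` and `tar` of `N`, and a
quasi-isomorphism `u : F src ⟶ tar`. -/
structure CPair {M N : ConflationCat.{v, u}} (F : M ⟶ N) : Type (max u v) where
  src : ChainComplex M.carrier ℤ
  tar : ChainComplex N.carrier ℤ
  bounded_src : GradedBounded src.X
  bounded_tar : GradedBounded tar.X
  comp : (mapC F).obj src ⟶ tar
  quasiIso : IsQuasiIso N comp

/-- The objects `(M, N, u)` of `B[F]`: a pair `(srcTop, srcBot)` of bounded chain complexes of `M`,
a bounded binary chain complex `tar` of `N`, and a pair of quasi-isomorphisms from the image of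
`(srcTop, srcBot)` under `F` to the pair consisting of the top and the bottom complex of `tar`. -/
structure BPair {M N : ConflationCat.{v, u}} (F : M ⟶ N) : Type (max u v) where
  srcTop : ChainComplex M.carrier ℤ
  srcBot : ChainComplex M.carrier ℤ
  tar : BinaryComplex N.carrier
  bounded_srcTop : GradedBounded srcTop.X
  bounded_srcBot : GradedBounded srcBot.X
  bounded_tar : GradedBounded tar.X
  compTop : (mapC F).obj srcTop ⟶ BinaryComplex.top.obj tar
  compBot : (mapC F).obj srcBot ⟶ BinaryComplex.bot.obj tar
  quasiIsoTop : IsQuasiIso N compTop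
  quasiIsoBot : IsQuasiIso N compBot

/-- The diagonal `Δ : C[F] ⟶ B[F]` on objects. -/
def CPair.diag {M N : ConflationCat.{v, u}} {F : M ⟶ N} (X : CPair F) : BPair F where
  srcTop := X.src
  srcBot := X.src
  tar := BinaryComplex.diag.obj X.tar
  bounded_srcTop := X.bounded_src
  bounded_srcBot := X.bounded_src
  bounded_tar := X.bounded_tar
  compTop := X.comp
  compBot := X.comp
  quasiIsoTop := X.quasiIso
  quasiIsoBot := X.quasiIso

namespace BPair

variable {M N : ConflationCat.{v, u}} {F : M ⟶ N}

/-- The morphisms of `B[F]`. -/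
@[ext]
structure Hom (X Y : BPair F) where
  srcTop : X.srcTop ⟶ Y.srcTop
  srcBot : X.srcBot ⟶ Y.srcBot
  tar : X.tar ⟶ Y.tar
  wTop : X.compTop ≫ BinaryComplex.top.map tar = (mapC F).map srcTop ≫ Y.compTop
  wBot : X.compBot ≫ BinaryComplex.bot.map tar = (mapC F).map srcBot ≫ Y.compBot

instance : Category (BPair F) where
  Hom := Hom
  id X :=
    { srcTop := 𝟙 _
      srcBot := 𝟙 _
      tar := 𝟙 _
      wTop := by
        rw [(mapC F).map_id, BinaryComplex.top.map_id, Category.comp_id, Category.id_comp]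
      wBot := by
        rw [(mapC F).map_id, BinaryComplex.bot.map_id, Category.comp_id, Category.id_comp] }
  comp f g :=
    { srcTop := f.srcTop ≫ g.srcTop
      srcBot := f.srcBot ≫ g.srcBot
      tar := f.tar ≫ g.tar
      wTop := by
        rw [(mapC F).map_comp, BinaryComplex.top.map_comp, ← Category.assoc, f.wTop,
          Category.assoc, g.wTop, Category.assoc]
      wBot := by
        rw [(mapC F).map_comp, BinaryComplex.bot.map_comp, ← Category.assoc, f.wBot,
          Category.assoc, g.wBot, Category.assoc] }
  id_comp f := by apply Hom.ext <;> exact Category.id_comp _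
  comp_id f := by apply Hom.ext <;> exact Category.comp_id _
  assoc f g h := by apply Hom.ext <;> exact Category.assoc _ _ _

/-- The short exact sequences of `B[F]`. -/
def Conf {X Y Z : BPair F} (i : X ⟶ Y) (p : Y ⟶ Z) : Prop :=
  (∀ n, M.conf (Hom.srcTop i |>.f n) (Hom.srcTop p |>.f n)) ∧
  (∀ n, M.conf (Hom.srcBot i |>.f n) (Hom.srcBot p |>.f n)) ∧
  (∀ n, N.conf (BinaryComplex.comp (Hom.tar i) n) (BinaryComplex.comp (Hom.tar p) n))

/-- The subcategory `p` of weak equivalences of `B[F]`: the arrows which are quasi-isomorphisms on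
the sources and isomorphisms on the targets. -/
def WeakEquiv {X Y : BPair F} (f : X ⟶ Y) : Prop :=
  IsQuasiIso M (Hom.srcTop f) ∧ IsQuasiIso M (Hom.srcBot f) ∧ IsIso (Hom.tar f)

end BPair

/-- The subgroup of `K_0 B[F]` generated by the classes of the diagonal objects, and by the
differences of the source and the target of the arrows in `p`. -/
def K0OmegaRel {M N : ConflationCat.{v, u}} (F : M ⟶ N) :
    AddSubgroup (K0Group (BPair F) BPair.Conf) :=
  AddSubgroup.closure
    ({x | ∃ X : CPair F, x = QuotientAddGroup.mk (FreeAbelianGroup.of X.diag)} ∪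
     {x | ∃ (X Y : BPair F) (f : X ⟶ Y), BPair.WeakEquiv f ∧
        x = QuotientAddGroup.mk (FreeAbelianGroup.of X - FreeAbelianGroup.of Y)})

/-- The relative Grothendieck group `K_0 Ω[F]`: the quotient of `K_0 B[F]` that equates the objects
in the image of `Δ : C[F] ⟶ B[F]` to `0`, and equates the source and the target of the arrows
in `p`. -/
abbrev K0OmegaGroup {M N : ConflationCat.{v, u}} (F : M ⟶ N) : Type (max u v) :=
  K0Group (BPair F) BPair.Conf ⧸ K0OmegaRel F

/-- The class of an object of `B[F]` in `K_0 Ω[F]`. -/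
def K0OmegaClass {M N : ConflationCat.{v, u}} {F : M ⟶ N} (X : BPair F) : K0OmegaGroup F :=
  QuotientAddGroup.mk (QuotientAddGroup.mk (FreeAbelianGroup.of X))

section MapOfPairs

/-- For a map `s : F ⟶ G` of pairs, the identification of `G (s K)` with `s (F K)`. -/
def pairIso {F G : Arrow ConflationCat.{v, u}} (s : F ⟶ G) :
    mapC s.left ⋙ mapC G.hom ≅ mapC F.hom ⋙ mapC s.right :=
  eqToIso (congrArg (fun H => mapC H) (Arrow.w s))

variable {F G : Arrow ConflationCat.{v, u}} (s : F ⟶ G)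

theorem pairIso_app_f (K : ChainComplex F.left.carrier ℤ) (n : ℤ) :
    ((pairIso s).hom.app K).f n =
      eqToHom (congrArg (fun H => (fn H).obj (K.X n)) (Arrow.w s)) := by
  have : ∀ {H H' : F.left ⟶ G.right} (h : H = H'),
      ((eqToHom (congrArg (fun H => mapC H) h)).app K).f n =
        eqToHom (congrArg (fun H => (fn H).obj (K.X n)) h) := by
    rintro H _ rfl
    rfl
  exact this (Arrow.w s)

/-- The object of `C[G]` induced by an object of `C[F]`, for a map `F ⟶ G` of pairs. -/
def CPair.map (X : CPair F.hom) : CPair G.hom where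
  src := (mapC s.left).obj X.src
  tar := (mapC s.right).obj X.tar
  bounded_src := X.bounded_src.map s.left
  bounded_tar := X.bounded_tar.map s.right
  comp := (pairIso s).hom.app X.src ≫ (mapC s.right).map X.comp
  quasiIso := (X.quasiIso.map s.right).iso_comp _ ((pairIso s).app X.src)

/-- The functor `B[F] ⟶ B[G]` induced by a map `F ⟶ G` of pairs. -/
def BPair.map : BPair F.hom ⥤ BPair G.hom where
  obj X :=
    { srcTop := (mapC s.left).obj X.srcTop
      srcBot := (mapC s.left).obj X.srcBot
      tar := (mapB s.right).obj X.tar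
      bounded_srcTop := X.bounded_srcTop.map s.left
      bounded_srcBot := X.bounded_srcBot.map s.left
      bounded_tar := X.bounded_tar.map s.right
      compTop := (pairIso s).hom.app X.srcTop ≫ (mapC s.right).map X.compTop
      compBot := (pairIso s).hom.app X.srcBot ≫ (mapC s.right).map X.compBot
      quasiIsoTop := (X.quasiIsoTop.map s.right).iso_comp _ ((pairIso s).app X.srcTop)
      quasiIsoBot := (X.quasiIsoBot.map s.right).iso_comp _ ((pairIso s).app X.srcBot) }
  map {X Y} f :=
    { srcTop := (mapC s.left).map (BPair.Hom.srcTop f)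
      srcBot := (mapC s.left).map (BPair.Hom.srcBot f)
      tar := (mapB s.right).map (BPair.Hom.tar f)
      wTop := by
        have h1 := (mapC s.right).congr_map (BPair.Hom.wTop f)
        have h2 := (pairIso s).hom.naturality (BPair.Hom.srcTop f)
        rw [Functor.map_comp, Functor.map_comp] at h1
        refine (Category.assoc _ _ _).trans (Eq.trans (congrArg _ h1) ?_)
        refine (Category.assoc _ _ _).symm.trans (Eq.trans ?_ (Category.assoc _ _ _))
        exact congrArg (fun t => t ≫ (mapC s.right).map Y.compTop) h2.symm
      wBot := by
        have h1 := (mapC s.right).congr_map (BPair.Hom.wBot f)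
        have h2 := (pairIso s).hom.naturality (BPair.Hom.srcBot f)
        rw [Functor.map_comp, Functor.map_comp] at h1
        refine (Category.assoc _ _ _).trans (Eq.trans (congrArg _ h1) ?_)
        refine (Category.assoc _ _ _).symm.trans (Eq.trans ?_ (Category.assoc _ _ _))
        exact congrArg (fun t => t ≫ (mapC s.right).map Y.compBot) h2.symm }
  map_id X := by
    apply BPair.Hom.ext
    · exact (mapC s.left).map_id _
    · exact (mapC s.left).map_id _
    · exact (mapB s.right).map_id _
  map_comp f g := by
    apply BPair.Hom.ext
    · exact (mapC s.left).map_comp _ _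
    · exact (mapC s.left).map_comp _ _
    · exact (mapB s.right).map_comp _ _

theorem BPair.map_diag (X : CPair F.hom) : (BPair.map s).obj X.diag = (X.map s).diag := rfl

theorem BPair.map_conf {X Y Z : BPair F.hom} (i : X ⟶ Y) (p : Y ⟶ Z) (h : BPair.Conf i p) :
    BPair.Conf ((BPair.map s).map i) ((BPair.map s).map p) :=
  ⟨fun n => ConflationCat.Hom.map_conf s.left _ _ (h.1 n),
    fun n => ConflationCat.Hom.map_conf s.left _ _ (h.2.1 n),
    fun n => ConflationCat.Hom.map_conf s.right _ _ (h.2.2 n)⟩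

theorem BPair.map_weakEquiv {X Y : BPair F.hom} (f : X ⟶ Y) (h : BPair.WeakEquiv f) :
    BPair.WeakEquiv ((BPair.map s).map f) :=
  ⟨h.1.map s.left, h.2.1.map s.left,
    haveI := h.2.2; inferInstanceAs (IsIso ((mapB s.right).map (BPair.Hom.tar f)))⟩

theorem BPair.ext_comp {M N : ConflationCat.{v, u}} {H : M ⟶ N} {X Y : BPair H}
    (h1 : X.srcTop = Y.srcTop) (h2 : X.srcBot = Y.srcBot) (h3 : X.tar = Y.tar)
    (h4 : HEq X.compTop Y.compTop) (h5 : HEq X.compBot Y.compBot) : X = Y := by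
  cases X
  cases Y
  cases h1
  cases h2
  cases h3
  cases h4
  cases h5
  rfl

theorem BPair.map_id_obj (X : BPair F.hom) : (BPair.map (𝟙 F)).obj X = X := by
  refine BPair.ext_comp rfl rfl rfl (heq_of_eq ?_) (heq_of_eq ?_)
  · ext n
    change ((pairIso (𝟙 F)).hom.app X.srcTop).f n ≫ X.compTop.f n = _
    rw [pairIso_app_f]
    exact Category.id_comp _
  · ext n
    change ((pairIso (𝟙 F)).hom.app X.srcBot).f n ≫ X.compBot.f n = _
    rw [pairIso_app_f]
    exact Category.id_comp _

theorem BPair.map_comp_obj {H : Arrow ConflationCat.{v, u}} (t : G ⟶ H) (X : BPair F.hom) :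
    (BPair.map (s ≫ t)).obj X = (BPair.map t).obj ((BPair.map s).obj X) := by
  have key : ∀ (K : ChainComplex F.left.carrier ℤ) (n : ℤ),
      ((pairIso (s ≫ t)).hom.app K).f n =
        ((pairIso t).hom.app ((mapC s.left).obj K)).f n ≫
          (fn t.right).map (((pairIso s).hom.app K).f n) := by
    intro K n
    rw [pairIso_app_f, pairIso_app_f, pairIso_app_f]
    refine Eq.trans ?_ (congrArg (fun z => eqToHom _ ≫ z) (eqToHom_map (fn t.right) _).symm)
    exact (eqToHom_trans _ _).symm
  refine BPair.ext_comp rfl rfl rfl (heq_of_eq ?_) (heq_of_eq ?_)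
  · ext n
    change ((pairIso (s ≫ t)).hom.app X.srcTop).f n ≫
        (fn t.right).map ((fn s.right).map (X.compTop.f n)) =
      ((pairIso t).hom.app ((mapC s.left).obj X.srcTop)).f n ≫
        (fn t.right).map (((pairIso s).hom.app X.srcTop).f n ≫ (fn s.right).map (X.compTop.f n))
    rw [key]
    exact (Category.assoc _ _ _).trans (congrArg _ ((fn t.right).map_comp _ _).symm)
  · ext n
    change ((pairIso (s ≫ t)).hom.app X.srcBot).f n ≫
        (fn t.right).map ((fn s.right).map (X.compBot.f n)) =
      ((pairIso t).hom.app ((mapC s.left).obj X.srcBot)).f n ≫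
        (fn t.right).map (((pairIso s).hom.app X.srcBot).f n ≫ (fn s.right).map (X.compBot.f n))
    rw [key]
    exact (Category.assoc _ _ _).trans (congrArg _ ((fn t.right).map_comp _ _).symm)

/-- The map `K_0 B[F] ⟶ K_0 B[G]` induced by a map of pairs. -/
def K0BMap : K0Group (BPair F.hom) BPair.Conf →+ K0Group (BPair G.hom) BPair.Conf :=
  QuotientAddGroup.map _ _ (FreeAbelianGroup.map (BPair.map s).obj)
    (K0Group.map_rel (BPair.map s) (BPair.map_conf s))

theorem K0OmegaRel_le : K0OmegaRel F.hom ≤ (K0OmegaRel G.hom).comap (K0BMap s) := by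
  refine (AddSubgroup.closure_le _).2 ?_
  rintro _ (⟨X, rfl⟩ | ⟨X, Y, f, h, rfl⟩)
  · refine AddSubgroup.subset_closure (Or.inl ⟨X.map s, ?_⟩)
    exact congrArg _ (FreeAbelianGroup.map_of_apply _)
  · refine AddSubgroup.subset_closure
      (Or.inr ⟨_, _, (BPair.map s).map f, BPair.map_weakEquiv s f h, ?_⟩)
    refine congrArg (QuotientAddGroup.mk (s := K0Rel (BPair G.hom) BPair.Conf)) ?_
    rw [map_sub, FreeAbelianGroup.map_of_apply, FreeAbelianGroup.map_of_apply]

end MapOfPairs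

/-- The functor `K_0 Ω` from pairs of exact categories to abelian groups. -/
def K0Omega : Arrow ConflationCat.{v, u} ⥤ AddCommGrpCat.{max u v} where
  obj F := AddCommGrpCat.of (K0OmegaGroup F.hom)
  map s := AddCommGrpCat.ofHom (QuotientAddGroup.map _ _ (K0BMap s) (K0OmegaRel_le s))
  map_id F := by
    ext X
    exact congrArg K0OmegaClass (BPair.map_id_obj X)
  map_comp s t := by
    ext X
    exact congrArg K0OmegaClass (BPair.map_comp_obj s t X)

/-! ### The groups of the long exact sequence -/

/-- The higher K-group `K_n N = K_0 (Ω^n N)`, where `K_0` is extended to split `n`-cubes. -/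
def K (n : ℕ) : ConflationCat.{v, u} ⥤ AddCommGrpCat.{max u v} :=
  cubeIter Om n ⋙ cubeExt K0 n

/-- The group `(K_0 Ω)(Ω^n [F])`, where `K_0 Ω` is extended to split `n`-cubes of pairs. -/
def KOmega (n : ℕ) : Arrow ConflationCat.{v, u} ⥤ AddCommGrpCat.{max u v} :=
  cubeIter OmPair n ⋙ cubeExt K0Omega n

/-- The `n`-th iterate of `B^q`, which gives the last vertex of the cube `Ω^n`. -/
def BqIter : ℕ → (ConflationCat.{v, u} ⥤ ConflationCat.{v, u})
  | 0 => 𝟭 _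
  | n + 1 => BqFunctor ⋙ BqIter n

/-- The canonical map `K_0 ((B^q)^n N) ⟶ K_n N` from the group of the last vertex of `Ω^n N`; it is
a composite of projections to cokernels. -/
def vertexK : ∀ (n : ℕ) (N : ConflationCat.{v, u}), K0.obj ((BqIter n).obj N) ⟶ (K n).obj N
  | 0, N => 𝟙 (K0.obj N)
  | n + 1, N => vertexK n (BqFunctor.obj N) ≫ cokernel.π ((K n).map (diagNat.app N))

/-- The canonical map `K_1 ((B^q)^n N) ⟶ K_(n+1) N`; it is a composite of projections to
cokernels. -/
def vertexK1 : ∀ (n : ℕ) (N : ConflationCat.{v, u}), (K 1).obj ((BqIter n).obj N) ⟶ (K (n + 1)).obj N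
  | 0, N => 𝟙 ((K 1).obj N)
  | n + 1, N => vertexK1 n (BqFunctor.obj N) ≫ cokernel.π ((K (n + 1)).map (diagNat.app N))

/-- The canonical map `K_0 Ω[(B^q)^n F] ⟶ (K_0 Ω)(Ω^n [F])` from the group of the last vertex of
`Ω^n [F]`; it is a composite of projections to cokernels. -/
def vertexKOmega : ∀ (n : ℕ) (F : Arrow ConflationCat.{v, u}),
    K0Omega.obj ((BqIter n).mapArrow.obj F) ⟶ (KOmega n).obj F
  | 0, F => 𝟙 (K0Omega.obj F)
  | n + 1, F => vertexKOmega n (BqFunctor.mapArrow.obj F) ≫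
      cokernel.π ((KOmega n).map (((Functor.mapArrowFunctor _ _).map diagNat).app F))

/-- The Euler characteristic `∑ (-1)^i [K_i]` of a bounded graded object. -/
def eulerChar (N : ConflationCat.{v, u}) (X : ℤ → N.carrier) : K0Group N.carrier N.conf :=
  ∑ᶠ i : ℤ, (i.negOnePow : ℤ) • K0Class N (X i)

end

open ConflationCat ZeroObject

noncomputable section

set_option linter.unusedSectionVars false

/-! ### Exact categories that support long exact sequences -/

/-! The segment K_1 M → K_1 N → K_0 Ω[F] → K_0 M → K_0 N carries the mathematics; the other segments
come from it by replacing F with B^q F and passing to quotients.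

Three tools serve the lowest segment. First, conflations and bounded acyclic complexes are detected
in a category of abelian sheaves (`conf_iff_shortExact`, `acyclic_iff_exactAt`), so the long exact
homology sequence gives two-out-of-three for acyclicity and the usual calculus of
quasi-isomorphisms. Second, dévissage (`eq_zero_of_additive`): brutal truncation cuts a bounded
binary complex into pieces concentrated in one degree, which are diagonal, so an additive function
that vanishes on diagonal complexes vanishes. Hence the binary cone of the identity of any bounded
binary complex X is zero in K_1, and ((⊤X, ⊥X), FX, 1) is zero in K_0 Ω[F]. Third
(`exists_acyclic_of_eulerChar_eq`): modulo acyclic complexes, the class of a bounded graded object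
depends only on its Euler characteristic, so two graded objects with equal Euler characteristic
become degreewise isomorphic after adding acyclic complexes. Transporting a differential along such
isomorphisms produces binary complexes.

Exactness at K_0 M: if F[A] = F[B], then FA ⊕ S and FB ⊕ T are degreewise isomorphic with S and T
acyclic; they form a binary complex, and hence an object of B[F], with Euler characteristic [A] -
[B]. Exactness at K_0 Ω[F]: if the Euler characteristic of an object vanishes, its two sources
become one binary complex after adding acyclic complexes (`exists_hasClass`). An object with a
binary source has the same class as (0, T, 0), where T is its binary mapping cone
(`relClass_toBPair`).

Exactness at K_1 N is the delicate point. The inverse of the boundary map should send an object with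
a binary source to the class of its binary cone in the cokernel of K_1 M → K_1 N. This is invariant
under weak equivalences, because a weak equivalence has a cone with source in B^q M and target the
cone of an isomorphism. It is additive on conflations because the iterated cone of a conflation has
class zero (`HasClass.eq_add_of_conf`). But it is defined only when the Euler characteristic
vanishes. `exists_hom_of_partial` extends this partial additive function on isomorphism classes to a
function with values in a larger group. That function respects all relations of K_0 Ω[F], since each
relation can be completed by summands with exchanged top and bottom so that the Euler
characteristics vanish. It separates the values in the cokernel, which is the required injectivity.

For the induction, B^q preserves the hypotheses on M and N, and the groups for n + 1 are the
quotients of the groups for n of B^q F by the images of the diagonals. The maps are determined by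
their formulas on objects, so they commute with the idempotent Δ⊤ of the pair B^q F. They therefore
descend, and exactness descends because the kernel of each projection consists of fixed elements of
the idempotent (`exact_of_quotients`). No exact sequence for C^q is needed. -/

/-- Exact categories in which every retraction has a kernel. -/
class GoodExact (N : ConflationCat.{v, u}) : Prop where
  exact : N.IsExactCategory
  les : N.SupportsLongExactSequences

namespace GoodExact

variable {N : ConflationCat.{v, u}} [GoodExact N]

instance : HasFiniteBiproducts N.carrier := GoodExact.exact.hasFiniteBiproducts

instance : HasBinaryBiproducts N.carrier := hasBinaryBiproducts_of_finite_biproducts _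

instance : HasZeroObject N.carrier := hasZeroObject_of_hasFiniteBiproducts _

variable {A B C A' B' C' : N.carrier} {i : A ⟶ B} {p : B ⟶ C}

theorem conf_w (h : N.conf i p) : i ≫ p = 0 := (exact.kernel_cokernel h).choose

theorem conf_mono (h : N.conf i p) : Mono i := by
  obtain ⟨w, ⟨hk⟩, _⟩ := exact.kernel_cokernel h
  exact ⟨fun a b hab => Fork.IsLimit.hom_ext hk hab⟩

theorem conf_epi (h : N.conf i p) : Epi p := by
  obtain ⟨w, _, ⟨hk⟩⟩ := exact.kernel_cokernel h
  exact ⟨fun a b hab => Cofork.IsColimit.hom_ext hk hab⟩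

theorem conf_lift (h : N.conf i p) {T : N.carrier} (x : T ⟶ B) (hx : x ≫ p = 0) :
    ∃ y : T ⟶ A, y ≫ i = x := by
  obtain ⟨w, ⟨hk⟩, _⟩ := exact.kernel_cokernel h
  exact ⟨_, (KernelFork.IsLimit.lift' hk x hx).2⟩

theorem conf_desc (h : N.conf i p) {T : N.carrier} (x : B ⟶ T) (hx : i ≫ x = 0) :
    ∃ y : C ⟶ T, p ≫ y = x := by
  obtain ⟨w, _, ⟨hk⟩⟩ := exact.kernel_cokernel h
  exact ⟨_, (CokernelCofork.IsColimit.desc' hk x hx).2⟩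

theorem deflation_epi (h : N.Deflation p) : Epi p := conf_epi h.choose_spec.choose_spec

theorem inflation_mono (h : N.Inflation i) : Mono i := conf_mono h.choose_spec.choose_spec

/-- Any two kernels of a deflation are isomorphic, and conflations are closed under isomorphism.
Existence of liftings suffices as a hypothesis because uniqueness is contained in `Mono i`. -/
theorem conf_of_deflation (h : N.Deflation p) [Mono i] (w : i ≫ p = 0)
    (hl : ∀ {T : N.carrier} (x : T ⟶ B), x ≫ p = 0 → ∃ y, y ≫ i = x) : N.conf i p := by
  obtain ⟨K, k, hk⟩ := h
  obtain ⟨y, hy⟩ := hl k (conf_w hk)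
  obtain ⟨z, hz⟩ := conf_lift hk i w
  have := conf_mono hk
  refine exact.conf_of_iso ⟨y, z, ?_, ?_⟩ (Iso.refl B) (Iso.refl C) ?_ ?_ hk
  · rw [← cancel_mono k, Category.assoc, hz, hy, Category.id_comp]
  · rw [← cancel_mono i, Category.assoc, hy, hz, Category.id_comp]
  · simp [hy]
  · simp

theorem conf_of_inflation (h : N.Inflation i) [Epi p] (w : i ≫ p = 0)
    (hl : ∀ {T : N.carrier} (x : B ⟶ T), i ≫ x = 0 → ∃ y, p ≫ y = x) : N.conf i p := by
  obtain ⟨K, k, hk⟩ := h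
  obtain ⟨y, hy⟩ := hl k (conf_w hk)
  obtain ⟨z, hz⟩ := conf_desc hk p w
  have := conf_epi hk
  refine exact.conf_of_iso (Iso.refl A) (Iso.refl B) ⟨z, y, ?_, ?_⟩ ?_ ?_ hk
  · rw [← cancel_epi k, ← Category.assoc, hz, hy, Category.comp_id]
  · rw [← cancel_epi p, ← Category.assoc, hy, hz, Category.comp_id]
  · simp
  · simp [hz]

theorem deflation_of_isIso (f : A ⟶ B) [IsIso f] : N.Deflation f := by
  obtain ⟨K, k, hk⟩ := exact.deflation_id A
  exact ⟨K, k, exact.conf_of_iso (Iso.refl _) (Iso.refl _) (asIso f) (by simp) (by simp) hk⟩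

theorem deflation_iso (e : A ≅ B) : N.Deflation e.hom := deflation_of_isIso _

theorem deflation_zero (hC : IsZero C) (p : B ⟶ C) : N.Deflation p := by
  obtain ⟨K, k, hk⟩ := exact.inflation_id B
  have hK : IsZero K := by
    have := conf_epi hk
    rw [IsZero.iff_id_eq_zero, ← cancel_epi k, comp_zero]
    have := conf_w hk
    rw [Category.id_comp] at this
    simp [this]
  exact ⟨B, 𝟙 B, exact.conf_of_iso (Iso.refl _) (Iso.refl _) (hK.iso hC) (by simp)
    (hC.eq_of_tgt _ _) hk⟩

theorem deflation_of_isPullback {P : N.carrier} {f' : P ⟶ B} {p' : P ⟶ A} {f : A ⟶ C}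
    (h : N.Deflation p) (hP : IsPullback f' p' p f) : N.Deflation p' := by
  obtain ⟨B', f₁, p₁, h₁, h₂⟩ := exact.deflation_pullback p f h
  have e : (hP.isoIsPullback _ _ h₁).hom ≫ p₁ = p' := hP.isoIsPullback_hom_snd _ _ h₁
  rw [← e]
  exact exact.deflation_comp _ _ (deflation_of_isIso _) h₂

/-- The splitting makes B the product of A and C, so p is the base change of the deflation A ⟶ 0
along C ⟶ 0. -/
theorem conf_split (r : B ⟶ A) (s : C ⟶ B) (hir : i ≫ r = 𝟙 A) (hsp : s ≫ p = 𝟙 C)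
    (hip : i ≫ p = 0) (tot : r ≫ i + p ≫ s = 𝟙 B) : N.conf i p := by
  have hsr : s ≫ r = 0 := by
    have : s ≫ (r ≫ i + p ≫ s) ≫ r = s ≫ r := by rw [tot, Category.id_comp]
    simp only [Preadditive.add_comp, Preadditive.comp_add, Category.assoc, hir] at this
    rw [← Category.assoc s p, hsp] at this
    simpa using this
  have hP : IsPullback r p (0 : A ⟶ (0 : N.carrier)) (0 : C ⟶ (0 : N.carrier)) :=
    ⟨⟨by simp⟩, ⟨PullbackCone.IsLimit.mk _ (fun c => c.fst ≫ i + c.snd ≫ s)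
      (fun c => by simp [hir, hsr]) (fun c => by simp [hip, hsp])
      (fun c m h1 h2 => by
        rw [← h1, ← h2, Category.assoc, Category.assoc, ← Preadditive.comp_add, tot,
          Category.comp_id])⟩⟩
  have : Mono i := ⟨fun a b hab => by
    simpa [hir] using congrArg (fun t => t ≫ r) hab⟩
  refine conf_of_deflation (deflation_of_isPullback (deflation_zero (isZero_zero _) _) hP) hip ?_
  intro T x hx
  refine ⟨x ≫ r, ?_⟩
  have : x ≫ (r ≫ i + p ≫ s) = x := by rw [tot, Category.comp_id]
  rw [Preadditive.comp_add, ← Category.assoc x p, hx] at this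
  simpa using this

theorem conf_biprod (A C : N.carrier) :
    N.conf (biprod.inl : A ⟶ A ⊞ C) (biprod.snd : A ⊞ C ⟶ C) :=
  conf_split biprod.fst biprod.inr (by simp) (by simp) (by simp) biprod.total

theorem conf_biprod' (A C : N.carrier) :
    N.conf (biprod.inr : C ⟶ A ⊞ C) (biprod.fst : A ⊞ C ⟶ A) :=
  conf_split biprod.snd biprod.inl (by simp) (by simp) (by simp)
    (by rw [add_comm]; exact biprod.total)

theorem conf_iso_zero (f : A ⟶ B) [IsIso f] (hC : IsZero C) (p : B ⟶ C) : N.conf f p :=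
  conf_split (inv f) 0 (by simp) (hC.eq_of_src _ _) (hC.eq_of_tgt _ _) (by simp)

theorem conf_zero_iso (hA : IsZero A) (i : A ⟶ B) (f : B ⟶ C) [IsIso f] : N.conf i f :=
  conf_split 0 (inv f) (hA.eq_of_src _ _) (by simp) (hA.eq_of_src _ _) (by simp)

/-- If a morphism has a kernel and some composite with it is a deflation, it is a deflation. -/
theorem deflation_of_comp_of_kernel {K : N.carrier} (k : K ⟶ B) [Mono k] (w : k ≫ p = 0)
    (hl : ∀ {T : N.carrier} (x : T ⟶ B), x ≫ p = 0 → ∃ y, y ≫ k = x) (f : A ⟶ B)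
    (h : N.Deflation (f ≫ p)) : N.Deflation p := by
  -- the map `(p, 0) : B ⊞ A ⟶ C` is a deflation
  have h1 : N.Deflation (biprod.map (𝟙 B) (f ≫ p)) := by
    refine deflation_of_isPullback (p := f ≫ p) (f' := biprod.snd) (f := biprod.snd) h
      ⟨⟨by simp⟩, ⟨PullbackCone.IsLimit.mk _ (fun c => biprod.lift (c.snd ≫ biprod.fst) c.fst)
        (fun c => by simp) (fun c => ?_) (fun c m h1 h2 => ?_)⟩⟩
    · have := c.condition
      ext <;> simp [this]
    · ext
      · simpa using congrArg (fun t => t ≫ biprod.fst) h2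
      · simpa using h1
  have h2 : N.Deflation (biprod.desc p (𝟙 C)) := by
    have : biprod.desc p (𝟙 C) =
        (Iso.mk (biprod.lift biprod.fst (biprod.desc p (𝟙 C)))
          (biprod.lift biprod.fst (biprod.desc (-p) (𝟙 C)))
          (by ext <;> simp) (by ext <;> simp) : B ⊞ C ≅ B ⊞ C).hom ≫ biprod.snd := by simp
    rw [this]
    exact exact.deflation_comp _ _ (deflation_iso _) ⟨_, _, conf_biprod _ _⟩
  have h3 : N.Deflation (biprod.desc p (0 : A ⟶ C)) := by
    -- The shear (b, a) ↦ (b - f a, a) comes first: its term - f a cancels the contribution of a to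
    -- the deflation (b, a) ↦ p b + p (f a).
    have : biprod.desc p (0 : A ⟶ C) =
        (Iso.mk (biprod.desc biprod.inl (biprod.lift (-f) (𝟙 A)))
          (biprod.desc biprod.inl (biprod.lift f (𝟙 A)))
          (by ext <;> simp) (by ext <;> simp) : B ⊞ A ≅ B ⊞ A).hom ≫
          biprod.map (𝟙 B) (f ≫ p) ≫ biprod.desc p (𝟙 C) := by
      ext
      · simp
      · have e : biprod.map (𝟙 B) (f ≫ p) ≫ biprod.desc p (𝟙 C) = biprod.desc p (f ≫ p) := by
          ext <;> simp
        rw [e]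
        simp [biprod.lift_desc]
    rw [this]
    exact exact.deflation_comp _ _ (deflation_iso _) (exact.deflation_comp _ _ h1 h2)
  have h4 : N.conf (biprod.map k (𝟙 A)) (biprod.desc p (0 : A ⟶ C)) := by
    have : Mono (biprod.map k (𝟙 A)) := ⟨fun a b hab => by
      have e1 := congrArg (fun t => t ≫ biprod.fst) hab
      have e2 := congrArg (fun t => t ≫ biprod.snd) hab
      simp only [Category.assoc, biprod.map_fst, biprod.map_snd, Category.comp_id] at e1 e2
      rw [← Category.assoc, ← Category.assoc, cancel_mono] at e1
      ext
      · exact e1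
      · exact e2⟩
    refine conf_of_deflation h3 (by ext <;> simp [w]) ?_
    intro T x hx
    obtain ⟨y, hy⟩ := hl (x ≫ biprod.fst) (by
      rw [← hx, Category.assoc]
      congr 1
      ext <;> simp)
    refine ⟨biprod.lift y (x ≫ biprod.snd), ?_⟩
    ext
    · simp [hy]
    · simp
  -- It remains to see that k itself is an inflation. It is the pushout of k ⊕ 1 along the
  -- projection K ⊞ A ⟶ K, and inflations are stable under pushout.
  obtain ⟨B', g, i', hP, hi'⟩ := exact.inflation_pushout (biprod.map k (𝟙 A)) biprod.fst ⟨_, _, h4⟩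
  have := inflation_mono hi'
  -- the pushout is `B`
  obtain ⟨φ, hφ1, hφ2⟩ : ∃ φ : B' ⟶ B, g ≫ φ = biprod.fst ∧ i' ≫ φ = k :=
    ⟨hP.desc biprod.fst k (by ext <;> simp), by simp, by simp⟩
  have hφ3 : φ ≫ biprod.inl ≫ g = 𝟙 B' := by
    apply hP.hom_ext
    · rw [← Category.assoc, hφ1]
      ext
      · simp
      · have := congrArg (fun t => biprod.inr ≫ t) hP.w
        simp only [biprod.inr_map_assoc, biprod.inr_fst_assoc, zero_comp] at this
        simp at this
        simp [this]
    · rw [← Category.assoc, hφ2]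
      have := congrArg (fun t => biprod.inl ≫ t) hP.w
      simp at this
      simp [this]
  have : IsIso φ := ⟨⟨_, hφ3, by simp [hφ1]⟩⟩
  have h5 : N.Inflation k := by
    obtain ⟨D, q, hq⟩ := hi'
    exact ⟨D, inv φ ≫ q, exact.conf_of_iso (Iso.refl _) (asIso φ) (Iso.refl _) (by simp [hφ2])
      (by simp) hq⟩
  have : Epi p := by
    have := deflation_epi h
    exact epi_of_epi f p
  refine ⟨K, k, conf_of_inflation h5 w ?_⟩
  intro T x hx
  obtain ⟨y, hy⟩ := conf_desc h4 (biprod.desc x 0) (by ext <;> simp [hx])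
  exact ⟨y, by simpa using congrArg (fun t => biprod.inl ≫ t) hy⟩

/-- In an exact category that supports long exact sequences, `p` is a deflation as soon as some
composite `f ≫ p` is. -/
theorem deflation_of_comp (f : A ⟶ B) (h : N.Deflation (f ≫ p)) : N.Deflation p := by
  obtain ⟨P, π, q, hP, hq⟩ := exact.deflation_pullback (f ≫ p) p h
  -- `hP : π ≫ f ≫ p = q ≫ p`
  obtain ⟨s, hs1, hs2⟩ : ∃ s : A ⟶ P, s ≫ π = 𝟙 A ∧ s ≫ q = f :=
    ⟨hP.lift (𝟙 A) f (by simp), by simp, by simp⟩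
  -- The projection π has the section (1, f), so the hypothesis on retractions applies. The kernel
  -- of π, mapped to B, is a kernel of p.
  have : HasKernel π := les π s hs1
  have : Mono (kernel.ι π ≫ q) := ⟨fun a b hab => by
    rw [← cancel_mono (kernel.ι π)]
    apply hP.hom_ext
    · simp
    · simpa using hab⟩
  refine deflation_of_comp_of_kernel (kernel.ι π ≫ q) ?_ ?_ f h
  · rw [Category.assoc, ← hP.w, ← Category.assoc, kernel.condition, zero_comp]
  · intro T x hx
    refine ⟨kernel.lift π (hP.lift 0 x (by simp [hx])) (by simp), by simp⟩

end GoodExact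

namespace GoodExact

variable (N : ConflationCat.{v, u}) [GoodExact N]

/-! ### The embedding into abelian sheaves -/

/-- The topology on an exact category whose covering sieves are those containing a deflation. -/
def deflationTopology : GrothendieckTopology N.carrier where
  sieves X := {S | ∃ (Y : N.carrier) (q : Y ⟶ X), N.Deflation q ∧ S q}
  top_mem' X := ⟨X, 𝟙 X, exact.deflation_id X, trivial⟩
  pullback_stable' X X' S f := by
    rintro ⟨Y, q, hq, hS⟩
    obtain ⟨B', f', p', h, h'⟩ := exact.deflation_pullback q f hq
    refine ⟨B', p', h', ?_⟩
    change S (p' ≫ f)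
    rw [← h.w]
    exact S.downward_closed hS f'
  transitive' X S := by
    rintro ⟨Y, q, hq, hS⟩ R hR
    obtain ⟨Z, q', hq', hR'⟩ := hR hS
    exact ⟨Z, q' ≫ q, exact.deflation_comp _ _ hq' hq, hR'⟩

/-- The presheaf of abelian groups represented by an object. -/
def yonedaPresheaf (A : N.carrier) : N.carrierᵒᵖ ⥤ AddCommGrpCat.{max u v} where
  obj X := AddCommGrpCat.of (ULift.{max u v} (X.unop ⟶ A))
  map f := AddCommGrpCat.ofHom
    { toFun := fun g => ⟨f.unop ≫ g.down⟩
      map_zero' := by ext; simp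
      map_add' := fun a b => by ext; simp }

/-- A deflation q is the cokernel of its kernel k. Compatibility of the family on the pair k, 0
shows that its value at q kills k, so it descends to X. Agreement with the family on any other f is
checked after pulling the covering q back along f. -/
theorem yonedaPresheaf_isSheaf (A : N.carrier) :
    Presheaf.IsSheaf (deflationTopology N) (yonedaPresheaf N A) := by
  rw [Presheaf.isSheaf_iff_isSheaf_forget _ _ (forget AddCommGrpCat.{max u v}),
    isSheaf_iff_isSheaf_of_type]
  rintro X S ⟨Y, q, hq, hS⟩ x hx
  have hqe := deflation_epi hq
  obtain ⟨K, k, hk⟩ := id hq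
  have hcomp : ∀ {Y₁ Y₂ Z : N.carrier} (g₁ : Z ⟶ Y₁) (g₂ : Z ⟶ Y₂) (f₁ : Y₁ ⟶ X) (f₂ : Y₂ ⟶ X)
      (h₁ : S f₁) (h₂ : S f₂), g₁ ≫ f₁ = g₂ ≫ f₂ →
        g₁ ≫ (x f₁ h₁ : ULift.{max u v} (Y₁ ⟶ A)).down = g₂ ≫ (x f₂ h₂ : ULift (Y₂ ⟶ A)).down :=
    fun g₁ g₂ f₁ f₂ h₁ h₂ h => congrArg ULift.down (hx g₁ g₂ h₁ h₂ h)
  obtain ⟨y, hy⟩ := conf_desc hk (x q hS : ULift.{max u v} (Y ⟶ A)).down (by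
    have := hcomp k 0 q q hS hS (by rw [conf_w hk, zero_comp])
    rwa [zero_comp] at this)
  refine ⟨(⟨y⟩ : ULift.{max u v} (X ⟶ A)), ?_, ?_⟩
  · intro Z f hf
    refine ULift.ext _ _ ?_
    change f ≫ y = (x f hf : ULift.{max u v} (Z ⟶ A)).down
    obtain ⟨B', f', p', h, h'⟩ := exact.deflation_pullback q f hq
    have := deflation_epi h'
    rw [← cancel_epi p', ← hcomp f' p' q f hS hf h.w, ← hy, ← Category.assoc, ← h.w,
      Category.assoc]
  · intro z hz
    refine ULift.ext _ _ ?_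
    have h1 : q ≫ (z : ULift.{max u v} (X ⟶ A)).down = _ := congrArg ULift.down (hz q hS)
    rw [← cancel_epi q]
    exact h1.trans hy.symm

/-- The Yoneda embedding of an exact category into abelian sheaves. -/
def sheafYoneda : N.carrier ⥤ Sheaf (deflationTopology N) AddCommGrpCat.{max u v} where
  obj A := ⟨yonedaPresheaf N A, yonedaPresheaf_isSheaf N A⟩
  map f := ⟨{ app := fun X => AddCommGrpCat.ofHom
                { toFun := fun g => ⟨g.down ≫ f⟩
                  map_zero' := by ext; simp
                  map_add' := fun a b => by ext; simp }
              naturality := fun X Y g => by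
                ext x
                exact ULift.ext _ _ (Category.assoc _ _ _) }⟩
  map_id A := by
    ext X x
    exact ULift.ext _ _ (Category.comp_id _)
  map_comp f g := by
    ext X x
    exact ULift.ext _ _ (Category.assoc _ _ _).symm

instance : (sheafYoneda N).Additive where
  map_add {A B f g} := by
    ext X x
    exact ULift.ext _ _ (Preadditive.comp_add _ _ _ _ _ _)

theorem sheafYoneda_map_app {A B : N.carrier} (f : A ⟶ B) (X : N.carrier) (g : X ⟶ A) :
    ((((sheafYoneda N).map f).hom.app (Opposite.op X)).hom (⟨g⟩ : ULift (X ⟶ A)) :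
      ULift.{max u v} (X ⟶ B)) = ⟨g ≫ f⟩ := rfl

def sheafYonedaFullyFaithful : (sheafYoneda N).FullyFaithful where
  preimage {A B} α := ((α.hom.app (Opposite.op A)).hom (⟨𝟙 A⟩ : ULift (A ⟶ A)) :
      ULift.{max u v} (A ⟶ B)).down
  map_preimage {A B} α := by
    ext X x
    refine ULift.ext _ _ ?_
    have h := ConcreteCategory.congr_hom (α.hom.naturality
      ((x : ULift (X.unop ⟶ A)).down.op : Opposite.op A ⟶ X)) (⟨𝟙 A⟩ : ULift (A ⟶ A))
    have h' := congrArg (fun t : ULift.{max u v} (X.unop ⟶ B) => t.down) h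
    refine Eq.trans h'.symm ?_
    have : (((yonedaPresheaf N A).map (x : ULift (X.unop ⟶ A)).down.op).hom
        (⟨𝟙 A⟩ : ULift (A ⟶ A)) : ULift (X.unop ⟶ A)) = x :=
      ULift.ext _ _ (Category.comp_id _)
    exact congrArg (fun t => ((α.hom.app X).hom t : ULift.{max u v} (X.unop ⟶ B)).down) this
  preimage_map f := Category.id_comp _

instance : (sheafYoneda N).Full := (sheafYonedaFullyFaithful N).full
instance : (sheafYoneda N).Faithful := (sheafYonedaFullyFaithful N).faithful

variable {N} {A B C : N.carrier} {i : A ⟶ B} {p : B ⟶ C}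

/-- An epimorphism of sheaves lifts the identity of C only locally, that is, along a deflation of
the form t ≫ p. Concluding that p is itself a deflation is where the support of long exact sequences
enters, through `deflation_of_comp`. -/
theorem epi_sheafYoneda_map_iff : Epi ((sheafYoneda N).map p) ↔ N.Deflation p := by
  rw [← Sheaf.isLocallySurjective_iff_epi']
  constructor
  · intro h
    obtain ⟨Y, q, hq, ⟨t, ht⟩⟩ := Presheaf.imageSieve_mem (deflationTopology N)
      ((sheafYoneda N).map p).hom (U := Opposite.op C) (⟨𝟙 C⟩ : ULift.{max u v} (C ⟶ C))
    have h' : (t : ULift (Y ⟶ B)).down ≫ p = q ≫ 𝟙 C := congrArg ULift.down ht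
    rw [Category.comp_id] at h'
    rw [← h'] at hq
    exact deflation_of_comp _ hq
  · intro h
    refine ⟨fun {U} s => ?_⟩
    obtain ⟨B', f', p', h, h'⟩ := exact.deflation_pullback p (s : ULift (U ⟶ C)).down h
    exact ⟨B', p', h', (⟨f'⟩ : ULift (B' ⟶ B)), ULift.ext _ _ h.w⟩

/-- Sections of a representable sheaf are morphisms of N, so the lifting is done section by section.
Since i is a monomorphism, the liftings are unique and hence additive and natural. This lets the
embedding preserve kernels against an arbitrary sheaf T. -/
theorem exists_lift_sheafYoneda [Mono i]
    (h : ∀ {T : N.carrier} (x : T ⟶ B), x ≫ p = 0 → ∃ y, y ≫ i = x) {T : Sheaf (deflationTopology N) AddCommGrpCat}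
    (g : T ⟶ (sheafYoneda N).obj B) (hg : g ≫ (sheafYoneda N).map p = 0) :
    ∃ g' : T ⟶ (sheafYoneda N).obj A, g' ≫ (sheafYoneda N).map i = g := by
  let G : ∀ X, T.obj.obj X → (X.unop ⟶ B) := fun X x => ((g.hom.app X).hom x : ULift (_ ⟶ B)).down
  have hG : ∀ X (x : T.obj.obj X), G X x ≫ p = 0 := fun X x => by
    have h1 := congrArg (fun t => (t.hom.app X)) hg
    exact congrArg ULift.down (ConcreteCategory.congr_hom h1 x)
  choose l hl using fun X (x : T.obj.obj X) => h (G X x) (hG X x)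
  let α : ∀ X, T.obj.obj X ⟶ (yonedaPresheaf N A).obj X := fun X => AddCommGrpCat.ofHom
    { toFun := fun x => (⟨l X x⟩ : ULift (X.unop ⟶ A))
      map_zero' := ?_
      map_add' := ?_ }
  · refine ⟨⟨⟨α, ?_⟩⟩, ?_⟩
    · intro X Y f
      ext x
      refine ULift.ext _ _ ?_
      change l Y ((T.obj.map f).hom x) = f.unop ≫ l X x
      rw [← cancel_mono i, hl, Category.assoc, hl]
      exact congrArg ULift.down (ConcreteCategory.congr_hom (g.hom.naturality f) x)
    · ext X x
      exact ULift.ext _ _ (hl X x)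
  · refine ULift.ext _ _ ?_
    change l X 0 = 0
    rw [← cancel_mono i, hl, zero_comp]
    exact congrArg ULift.down (map_zero (g.hom.app X).hom)
  · intro x y
    refine ULift.ext _ _ ?_
    change l X (x + y) = l X x + l X y
    rw [← cancel_mono i, hl, Preadditive.add_comp, hl, hl]
    exact congrArg ULift.down (map_add (g.hom.app X).hom x y)

instance [Mono i] : Mono ((sheafYoneda N).map i) := by
  refine ⟨fun {T} a b hab => ?_⟩
  ext X x
  refine ULift.ext _ _ ?_
  have h2 := congrArg (fun t => (t.hom.app X)) hab
  have h3 := congrArg ULift.down (ConcreteCategory.congr_hom h2 x)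
  exact (cancel_mono i).1 h3

/-- A sequence in an exact category supporting long exact sequences is a conflation if and only if
it becomes short exact in the category of sheaves. -/
theorem conf_iff_shortExact (w : i ≫ p = 0) :
    N.conf i p ↔ ((ShortComplex.mk i p w).map (sheafYoneda N)).ShortExact := by
  have key : ∀ {A : N.carrier} {i : A ⟶ B} (w : i ≫ p = 0), N.conf i p →
      ((ShortComplex.mk i p w).map (sheafYoneda N)).ShortExact := by
    intro A i w h
    have hi := conf_mono h
    have h1 : Mono ((sheafYoneda N).map i) := inferInstance
    have h2 : Epi ((sheafYoneda N).map p) := epi_sheafYoneda_map_iff.2 ⟨_, _, h⟩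
    refine ShortComplex.ShortExact.mk' (ShortComplex.exact_of_f_is_kernel _ ?_) h1 h2
    have : Mono ((ShortComplex.mk i p w).map (sheafYoneda N)).f := h1
    exact KernelFork.IsLimit.ofι' _ _ fun g hg =>
      ⟨_, (exists_lift_sheafYoneda (fun x hx => conf_lift h x hx) g hg).choose_spec⟩
  refine ⟨key w, fun h => ?_⟩
  -- Now p is a deflation, with some kernel k. Both i and k become kernels of the same map of
  -- sheaves, so the comparison t becomes an isomorphism, and full faithfulness reflects this.
  obtain ⟨K, k, hk⟩ := epi_sheafYoneda_map_iff.1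
    (show Epi ((sheafYoneda N).map p) from h.epi_g)
  obtain ⟨t, ht⟩ := conf_lift hk i w
  have h' := key (conf_w hk) hk
  have hm₀ := h.mono_f
  have hm : Mono ((sheafYoneda N).map i) := h.mono_f
  have hm' : Mono ((sheafYoneda N).map k) := h'.mono_f
  have hs : ∃ s, s ≫ (sheafYoneda N).map i = (sheafYoneda N).map k :=
    ⟨_, (KernelFork.IsLimit.lift' h.exact.fIsKernel ((sheafYoneda N).map k) 
      (((sheafYoneda N).map_comp k p).symm.trans (by rw [conf_w hk, Functor.map_zero]; rfl))).2⟩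
  obtain ⟨s, hs⟩ := hs
  have hiso : IsIso ((sheafYoneda N).map t) := by
    refine ⟨s, ?_, ?_⟩
    · rw [← cancel_mono ((sheafYoneda N).map i), Category.assoc, hs, ← Functor.map_comp, ht,
        Category.id_comp]
    · rw [← cancel_mono ((sheafYoneda N).map k), Category.assoc, ← Functor.map_comp, ht, hs,
        Category.id_comp]
  have : IsIso t := isIso_of_reflects_iso t (sheafYoneda N)
  exact exact.conf_of_iso (asIso t).symm (Iso.refl _) (Iso.refl _) (by simp [← ht]) (by simp) hk

end GoodExact

namespace GoodExact

/-! ### Acyclic complexes -/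

section

variable {N : ConflationCat.{v, u}} [GoodExact N]

/-- The complex of sheaves associated with a complex. -/
abbrev sheafComplex (K : ChainComplex N.carrier ℤ) :
    ChainComplex (Sheaf (deflationTopology N) AddCommGrpCat.{max u v}) ℤ :=
  ((sheafYoneda N).mapHomologicalComplex (ComplexShape.down ℤ)).obj K

/-- The degree is written i - 1 so that its neighbours are literally i and i - 1 - 1, in the form in
which `Acyclic` uses the differentials. -/
theorem exactAt_sheafComplex_iff (K : ChainComplex N.carrier ℤ) (i : ℤ) :
    (sheafComplex K).ExactAt (i - 1) ↔
      ∀ ⦃A⦄ (x : A ⟶ (sheafYoneda N).obj (K.X (i - 1))),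
        x ≫ (sheafYoneda N).map (K.d (i - 1) (i - 1 - 1)) = 0 →
        ∃ (A' : _) (π : A' ⟶ A) (_ : Epi π) (y : A' ⟶ (sheafYoneda N).obj (K.X i)),
          π ≫ x = y ≫ (sheafYoneda N).map (K.d i (i - 1)) :=
  (sheafComplex K).exactAt_iff_exact_up_to_refinements i (i - 1) (i - 1 - 1) (by simp) (by simp)

theorem exactAt_of_acyclic {K : ChainComplex N.carrier ℤ} (h : Acyclic N K) (i : ℤ) :
    (sheafComplex K).ExactAt i := by
  obtain ⟨i, rfl⟩ : ∃ j, i = j - 1 := ⟨i + 1, by simp⟩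
  obtain ⟨Z, j, q, h, h'⟩ := h
  rw [exactAt_sheafComplex_iff]
  intro A x hx
  have h1 := conf_mono (h (i - 1))
  have h2 := conf_mono (h (i - 1 - 1))
  rw [h', Functor.map_comp, ← Category.assoc] at hx
  obtain ⟨y, rfl⟩ := exists_lift_sheafYoneda (i := j (i - 1)) (p := q (i - 1))
    (fun x hx => conf_lift (h (i - 1)) x hx) x (by
      rw [← cancel_mono ((sheafYoneda N).map (j (i - 1 - 1))), hx, zero_comp])
  have : Epi ((sheafYoneda N).map (q i)) := epi_sheafYoneda_map_iff.2 ⟨_, _, h i⟩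
  obtain ⟨A', π, hπ, z, hz⟩ :=
    surjective_up_to_refinements_of_epi ((sheafYoneda N).map (q i)) y
  refine ⟨A', π, hπ, z, ?_⟩
  rw [← Category.assoc, hz, h', Functor.map_comp, Category.assoc]

/-- A local section of Z is a cycle through j, hence a boundary after a covering by exactness.
Cancelling j shows that it lifts locally along q. -/
theorem deflation_of_exactAt {K : ChainComplex N.carrier ℤ} {i : ℤ}
    (h : (sheafComplex K).ExactAt (i - 1)) {Z : N.carrier} (j : Z ⟶ K.X (i - 1)) [Mono j]
    (hj : j ≫ K.d (i - 1) (i - 1 - 1) = 0) (q : K.X i ⟶ Z) (hq : q ≫ j = K.d i (i - 1)) :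
    N.Deflation q := by
  rw [← epi_sheafYoneda_map_iff, epi_iff_surjective_up_to_refinements]
  intro A y
  rw [exactAt_sheafComplex_iff] at h
  obtain ⟨A', π, hπ, z, hz⟩ := h (y ≫ (sheafYoneda N).map j)
    (by rw [Category.assoc, ← Functor.map_comp, hj, Functor.map_zero, comp_zero])
  refine ⟨A', π, hπ, z, ?_⟩
  rw [← cancel_mono ((sheafYoneda N).map j), Category.assoc, hz, Category.assoc,
    ← Functor.map_comp, hq]

/-- The objects of cycles are constructed upwards from the lower bound. Once the kernel of one
differential exists, the next differential factors through it by a deflation, and the kernel of that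
deflation is the next object of cycles. -/
theorem acyclic_of_exactAt {K : ChainComplex N.carrier ℤ} (hK : GradedBounded K.X)
    (h : ∀ i, (sheafComplex K).ExactAt i) : Acyclic N K := by
  have key : ∀ i, ∃ (Z : N.carrier) (j : Z ⟶ K.X i), Mono j ∧ j ≫ K.d i (i - 1) = 0 ∧
      ∀ {T : N.carrier} (x : T ⟶ K.X i), x ≫ K.d i (i - 1) = 0 → ∃ y, y ≫ j = x := by
    obtain ⟨a, b, hab⟩ := hK
    have low : ∀ i, i < a → ∃ (Z : N.carrier) (j : Z ⟶ K.X i), Mono j ∧ j ≫ K.d i (i - 1) = 0 ∧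
        ∀ {T : N.carrier} (x : T ⟶ K.X i), x ≫ K.d i (i - 1) = 0 → ∃ y, y ≫ j = x := by
      intro i hi
      refine ⟨K.X i, 𝟙 _, inferInstance, (hab i (Or.inl hi)).eq_of_src _ _, fun x _ => ⟨x, by simp⟩⟩
    intro i
    rcases lt_or_ge i a with hi | hi
    · exact low i hi
    -- The induction starts at a - 1, the last degree in which the lower bound forces the complex to
    -- vanish, so that the whole term serves as its own kernel.
    · have hia : a - 1 ≤ i := by omega
      clear hi
      induction i, hia using Int.leInduction with
      | base => exact low _ (by omega)
      | succ n hn ih => ?_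
      obtain ⟨n, rfl⟩ : ∃ m, n = m - 1 := ⟨n + 1, by simp⟩
      rw [show n - 1 + 1 = n by omega]
      obtain ⟨Z, j, hj, hj', hl⟩ := ih
      obtain ⟨q, hq⟩ := hl (K.d n (n - 1)) (by simp)
      obtain ⟨Z', j', hc⟩ := deflation_of_exactAt (h (n - 1)) j hj' q hq
      refine ⟨Z', j', conf_mono hc, ?_, ?_⟩
      · rw [← hq, ← Category.assoc, conf_w hc, zero_comp]
      · intro T x hx
        refine conf_lift hc x ?_
        rw [← cancel_mono j, Category.assoc, hq, hx, zero_comp]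
  choose Z j hj hj' hl using key
  choose q hq using fun i => hl (i - 1) (K.d i (i - 1)) (by simp)
  refine ⟨Z, j, q, fun i => ?_, fun i => (hq i).symm⟩
  have := hj (i - 1)
  refine conf_of_deflation (deflation_of_exactAt (h (i - 1)) (j (i - 1)) (hj' _) (q i) (hq i)) ?_ ?_
  · rw [← cancel_mono (j (i - 1)), Category.assoc, hq, hj', zero_comp]
  · intro T x hx
    refine hl i x ?_
    rw [← hq, ← Category.assoc, hx, zero_comp]

theorem acyclic_iff_exactAt {K : ChainComplex N.carrier ℤ} (hK : GradedBounded K.X) :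
    Acyclic N K ↔ ∀ i, (sheafComplex K).ExactAt i :=
  ⟨exactAt_of_acyclic, acyclic_of_exactAt hK⟩

end

/-! ### Two-out-of-three for acyclic complexes -/

/-- Degreewise short exact sequences of complexes. -/
def ConfC (N : ConflationCat.{v, u}) {K L P : ChainComplex N.carrier ℤ} (f : K ⟶ L)
    (g : L ⟶ P) : Prop :=
  ∀ n, N.conf (f.f n) (g.f n)

section

variable {N : ConflationCat.{v, u}} [GoodExact N]
variable {K L P : ChainComplex N.carrier ℤ} {f : K ⟶ L} {g : L ⟶ P}

theorem ConfC.w (h : ConfC N f g) : f ≫ g = 0 := by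
  ext n
  exact conf_w (h n)

theorem ConfC.shortExact (h : ConfC N f g) :
    ((ShortComplex.mk f g h.w).map
      ((sheafYoneda N).mapHomologicalComplex (ComplexShape.down ℤ))).ShortExact :=
  HomologicalComplex.shortExact_of_degreewise_shortExact _ fun n =>
    (conf_iff_shortExact (conf_w (h n))).1 (h n)

/-- This and its two companions are read off the long exact homology sequence in sheaves.
Boundedness is needed only for the complex whose acyclicity is being proved. -/
theorem ConfC.acyclic₂ (h : ConfC N f g) (hL : GradedBounded L.X) (h₁ : Acyclic N K)
    (h₃ : Acyclic N P) : Acyclic N L := by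
  rw [acyclic_iff_exactAt hL]
  intro i
  rw [HomologicalComplex.exactAt_iff_isZero_homology]
  exact (h.shortExact.homology_exact₂ i).isZero_of_both_isZero
    ((exactAt_of_acyclic h₁ i).isZero_homology) ((exactAt_of_acyclic h₃ i).isZero_homology)

theorem ConfC.acyclic₃ (h : ConfC N f g) (hP : GradedBounded P.X) (h₁ : Acyclic N K)
    (h₂ : Acyclic N L) : Acyclic N P := by
  rw [acyclic_iff_exactAt hP]
  intro i
  rw [HomologicalComplex.exactAt_iff_isZero_homology]
  exact (h.shortExact.homology_exact₃ i (i - 1) (by simp)).isZero_of_both_isZero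
    ((exactAt_of_acyclic h₂ i).isZero_homology) ((exactAt_of_acyclic h₁ (i - 1)).isZero_homology)

theorem ConfC.acyclic₁ (h : ConfC N f g) (hK : GradedBounded K.X) (h₂ : Acyclic N L)
    (h₃ : Acyclic N P) : Acyclic N K := by
  rw [acyclic_iff_exactAt hK]
  intro i
  rw [HomologicalComplex.exactAt_iff_isZero_homology]
  exact (h.shortExact.homology_exact₁ (i + 1) i (by simp)).isZero_of_both_isZero
    ((exactAt_of_acyclic h₃ (i + 1)).isZero_homology) ((exactAt_of_acyclic h₂ i).isZero_homology)

theorem acyclic_of_iso (e : K ≅ L) (h : Acyclic N K) : Acyclic N L := by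
  obtain ⟨Z, j, q, h, h'⟩ := h
  let ei : ∀ i, K.X i ≅ L.X i := fun i => (HomologicalComplex.eval _ _ i).mapIso e
  refine ⟨Z, fun i => j i ≫ (ei i).hom, fun i => (ei i).inv ≫ q i, fun i => ?_, fun i => ?_⟩
  · exact exact.conf_of_iso (Iso.refl _) (ei i) (Iso.refl _) (by simp) (by simp) (h i)
  · rw [Category.assoc, ← Category.assoc (q i), ← h']
    change _ = e.inv.f i ≫ K.d i (i - 1) ≫ e.hom.f (i - 1)
    rw [← e.hom.comm, ← Category.assoc, ← HomologicalComplex.comp_f,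
      e.inv_hom_id, HomologicalComplex.id_f, Category.id_comp]

/-- The sum of two deflations is a composite of base changes of each of them, hence a deflation; its
kernel is computed componentwise. -/
theorem conf_biprod_map {A B C A' B' C' : N.carrier} {i : A ⟶ B} {p : B ⟶ C} {i' : A' ⟶ B'}
    {p' : B' ⟶ C'} (h : N.conf i p) (h' : N.conf i' p') :
    N.conf (biprod.map i i') (biprod.map p p') := by
  have := conf_mono h
  have := conf_mono h'
  have hm : Mono (biprod.map i i') := ⟨fun a b hab => by
    have e1 := congrArg (fun t => t ≫ biprod.fst) hab
    have e2 := congrArg (fun t => t ≫ biprod.snd) hab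
    simp only [Category.assoc, biprod.map_fst, biprod.map_snd] at e1 e2
    rw [← Category.assoc, ← Category.assoc, cancel_mono] at e1 e2
    ext
    · exact e1
    · exact e2⟩
  have hd : ∀ {B B' C C' : N.carrier} {p : B ⟶ C} {p' : B' ⟶ C'}, N.Deflation p →
      N.Deflation (biprod.map p (𝟙 C')) := fun {B B' C C' p p'} h =>
    deflation_of_isPullback (p := p) (f' := biprod.fst) (f := biprod.fst) h
      ⟨⟨by simp⟩, ⟨PullbackCone.IsLimit.mk _ (fun c => biprod.lift c.fst (c.snd ≫ biprod.snd))
        (fun c => by simp) (fun c => by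
          have := c.condition
          ext <;> simp [this]) (fun c m h1 h2 => by
            ext
            · simpa using h1
            · simpa using congrArg (fun t => t ≫ biprod.snd) h2)⟩⟩
  have hd' : ∀ {B B' C C' : N.carrier} {p : B ⟶ C} {p' : B' ⟶ C'}, N.Deflation p' →
      N.Deflation (biprod.map (𝟙 B) p') := fun {B B' C C' p p'} h =>
    deflation_of_isPullback (p := p') (f' := biprod.snd) (f := biprod.snd) h
      ⟨⟨by simp⟩, ⟨PullbackCone.IsLimit.mk _ (fun c => biprod.lift (c.snd ≫ biprod.fst) c.fst)
        (fun c => by simp) (fun c => by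
          have := c.condition
          ext <;> simp [this]) (fun c m h1 h2 => by
            ext
            · simpa using congrArg (fun t => t ≫ biprod.fst) h2
            · simpa using h1)⟩⟩
  have hdefl : N.Deflation (biprod.map p p') := by
    have : biprod.map p p' = biprod.map (𝟙 B) p' ≫ biprod.map p (𝟙 C') := by ext <;> simp
    rw [this]
    exact exact.deflation_comp _ _ (hd' (C := C) (p := p) ⟨_, _, h'⟩)
      (hd (B' := B') (p' := p') ⟨_, _, h⟩)
  refine conf_of_deflation hdefl (by ext <;> simp [conf_w h, conf_w h']) ?_
  intro T x hx
  have e1 := congrArg (fun t => t ≫ biprod.fst) hx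
  have e2 := congrArg (fun t => t ≫ biprod.snd) hx
  simp only [Category.assoc, biprod.map_fst, biprod.map_snd, zero_comp] at e1 e2
  obtain ⟨y, hy⟩ := conf_lift h (x ≫ biprod.fst) (by simpa using e1)
  obtain ⟨y', hy'⟩ := conf_lift h' (x ≫ biprod.snd) (by simpa using e2)
  exact ⟨biprod.lift y y', by ext <;> simp [hy, hy']⟩

end

end GoodExact

/-! ### Mapping cones -/

section Cone

variable {C : Type u₁} [Category.{v₁} C] [Preadditive C]

/-- A chain map given by its components. -/
abbrev chainMk {K L : ChainComplex C ℤ} (f : ∀ i, K.X i ⟶ L.X i)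
    (h : ∀ i, f i ≫ L.d i (i - 1) = K.d i (i - 1) ≫ f (i - 1)) : K ⟶ L where
  f := f
  comm' i j hij := by
    obtain rfl : j = i - 1 := by
      simp only [ComplexShape.down_Rel] at hij
      omega
    exact h i

@[simp]
theorem chainMk_f {K L : ChainComplex C ℤ} (f : ∀ i, K.X i ⟶ L.X i)
    (h : ∀ i, f i ≫ L.d i (i - 1) = K.d i (i - 1) ≫ f (i - 1)) (i : ℤ) :
    (chainMk f h).f i = f i := rfl

/-- The shift of a chain complex. -/
abbrev shiftC (K : ChainComplex C ℤ) : ChainComplex C ℤ where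
  X i := K.X (i - 1)
  d i j := - K.d (i - 1) (j - 1)
  shape i j h := by
    rw [K.shape, neg_zero]
    simp only [ComplexShape.down_Rel] at h ⊢
    omega
  d_comp_d' i j k _ _ := by simp

@[simp]
theorem shiftC_d (K : ChainComplex C ℤ) (i j : ℤ) : (shiftC K).d i j = - K.d (i - 1) (j - 1) := rfl

/-- The shift of a chain map. -/
def shiftMap {K L : ChainComplex C ℤ} (f : K ⟶ L) : shiftC K ⟶ shiftC L :=
  chainMk (fun i => f.f (i - 1)) fun i => by simp

@[simp]
theorem shiftMap_f {K L : ChainComplex C ℤ} (f : K ⟶ L) (i : ℤ) :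
    (shiftMap f).f i = f.f (i - 1) := rfl

/-- The component of a chain map between two degrees, which is zero if they differ. -/
def chainComp {K L : ChainComplex C ℤ} (f : K ⟶ L) (i j : ℤ) : K.X i ⟶ L.X j :=
  if h : i = j then f.f i ≫ eqToHom (by rw [h]) else 0

@[simp]
theorem chainComp_self {K L : ChainComplex C ℤ} (f : K ⟶ L) (i : ℤ) :
    chainComp f i i = f.f i := by
  simp [chainComp]

variable [HasBinaryBiproducts C]

/-- The mapping cone of a chain map. -/
abbrev cone {K L : ChainComplex C ℤ} (f : K ⟶ L) : ChainComplex C ℤ where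
  X i := L.X i ⊞ K.X (i - 1)
  -- The differential must be given for all pairs i, j. The component K (i - 1) ⟶ L j of f then
  -- needs a transport and is zero unless j = i - 1, whence `chainComp`.
  d i j := biprod.fst ≫ L.d i j ≫ biprod.inl + biprod.snd ≫ chainComp f (i - 1) j ≫ biprod.inl
    - biprod.snd ≫ K.d (i - 1) (j - 1) ≫ biprod.inr
  shape i j h := by
    simp only [ComplexShape.down_Rel] at h
    rw [L.shape, K.shape, chainComp, dif_neg]
    · simp
    · omega
    · simp only [ComplexShape.down_Rel]
      omega
    · simp only [ComplexShape.down_Rel]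
      omega
  d_comp_d' i j k hij hjk := by
    simp only [ComplexShape.down_Rel] at hij hjk
    obtain rfl : j = i - 1 := by omega
    obtain rfl : k = i - 1 - 1 := by omega
    ext <;> simp

theorem cone_d {K L : ChainComplex C ℤ} (f : K ⟶ L) (i : ℤ) :
    (cone f).d i (i - 1) = biprod.fst ≫ L.d i (i - 1) ≫ biprod.inl
      + biprod.snd ≫ f.f (i - 1) ≫ biprod.inl
      - biprod.snd ≫ K.d (i - 1) (i - 1 - 1) ≫ biprod.inr := by
  rw [← chainComp_self f]

theorem cone_inl_d {K L : ChainComplex C ℤ} (f : K ⟶ L) (i : ℤ) :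
    (biprod.inl : _ ⟶ L.X i ⊞ K.X (i - 1)) ≫ (cone f).d i (i - 1) =
      L.d i (i - 1) ≫ (biprod.inl : _ ⟶ L.X (i - 1) ⊞ K.X (i - 1 - 1)) := by
  rw [cone_d]
  simp

theorem cone_inr_d {K L : ChainComplex C ℤ} (f : K ⟶ L) (i : ℤ) :
    (biprod.inr : _ ⟶ L.X i ⊞ K.X (i - 1)) ≫ (cone f).d i (i - 1) =
      f.f (i - 1) ≫ (biprod.inl : _ ⟶ L.X (i - 1) ⊞ K.X (i - 1 - 1)) -
        K.d (i - 1) (i - 1 - 1) ≫ biprod.inr := by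
  rw [cone_d]
  simp

theorem cone_d_fst {K L : ChainComplex C ℤ} (f : K ⟶ L) (i : ℤ) :
    (cone f).d i (i - 1) ≫ (biprod.fst : L.X (i - 1) ⊞ K.X (i - 1 - 1) ⟶ _) =
      (biprod.fst : L.X i ⊞ K.X (i - 1) ⟶ _) ≫ L.d i (i - 1) + biprod.snd ≫ f.f (i - 1) := by
  rw [cone_d]
  simp

theorem cone_d_snd {K L : ChainComplex C ℤ} (f : K ⟶ L) (i : ℤ) :
    (cone f).d i (i - 1) ≫ (biprod.snd : L.X (i - 1) ⊞ K.X (i - 1 - 1) ⟶ _) =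
      - (biprod.snd : L.X i ⊞ K.X (i - 1) ⟶ _) ≫ K.d (i - 1) (i - 1 - 1) := by
  rw [cone_d]
  simp

/-- The standard presentation of the mapping cone. -/
def conePresentation {K L : ChainComplex C ℤ} (f : K ⟶ L) : ConePresentation f (cone f) where
  inl i := (biprod.inl : _ ⟶ L.X i ⊞ K.X (i - 1))
  fst i := (biprod.fst : L.X i ⊞ K.X (i - 1) ⟶ _)
  inr i := (biprod.inr : _ ⟶ L.X i ⊞ K.X (i - 1))
  snd i := (biprod.snd : L.X i ⊞ K.X (i - 1) ⟶ _)
  inl_fst i := biprod.inl_fst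
  inr_snd i := biprod.inr_snd
  inl_snd i := biprod.inl_snd
  inr_fst i := biprod.inr_fst
  total i := biprod.total
  d_eq i := cone_d f i

/-- Any presentation of the mapping cone is isomorphic to the standard one. -/
def ConePresentation.iso {K L : ChainComplex C ℤ} {f : K ⟶ L} {T : ChainComplex C ℤ}
    (c : ConePresentation f T) : T ≅ cone f where
  hom := chainMk (fun i => biprod.lift (c.fst i) (c.snd i)) fun i => by
    rw [c.d_eq]
    ext
    · rw [Category.assoc, cone_d_fst]
      simp [c.inl_fst, c.inr_fst]
    · rw [Category.assoc, cone_d_snd]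
      simp [c.inl_snd, c.inr_snd]
  inv := chainMk (fun i => biprod.desc (c.inl i) (c.inr i)) fun i => by
    rw [c.d_eq]
    ext
    · rw [← Category.assoc biprod.inl ((cone f).d _ _), cone_inl_d]
      simp [reassoc_of% c.inl_fst, reassoc_of% c.inl_snd]
    · rw [← Category.assoc biprod.inr ((cone f).d _ _), cone_inr_d]
      simp [reassoc_of% c.inr_fst, reassoc_of% c.inr_snd]
  hom_inv_id := by
    ext i
    simp [biprod.lift_desc, c.total]
  inv_hom_id := by
    refine HomologicalComplex.hom_ext _ _ fun i => ?_
    change biprod.desc (c.inl i) (c.inr i) ≫ biprod.lift (c.fst i) (c.snd i) = 𝟙 _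
    ext <;> simp [c.inl_fst, c.inl_snd, c.inr_fst, c.inr_snd]

/-- The map of mapping cones induced by a commutative square. -/
def coneMap {K L K' L' : ChainComplex C ℤ} (f : K ⟶ L) (f' : K' ⟶ L') (a : K ⟶ K') (b : L ⟶ L')
    (h : a ≫ f' = f ≫ b) : cone f ⟶ cone f' :=
  chainMk (fun i => biprod.map (b.f i) (a.f (i - 1))) fun i => by
    have h' := HomologicalComplex.congr_hom h (i - 1)
    simp only [HomologicalComplex.comp_f] at h'
    ext
    · rw [← Category.assoc biprod.inl ((cone f).d _ _), cone_inl_d, biprod.inl_map_assoc,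
        Category.assoc, Category.assoc, cone_d_fst]
      simp
    · rw [← Category.assoc biprod.inl ((cone f).d _ _), cone_inl_d, biprod.inl_map_assoc,
        Category.assoc, Category.assoc, cone_d_snd]
      simp
    · rw [← Category.assoc biprod.inr ((cone f).d _ _), cone_inr_d, biprod.inr_map_assoc,
        Category.assoc, Category.assoc, cone_d_fst]
      simp [h']
    · rw [← Category.assoc biprod.inr ((cone f).d _ _), cone_inr_d, biprod.inr_map_assoc,
        Category.assoc, Category.assoc, cone_d_snd]
      simp

@[simp]
theorem coneMap_f {K L K' L' : ChainComplex C ℤ} (f : K ⟶ L) (f' : K' ⟶ L') (a : K ⟶ K')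
    (b : L ⟶ L') (h : a ≫ f' = f ≫ b) (i : ℤ) :
    (coneMap f f' a b h).f i = biprod.map (b.f i) (a.f (i - 1)) := rfl

/-- The inclusion of the target in the mapping cone. -/
def coneInl {K L : ChainComplex C ℤ} (f : K ⟶ L) : L ⟶ cone f :=
  chainMk (fun i => (biprod.inl : _ ⟶ L.X i ⊞ K.X (i - 1))) fun i => cone_inl_d f i

@[simp]
theorem coneInl_f {K L : ChainComplex C ℤ} (f : K ⟶ L) (i : ℤ) :
    (coneInl f).f i = (biprod.inl : _ ⟶ L.X i ⊞ K.X (i - 1)) := rfl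

/-- The projection of the mapping cone to the shift of the source. -/
def coneSnd {K L : ChainComplex C ℤ} (f : K ⟶ L) : cone f ⟶ shiftC K :=
  chainMk (fun i => (biprod.snd : L.X i ⊞ K.X (i - 1) ⟶ _)) fun i => by
    refine Eq.trans ?_ (cone_d_snd f i).symm
    simp

@[simp]
theorem coneSnd_f {K L : ChainComplex C ℤ} (f : K ⟶ L) (i : ℤ) :
    (coneSnd f).f i = (biprod.snd : L.X i ⊞ K.X (i - 1) ⟶ _) := rfl

theorem coneInl_map {K L K' L' : ChainComplex C ℤ} (f : K ⟶ L) (f' : K' ⟶ L') (a : K ⟶ K')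
    (b : L ⟶ L') (h : a ≫ f' = f ≫ b) : coneInl f ≫ coneMap f f' a b h = b ≫ coneInl f' := by
  refine HomologicalComplex.hom_ext _ _ fun i => ?_
  simp

theorem coneMap_snd {K L K' L' : ChainComplex C ℤ} (f : K ⟶ L) (f' : K' ⟶ L') (a : K ⟶ K')
    (b : L ⟶ L') (h : a ≫ f' = f ≫ b) :
    coneMap f f' a b h ≫ coneSnd f' = coneSnd f ≫ shiftMap a := by
  refine HomologicalComplex.hom_ext _ _ fun i => ?_
  simp

/-- The direct sum of two complexes. -/
abbrev dsum (K L : ChainComplex C ℤ) : ChainComplex C ℤ where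
  X i := K.X i ⊞ L.X i
  d i j := biprod.map (K.d i j) (L.d i j)
  shape i j h := by
    rw [K.shape i j h, L.shape i j h]
    ext <;> simp
  d_comp_d' i j k _ _ := by ext <;> simp

def dsumInl (K L : ChainComplex C ℤ) : K ⟶ dsum K L :=
  chainMk (fun i => (biprod.inl : _ ⟶ K.X i ⊞ L.X i)) fun i => by simp [dsum]

def dsumInr (K L : ChainComplex C ℤ) : L ⟶ dsum K L :=
  chainMk (fun i => (biprod.inr : _ ⟶ K.X i ⊞ L.X i)) fun i => by simp [dsum]

def dsumFst (K L : ChainComplex C ℤ) : dsum K L ⟶ K :=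
  chainMk (fun i => (biprod.fst : K.X i ⊞ L.X i ⟶ _)) fun i => by simp [dsum]

def dsumSnd (K L : ChainComplex C ℤ) : dsum K L ⟶ L :=
  chainMk (fun i => (biprod.snd : K.X i ⊞ L.X i ⟶ _)) fun i => by simp [dsum]

@[simp] theorem dsumInl_f (K L : ChainComplex C ℤ) (i : ℤ) :
    (dsumInl K L).f i = (biprod.inl : _ ⟶ K.X i ⊞ L.X i) := rfl
@[simp] theorem dsumInr_f (K L : ChainComplex C ℤ) (i : ℤ) :
    (dsumInr K L).f i = (biprod.inr : _ ⟶ K.X i ⊞ L.X i) := rfl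
@[simp] theorem dsumFst_f (K L : ChainComplex C ℤ) (i : ℤ) :
    (dsumFst K L).f i = (biprod.fst : K.X i ⊞ L.X i ⟶ _) := rfl
@[simp] theorem dsumSnd_f (K L : ChainComplex C ℤ) (i : ℤ) :
    (dsumSnd K L).f i = (biprod.snd : K.X i ⊞ L.X i ⟶ _) := rfl

theorem dsumInl_fst (K L : ChainComplex C ℤ) : dsumInl K L ≫ dsumFst K L = 𝟙 _ := by
  ext i
  simp

/-- The direct sum of two chain maps. -/
def dsumMap {K L K' L' : ChainComplex C ℤ} (a : K ⟶ K') (b : L ⟶ L') : dsum K L ⟶ dsum K' L' :=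
  chainMk (fun i => biprod.map (a.f i) (b.f i)) fun i => by
    change _ ≫ biprod.map _ _ = biprod.map _ _ ≫ _
    ext <;> simp

@[simp]
theorem dsumMap_f {K L K' L' : ChainComplex C ℤ} (a : K ⟶ K') (b : L ⟶ L') (i : ℤ) :
    (dsumMap a b).f i = biprod.map (a.f i) (b.f i) := rfl

end Cone

section Bounded

variable {C : Type u₁} [Category.{v₁} C] [Preadditive C]

theorem isZero_biprod [HasBinaryBiproducts C] {A B : C} (hA : IsZero A) (hB : IsZero B) :
    IsZero (A ⊞ B) := by
  rw [IsZero.iff_id_eq_zero]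
  ext <;> first | exact hA.eq_of_src _ _ | exact hB.eq_of_src _ _

omit [Preadditive C] in
theorem GradedBounded.shift {X : ℤ → C} (h : GradedBounded X) :
    GradedBounded fun i => X (i - 1) := by
  obtain ⟨a, b, h⟩ := h
  exact ⟨a + 1, b + 1, fun i hi => h _ (by omega)⟩

theorem GradedBounded.biprod [HasBinaryBiproducts C] {X Y : ℤ → C} (hX : GradedBounded X)
    (hY : GradedBounded Y) : GradedBounded fun i => X i ⊞ Y i := by
  obtain ⟨a, b, h⟩ := hX
  obtain ⟨a', b', h'⟩ := hY
  exact ⟨min a a', max b b', fun i hi => isZero_biprod (h _ (by omega)) (h' _ (by omega))⟩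

theorem GradedBounded.cone [HasBinaryBiproducts C] {K L : ChainComplex C ℤ}
    (hK : GradedBounded K.X) (hL : GradedBounded L.X) (f : K ⟶ L) : GradedBounded (cone f).X :=
  hL.biprod hK.shift

end Bounded

/-! ### Quasi-isomorphisms -/

namespace GoodExact

section

variable {N : ConflationCat.{v, u}} [GoodExact N]
variable {K L P K' L' P' : ChainComplex N.carrier ℤ}

theorem isQuasiIso_iff (f : K ⟶ L) : IsQuasiIso N f ↔ Acyclic N (cone f) :=
  ⟨fun ⟨_, ⟨c⟩, h⟩ => acyclic_of_iso c.iso h, fun h => ⟨_, ⟨conePresentation f⟩, h⟩⟩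

theorem confC_cone (f : K ⟶ L) : ConfC N (coneInl f) (coneSnd f) := fun _ => conf_biprod _ _

theorem confC_dsum (K L : ChainComplex N.carrier ℤ) : ConfC N (dsumInl K L) (dsumSnd K L) :=
  fun _ => conf_biprod _ _

theorem ConfC.coneMap {a : K ⟶ L} {a' : L ⟶ P} {b : K' ⟶ L'} {b' : L' ⟶ P'} (ha : ConfC N a a')
    (hb : ConfC N b b') {f : K ⟶ K'} {g : L ⟶ L'} {h : P ⟶ P'} (w : a ≫ g = f ≫ b)
    (w' : a' ≫ h = g ≫ b') : ConfC N (coneMap f g a b w) (coneMap g h a' b' w') :=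
  fun n => conf_biprod_map (hb n) (ha (n - 1))

theorem conf_neg {A B C : N.carrier} {i : A ⟶ B} {p : B ⟶ C} (h : N.conf i p) :
    N.conf i (-p) :=
  exact.conf_of_iso (Iso.refl _) (Iso.refl _) ⟨-𝟙 C, -𝟙 C, by simp, by simp⟩ (by simp)
    (by simp) h

theorem acyclic_shift (h : Acyclic N K) : Acyclic N (shiftC K) := by
  obtain ⟨Z, j, q, h, h'⟩ := h
  exact ⟨fun i => Z (i - 1), fun i => j (i - 1), fun i => - q (i - 1), fun i => conf_neg (h _),
    fun i => by rw [shiftC_d, h', Preadditive.neg_comp]⟩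

theorem acyclic_cone_of_isIso (e : K ≅ L) : Acyclic N (cone e.hom) := by
  have h1 : ∀ i, e.hom.f i ≫ e.inv.f i = 𝟙 _ := fun i => by
    rw [← HomologicalComplex.comp_f, e.hom_inv_id]; rfl
  have h2 : ∀ i, e.inv.f i ≫ e.hom.f i = 𝟙 _ := fun i => by
    rw [← HomologicalComplex.comp_f, e.inv_hom_id]; rfl
  -- A pair (l, k) is a cycle exactly when e k = - d l, so the cycles are the graph of - d l ≫ e⁻¹
  -- and are parametrised by L. The projection to the next object of cycles is (l, k) ↦ d l + e k.
  refine ⟨L.X, fun i => biprod.lift (𝟙 _) (-L.d i (i - 1) ≫ e.inv.f (i - 1)),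
    fun i => biprod.desc (L.d i (i - 1)) (e.hom.f (i - 1)), fun i => ?_, fun i => ?_⟩
  · refine conf_split biprod.fst (e.inv.f (i - 1) ≫ biprod.inr) (by simp) (by simp [h2]) ?_ ?_
    · simp [biprod.lift_desc, h2]
    · ext <;> simp
  · rw [cone_d]
    ext
    · simp
    · simp
    · simp
    · simp [h1]

theorem acyclic_cone_id (K : ChainComplex N.carrier ℤ) : Acyclic N (cone (𝟙 K)) :=
  acyclic_cone_of_isIso (Iso.refl K)

theorem acyclic_cone (f : K ⟶ L) (hK : GradedBounded K.X) (hL : GradedBounded L.X)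
    (h : Acyclic N K) (h' : Acyclic N L) : Acyclic N (cone f) :=
  (confC_cone f).acyclic₂ (hK.cone hL f) h' (acyclic_shift h)

theorem isQuasiIso_of_acyclic (f : K ⟶ L) (hK : GradedBounded K.X) (hL : GradedBounded L.X)
    (h : Acyclic N K) (h' : Acyclic N L) : IsQuasiIso N f :=
  (isQuasiIso_iff f).2 (acyclic_cone f hK hL h h')

theorem isQuasiIso_of_iso (e : K ≅ L) : IsQuasiIso N e.hom :=
  (isQuasiIso_iff _).2 (acyclic_cone_of_isIso e)

/-- The middle term is the cone of a map between cones of identities, which is acyclic for bounded K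
and L. So the cones of f and of its shift are acyclic together, and the two need not be identified
up to signs. -/
theorem confC_shiftMap (f : K ⟶ L) (w₁ w₂) :
    ConfC N (coneMap f (coneMap (𝟙 K) (𝟙 L) f f (by simp)) (coneInl (𝟙 K)) (coneInl (𝟙 L)) w₁)
      (coneMap _ (shiftMap f) (coneSnd (𝟙 K)) (coneSnd (𝟙 L)) w₂) :=
  (confC_cone _).coneMap (confC_cone _) _ _

theorem acyclic_cone_coneMap_id (f : K ⟶ L) (hK : GradedBounded K.X) (hL : GradedBounded L.X) (w) :
    Acyclic N (cone (coneMap (𝟙 K) (𝟙 L) f f w)) :=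
  acyclic_cone _ (hK.cone hK _) (hL.cone hL _) (acyclic_cone_id K) (acyclic_cone_id L)

theorem isQuasiIso_shiftMap_iff (f : K ⟶ L) (hK : GradedBounded K.X) (hL : GradedBounded L.X) :
    IsQuasiIso N (shiftMap f) ↔ IsQuasiIso N f := by
  rw [isQuasiIso_iff, isQuasiIso_iff]
  have hc := confC_shiftMap f (coneInl_map _ _ _ _ _) (coneMap_snd _ _ _ _ _).symm
  exact ⟨fun h => hc.acyclic₁ (hK.cone hL f) (acyclic_cone_coneMap_id f hK hL _) h,
    fun h => hc.acyclic₃ (hK.shift.cone hL.shift (K := shiftC K) (L := shiftC L) _) h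
      (acyclic_cone_coneMap_id f hK hL _)⟩

/-- The square whose iterated mapping cone relates the mapping cones of two maps to the mapping
cone of their composite. -/
abbrev octMap (g : K ⟶ L) (f : L ⟶ P) : cone g ⟶ cone (𝟙 P) :=
  coneMap g (𝟙 P) (g ≫ f) f (by simp)

/-- This replaces the octahedral axiom: an iterated cone built from g and f is an extension of the
cone of the shifted composite by the cone of f. -/
theorem confC_octMap (g : K ⟶ L) (f : L ⟶ P) :
    ConfC N (coneMap f (octMap g f) (coneInl g) (coneInl (𝟙 P)) (coneInl_map _ _ _ _ _))
      (coneMap (octMap g f) (shiftMap (g ≫ f)) (coneSnd g) (coneSnd (𝟙 P))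
        (coneMap_snd _ _ _ _ _).symm) :=
  (confC_cone _).coneMap (confC_cone _) _ _

variable (hK : GradedBounded K.X) (hL : GradedBounded L.X) (hP : GradedBounded P.X)

-- If g is a quasi-isomorphism, the middle term of `confC_octMap` is the cone of a map from the
-- acyclic cone of g to the acyclic cone of an identity. Hence the outer terms are acyclic together.
include hK hL hP in
theorem isQuasiIso_comp_iff (g : K ⟶ L) (f : L ⟶ P) (hg : IsQuasiIso N g) :
    IsQuasiIso N (g ≫ f) ↔ IsQuasiIso N f := by
  rw [isQuasiIso_iff] at hg
  have hT : Acyclic N (cone (octMap g f)) :=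
    acyclic_cone _ (hK.cone hL _) (hP.cone hP _) hg (acyclic_cone_id P)
  rw [← isQuasiIso_shiftMap_iff _ hK hP, isQuasiIso_iff, isQuasiIso_iff]
  exact ⟨fun h => (confC_octMap g f).acyclic₁ (hL.cone hP _) hT h,
    fun h => (confC_octMap g f).acyclic₃
      (hK.shift.cone hP.shift (K := shiftC K) (L := shiftC P) _) h hT⟩

-- The cone of the inclusion is an extension of L by the cone of the identity of K, both acyclic.
include hK hL in
theorem isQuasiIso_dsumInl (h : Acyclic N L) : IsQuasiIso N (dsumInl K L) := by
  rw [isQuasiIso_iff]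
  have hc : ConfC N (coneMap (𝟙 K) (dsumInl K L) (𝟙 K) (dsumInl K L) (by simp))
      (chainMk (fun i => biprod.fst ≫ biprod.snd) fun i => ?_ : cone (dsumInl K L) ⟶ L) := ?_
  · exact hc.acyclic₂ (hK.cone (hK.biprod hL) _) (acyclic_cone_id K) h
  · change _ = _ ≫ (biprod.fst : (K.X _ ⊞ L.X _) ⊞ K.X _ ⟶ _) ≫ _
    rw [← Category.assoc]
    erw [cone_d_fst]
    simp [dsum]
  · intro n
    refine conf_split (biprod.map biprod.fst (𝟙 _)) (biprod.inr ≫ biprod.inl) ?_ ?_ ?_ ?_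
    · change biprod.map biprod.inl (𝟙 _) ≫ _ = _
      ext <;> simp
    · simp
    · change biprod.map biprod.inl (𝟙 _) ≫ _ = _
      ext <;> simp
    · change _ ≫ biprod.map biprod.inl (𝟙 _) + _ = _
      ext <;> simp

include hK hL in
theorem isQuasiIso_dsumFst (h : Acyclic N L) : IsQuasiIso N (dsumFst K L) := by
  rw [← isQuasiIso_comp_iff hK (hK.biprod hL) hK _ _ (isQuasiIso_dsumInl hK hL h), dsumInl_fst]
  exact isQuasiIso_of_iso (Iso.refl K)

end

end GoodExact

/-! ### Constructions of binary complexes -/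

namespace BinaryComplex

variable {C : Type u₁} [Category.{v₁} C] [Preadditive C]

/-- A quotient of a binary complex. -/
abbrev ofEpi (B : BinaryComplex C) (D : ℤ → C) (r : ∀ n, B.X n ⟶ D n) [∀ n, Epi (r n)]
    (e e' : ∀ n m, D n ⟶ D m) (he : ∀ n m, r n ≫ e n m = B.d n m ≫ r m)
    (he' : ∀ n m, r n ≫ e' n m = B.d' n m ≫ r m) : BinaryComplex C where
  X := D
  d := e
  d' := e'
  shape i j h := by rw [← cancel_epi (r i), he, B.shape i j h, zero_comp, comp_zero]
  shape' i j h := by rw [← cancel_epi (r i), he', B.shape' i j h, zero_comp, comp_zero]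
  d_comp_d i j k := by
    rw [← cancel_epi (r i), ← Category.assoc, he, Category.assoc, he, ← Category.assoc,
      B.d_comp_d, zero_comp, comp_zero]
  d_comp_d' i j k := by
    rw [← cancel_epi (r i), ← Category.assoc, he', Category.assoc, he', ← Category.assoc,
      B.d_comp_d', zero_comp, comp_zero]

/-- A subcomplex of a binary complex. -/
abbrev ofMono (B : BinaryComplex C) (D : ℤ → C) (r : ∀ n, D n ⟶ B.X n) [∀ n, Mono (r n)]
    (e e' : ∀ n m, D n ⟶ D m) (he : ∀ n m, e n m ≫ r m = r n ≫ B.d n m)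
    (he' : ∀ n m, e' n m ≫ r m = r n ≫ B.d' n m) : BinaryComplex C where
  X := D
  d := e
  d' := e'
  shape i j h := by rw [← cancel_mono (r j), he, B.shape i j h, zero_comp, comp_zero]
  shape' i j h := by rw [← cancel_mono (r j), he', B.shape' i j h, zero_comp, comp_zero]
  d_comp_d i j k := by
    rw [← cancel_mono (r k), Category.assoc, he, ← Category.assoc, he, Category.assoc,
      B.d_comp_d, zero_comp, comp_zero]
  d_comp_d' i j k := by
    rw [← cancel_mono (r k), Category.assoc, he', ← Category.assoc, he', Category.assoc,
      B.d_comp_d', zero_comp, comp_zero]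

variable [HasBinaryBiproducts C]

/-- The direct sum of binary complexes. -/
abbrev dsum (K L : BinaryComplex C) : BinaryComplex C where
  X i := K.X i ⊞ L.X i
  d i j := biprod.map (K.d i j) (L.d i j)
  d' i j := biprod.map (K.d' i j) (L.d' i j)
  shape i j h := by rw [K.shape i j h, L.shape i j h]; ext <;> simp
  shape' i j h := by rw [K.shape' i j h, L.shape' i j h]; ext <;> simp
  d_comp_d i j k := by ext <;> simp [K.d_comp_d, L.d_comp_d]
  d_comp_d' i j k := by ext <;> simp [K.d_comp_d', L.d_comp_d']

end BinaryComplex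

/-! ### Two-out-of-three for binary complexes -/

namespace GoodExact

open BinaryComplex (comp)

/-- Membership in `B^q N`. -/
def IsBq (N : ConflationCat.{v, u}) (K : BinaryComplex N.carrier) : Prop :=
  GradedBounded K.X ∧ Acyclic N (BinaryComplex.top.obj K) ∧ Acyclic N (BinaryComplex.bot.obj K)

/-- Degreewise short exact sequences of binary complexes. -/
def ConfB (N : ConflationCat.{v, u}) {K L P : BinaryComplex N.carrier} (f : K ⟶ L)
    (g : L ⟶ P) : Prop :=
  ∀ n, N.conf (BinaryComplex.comp f n) (BinaryComplex.comp g n)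

section

variable {N : ConflationCat.{v, u}} [GoodExact N]

theorem isZero_of_conf {A B C : N.carrier} {i : A ⟶ B} {p : B ⟶ C} (h : N.conf i p)
    (hA : IsZero A) (hC : IsZero C) : IsZero B := by
  obtain ⟨y, hy⟩ := conf_lift h (𝟙 B) (hC.eq_of_tgt _ _)
  rw [IsZero.iff_id_eq_zero, ← hy, hA.eq_of_tgt y 0, zero_comp]

theorem isZero_of_mono {A B : N.carrier} (i : A ⟶ B) [Mono i] (hB : IsZero B) : IsZero A := by
  rw [IsZero.iff_id_eq_zero, ← cancel_mono i]
  exact hB.eq_of_tgt _ _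

theorem isZero_of_epi {A B : N.carrier} (p : A ⟶ B) [Epi p] (hA : IsZero A) : IsZero B := by
  rw [IsZero.iff_id_eq_zero, ← cancel_epi p]
  exact hA.eq_of_src _ _

/-- A pushout has the same cokernel as the inflation it is made from. Keeping this cokernel fixed
lets the degreewise pushout of complexes be recognised as acyclic later. -/
theorem exists_pushout {A B C A' : N.carrier} {i : A ⟶ B} {p : B ⟶ C} (h : N.conf i p)
    (f : A ⟶ A') : ∃ (B' : N.carrier) (f' : B ⟶ B') (i' : A' ⟶ B') (p' : B' ⟶ C),
      IsPushout i f f' i' ∧ N.conf i' p' ∧ f' ≫ p' = p := by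
  obtain ⟨B', f', i', hP, hi⟩ := exact.inflation_pushout i f ⟨_, _, h⟩
  have hw : f' ≫ hP.desc p 0 (by simp [conf_w h]) = p := hP.inl_desc _ _ _
  have := conf_epi h
  have : Epi (hP.desc p 0 (by simp [conf_w h])) := by
    rw [← hw] at this
    exact epi_of_epi f' _
  refine ⟨B', f', i', _, hP, conf_of_inflation hi (by simp) ?_, hw⟩
  intro T x hx
  obtain ⟨y, hy⟩ := conf_desc h (f' ≫ x) (by
    rw [← Category.assoc, hP.w, Category.assoc, hx, comp_zero])
  refine ⟨y, hP.hom_ext ?_ ?_⟩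
  · rw [← Category.assoc, hw, hy]
  · rw [← Category.assoc, hP.inr_desc, zero_comp, hx]

theorem exists_pullback {A B C C' : N.carrier} {i : A ⟶ B} {p : B ⟶ C} (h : N.conf i p)
    (f : C' ⟶ C) : ∃ (B' : N.carrier) (f' : B' ⟶ B) (p' : B' ⟶ C') (i' : A ⟶ B'),
      IsPullback f' p' p f ∧ N.conf i' p' ∧ i' ≫ f' = i := by
  obtain ⟨B', f', p', hP, hi⟩ := exact.deflation_pullback p f ⟨_, _, h⟩
  have hw : hP.lift i 0 (by simp [conf_w h]) ≫ f' = i := hP.lift_fst _ _ _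
  have := conf_mono h
  have : Mono (hP.lift i 0 (by simp [conf_w h])) := by
    rw [← hw] at this
    exact mono_of_mono _ f'
  refine ⟨B', f', p', _, hP, conf_of_deflation hi (by simp) ?_, hw⟩
  intro T x hx
  obtain ⟨y, hy⟩ := conf_lift h (x ≫ f') (by
    rw [Category.assoc, hP.w, ← Category.assoc, hx, zero_comp])
  refine ⟨y, hP.hom_ext ?_ ?_⟩
  · rw [Category.assoc, hw, hy]
  · rw [Category.assoc, hP.lift_snd, comp_zero, hx]

theorem ConfB.confC_top {K L P : BinaryComplex N.carrier} {f : K ⟶ L} {g : L ⟶ P} (h : ConfB N f g) :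
    ConfC N (BinaryComplex.top.map f) (BinaryComplex.top.map g) := h

theorem ConfB.confC_bot {K L P : BinaryComplex N.carrier} {f : K ⟶ L} {g : L ⟶ P} (h : ConfB N f g) :
    ConfC N (BinaryComplex.bot.map f) (BinaryComplex.bot.map g) := h

theorem ConfB.bounded {K L P : BinaryComplex N.carrier} {f : K ⟶ L} {g : L ⟶ P}
    (h : ConfB N f g) (hK : GradedBounded K.X) (hP : GradedBounded P.X) : GradedBounded L.X := by
  obtain ⟨a, b, h₁⟩ := hK
  obtain ⟨a', b', h₂⟩ := hP
  exact ⟨min a a', max b b', fun i hi => isZero_of_conf (h i) (h₁ _ (by omega)) (h₂ _ (by omega))⟩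

theorem ConfB.isBq₂ {K L P : BinaryComplex N.carrier} {f : K ⟶ L} {g : L ⟶ P}
    (h : ConfB N f g) (hK : IsBq N K) (hP : IsBq N P) : IsBq N L :=
  have hb := h.bounded hK.1 hP.1
  ⟨hb, h.confC_top.acyclic₂ hb hK.2.1 hP.2.1, h.confC_bot.acyclic₂ hb hK.2.2 hP.2.2⟩

theorem ConfB.isBq₁ {K L P : BinaryComplex N.carrier} {f : K ⟶ L} {g : L ⟶ P}
    (h : ConfB N f g) (hL : IsBq N L) (hP : IsBq N P) : IsBq N K := by
  have hb : GradedBounded K.X := by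
    obtain ⟨a, b, h₁⟩ := hL.1
    exact ⟨a, b, fun i hi => have := conf_mono (h i); isZero_of_mono (comp f i) (h₁ i hi)⟩
  exact ⟨hb, h.confC_top.acyclic₁ hb hL.2.1 hP.2.1, h.confC_bot.acyclic₁ hb hL.2.2 hP.2.2⟩

theorem ConfB.isBq₃ {K L P : BinaryComplex N.carrier} {f : K ⟶ L} {g : L ⟶ P}
    (h : ConfB N f g) (hK : IsBq N K) (hL : IsBq N L) : IsBq N P := by
  have hb : GradedBounded P.X := by
    obtain ⟨a, b, h₁⟩ := hL.1
    exact ⟨a, b, fun i hi => have := conf_epi (h i); isZero_of_epi (comp g i) (h₁ i hi)⟩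
  exact ⟨hb, h.confC_top.acyclic₃ hb hK.2.1 hL.2.1, h.confC_bot.acyclic₃ hb hK.2.2 hL.2.2⟩

/-! ### `B^q N` is an exact category supporting long exact sequences -/

section BqExact

variable {A B C A' : BqObj N}

/-- The component of a map in `B^q N`. -/
abbrev bqComp {A B : BqObj N} (f : A ⟶ B) (n : ℤ) : A.obj.X n ⟶ B.obj.X n := comp f.hom n

/-- A map in `B^q N` given by its components. -/
abbrev bqMk {A B : BqObj N} (f : ∀ n, A.obj.X n ⟶ B.obj.X n)
    (h : ∀ n m, f n ≫ B.obj.d n m = A.obj.d n m ≫ f m)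
    (h' : ∀ n m, f n ≫ B.obj.d' n m = A.obj.d' n m ≫ f m) : A ⟶ B :=
  ObjectProperty.homMk ⟨f, h, h'⟩

theorem bq_ext {A B : BqObj N} {f g : A ⟶ B} (h : ∀ n, bqComp f n = bqComp g n) : f = g :=
  ObjectProperty.hom_ext _ (BinaryComplex.hom_ext h)

theorem bqComp_comm {A B : BqObj N} (f : A ⟶ B) (n m : ℤ) :
    bqComp f n ≫ B.obj.d n m = A.obj.d n m ≫ bqComp f m := BinaryComplex.Hom.comm f.hom n m

theorem bqComp_comm' {A B : BqObj N} (f : A ⟶ B) (n m : ℤ) :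
    bqComp f n ≫ B.obj.d' n m = A.obj.d' n m ≫ bqComp f m := BinaryComplex.Hom.comm' f.hom n m

theorem bqComp_comp (f : A ⟶ B) (g : B ⟶ C) (n : ℤ) :
    bqComp (f ≫ g) n = bqComp f n ≫ bqComp g n := rfl

/-- The degreewise isomorphisms of an isomorphism in `B^q N`. -/
def bqIso (e : A ≅ B) (n : ℤ) : A.obj.X n ≅ B.obj.X n where
  hom := bqComp e.hom n
  inv := bqComp e.inv n
  hom_inv_id := by rw [← bqComp_comp, e.hom_inv_id]; rfl
  inv_hom_id := by rw [← bqComp_comp, e.inv_hom_id]; rfl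

/-- Both differentials descend to the degreewise cokernels, and the quotient is again acyclic by
two-out-of-three. Admissibility in B^q N can therefore be tested degree by degree. -/
theorem bq_inflation (i : A ⟶ B) (h : ∀ n, N.Inflation (bqComp i n)) : (Bq N).Inflation i := by
  choose D r hr using h
  have hepi : ∀ n, Epi (r n) := fun n => conf_epi (hr n)
  choose e he using fun n m => conf_desc (hr n) (B.obj.d n m ≫ r m) (by
    rw [← Category.assoc, bqComp_comm, Category.assoc, conf_w (hr m), comp_zero])
  choose e' he' using fun n m => conf_desc (hr n) (B.obj.d' n m ≫ r m) (by
    rw [← Category.assoc, bqComp_comm', Category.assoc, conf_w (hr m), comp_zero])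
  let P := BinaryComplex.ofEpi B.obj D r e e' he he'
  let g : B.obj ⟶ P := ⟨r, he, he'⟩
  have hg : ConfB N i.hom g := hr
  exact ⟨⟨P, hg.isBq₃ A.property B.property⟩, ObjectProperty.homMk g, hr⟩

theorem bq_deflation (p : B ⟶ C) (h : ∀ n, N.Deflation (bqComp p n)) : (Bq N).Deflation p := by
  choose D r hr using h
  have hmono : ∀ n, Mono (r n) := fun n => conf_mono (hr n)
  choose e he using fun n m => conf_lift (hr m) (r n ≫ B.obj.d n m) (by
    rw [Category.assoc, ← bqComp_comm, ← Category.assoc, conf_w (hr n), zero_comp])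
  choose e' he' using fun n m => conf_lift (hr m) (r n ≫ B.obj.d' n m) (by
    rw [Category.assoc, ← bqComp_comm', ← Category.assoc, conf_w (hr n), zero_comp])
  let P := BinaryComplex.ofMono B.obj D r e e' he he'
  let g : P ⟶ B.obj := ⟨r, fun n m => (he n m).symm, fun n m => (he' n m).symm⟩
  have hg : ConfB N g p.hom := hr
  exact ⟨⟨P, hg.isBq₁ B.property C.property⟩, ObjectProperty.homMk g, hr⟩

theorem isBq_dsum {K L : BinaryComplex N.carrier} (hK : IsBq N K) (hL : IsBq N L) :
    IsBq N (BinaryComplex.dsum K L) := by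
  have h : ConfB N (⟨fun n => biprod.inl, fun n m => by simp, fun n m => by simp⟩ :
      K ⟶ BinaryComplex.dsum K L) (⟨fun n => biprod.snd, fun n m => by simp, fun n m => by simp⟩ :
      BinaryComplex.dsum K L ⟶ L) := fun n => conf_biprod _ _
  exact h.isBq₂ hK hL

variable (N) in
theorem bq_hasFiniteBiproducts : HasFiniteBiproducts (BqObj N) := by
  have h1 : HasBinaryBiproducts (BqObj N) := ⟨fun A B => by
    let b : BinaryBicone A B :=
      { pt := ⟨BinaryComplex.dsum A.obj B.obj, isBq_dsum A.property B.property⟩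
        fst := bqMk (fun n => biprod.fst) (fun n m => by simp) (fun n m => by simp)
        snd := bqMk (fun n => biprod.snd) (fun n m => by simp) (fun n m => by simp)
        inl := bqMk (fun n => biprod.inl) (fun n m => by simp) (fun n m => by simp)
        inr := bqMk (fun n => biprod.inr) (fun n m => by simp) (fun n m => by simp)
        inl_fst := bq_ext fun n => biprod.inl_fst
        inl_snd := bq_ext fun n => biprod.inl_snd
        inr_fst := bq_ext fun n => biprod.inr_fst
        inr_snd := bq_ext fun n => biprod.inr_snd }
    exact hasBinaryBiproduct_of_total b (bq_ext fun n => biprod.total)⟩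
  have h0 : HasZeroObject (BqObj N) := by
    let Z : BqObj N := ⟨{ X := fun _ => 0, d := fun _ _ => 0, d' := fun _ _ => 0,
                          shape := by simp, shape' := by simp, d_comp_d := by simp,
                          d_comp_d' := by simp },
      ⟨0, 0, fun _ _ => isZero_zero _⟩,
      ⟨fun _ => 0, 0, 0, fun i => conf_split 0 0 ((isZero_zero _).eq_of_src _ _)
        ((isZero_zero _).eq_of_src _ _) ((isZero_zero _).eq_of_src _ _)
        ((isZero_zero _).eq_of_src _ _),
        fun _ => (isZero_zero _).eq_of_src _ _⟩,
      ⟨fun _ => 0, 0, 0, fun i => conf_split 0 0 ((isZero_zero _).eq_of_src _ _)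
        ((isZero_zero _).eq_of_src _ _) ((isZero_zero _).eq_of_src _ _)
        ((isZero_zero _).eq_of_src _ _),
        fun _ => (isZero_zero _).eq_of_src _ _⟩⟩
    refine ⟨Z, (IsZero.iff_id_eq_zero Z).2 (bq_ext fun n => (isZero_zero _).eq_of_src _ _)⟩
  have h2 : HasFiniteProducts (BqObj N) := hasFiniteProducts_of_has_binary_and_terminal
  exact HasFiniteBiproducts.of_hasFiniteProducts

theorem bq_kernel_cokernel {i : A ⟶ B} {p : B ⟶ C} (h : (Bq N).conf i p) :
    ∃ w : i ≫ p = 0, Nonempty (IsLimit (KernelFork.ofι i w)) ∧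
      Nonempty (IsColimit (CokernelCofork.ofπ p w)) := by
  have hm : ∀ n, Mono (bqComp i n) := fun n => conf_mono (h n)
  have he : ∀ n, Epi (bqComp p n) := fun n => conf_epi (h n)
  have hi : Mono i := ⟨fun a b hab => bq_ext fun n => by
    rw [← cancel_mono (bqComp i n), ← bqComp_comp, hab, bqComp_comp]⟩
  have hp : Epi p := ⟨fun a b hab => bq_ext fun n => by
    rw [← cancel_epi (bqComp p n), ← bqComp_comp, hab, bqComp_comp]⟩
  have w : i ≫ p = 0 := bq_ext fun n => conf_w (h n)
  refine ⟨w, ⟨KernelFork.IsLimit.ofι' _ _ fun {T} g hg => ?_⟩,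
    ⟨CokernelCofork.IsColimit.ofπ' _ _ fun {T} g hg => ?_⟩⟩
  · choose l hl using fun n => conf_lift (show N.conf (bqComp i n) (bqComp p n) from h n) (bqComp g n) (by
      rw [← bqComp_comp g p, hg]; rfl)
    refine ⟨bqMk l (fun n m => ?_) (fun n m => ?_), bq_ext hl⟩
    · rw [← cancel_mono (bqComp i m), Category.assoc, Category.assoc, hl, ← bqComp_comm,
        ← Category.assoc, hl, bqComp_comm]
    · rw [← cancel_mono (bqComp i m), Category.assoc, Category.assoc, hl, ← bqComp_comm',
        ← Category.assoc, hl, bqComp_comm']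
  · choose l hl using fun n => conf_desc (show N.conf (bqComp i n) (bqComp p n) from h n) (bqComp g n) (by
      rw [← bqComp_comp i g, hg]; rfl)
    refine ⟨bqMk l (fun n m => ?_) (fun n m => ?_), bq_ext hl⟩
    · rw [← cancel_epi (bqComp p n), ← Category.assoc, hl, ← Category.assoc (bqComp p n),
        bqComp_comm, bqComp_comm, Category.assoc, hl]
    · rw [← cancel_epi (bqComp p n), ← Category.assoc, hl, ← Category.assoc (bqComp p n),
        bqComp_comm', bqComp_comm', Category.assoc, hl]

theorem bq_inflation_pushout (i : A ⟶ B) (f : A ⟶ A') (h : (Bq N).Inflation i) :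
    ∃ (B' : BqObj N) (f' : B ⟶ B') (i' : A' ⟶ B'), IsPushout i f f' i' ∧ (Bq N).Inflation i' := by
  obtain ⟨(C : BqObj N), (p : B ⟶ C), h⟩ := h
  replace h : ∀ n, N.conf (bqComp i n) (bqComp p n) := h
  choose B' f' i' p' hP hc hp using fun n => exists_pushout (h n) (bqComp f n)
  have hepi : ∀ n, Epi (biprod.desc (f' n) (i' n)) := fun n => ⟨fun a b hab =>
    (hP n).hom_ext (by simpa using congrArg (fun t => biprod.inl ≫ t) hab)
      (by simpa using congrArg (fun t => biprod.inr ≫ t) hab)⟩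
  have hw : ∀ n m, bqComp i n ≫ B.obj.d n m ≫ f' m = bqComp f n ≫ A'.obj.d n m ≫ i' m := by
    intro n m
    rw [← Category.assoc, bqComp_comm, Category.assoc, (hP m).w, ← Category.assoc, ← bqComp_comm,
      Category.assoc]
  have hw' : ∀ n m, bqComp i n ≫ B.obj.d' n m ≫ f' m = bqComp f n ≫ A'.obj.d' n m ≫ i' m := by
    intro n m
    rw [← Category.assoc, bqComp_comm', Category.assoc, (hP m).w, ← Category.assoc, ← bqComp_comm',
      Category.assoc]
  -- The degreewise pushouts form a quotient of the complex B ⊕ A', so the identities for the two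
  -- differentials are inherited from it.
  let P := BinaryComplex.ofEpi (BinaryComplex.dsum B.obj A'.obj) B'
    (fun n => biprod.desc (f' n) (i' n))
    (fun n m => (hP n).desc (B.obj.d n m ≫ f' m) (A'.obj.d n m ≫ i' m) (hw n m))
    (fun n m => (hP n).desc (B.obj.d' n m ≫ f' m) (A'.obj.d' n m ≫ i' m) (hw' n m))
    (fun n m => by ext <;> simp) (fun n m => by ext <;> simp)
  let i₁ : A'.obj ⟶ P := ⟨i', fun n m => by simp [P], fun n m => by simp [P]⟩
  let f₁ : B.obj ⟶ P := ⟨f', fun n m => by simp [P], fun n m => by simp [P]⟩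
  have hp0 : ∀ n, i' n ≫ p' n = 0 := fun n => conf_w (hc n)
  let p₁ : P ⟶ C.obj := ⟨p', fun n m => (hP n).hom_ext
      (by simp only [P, ← Category.assoc, (hP n).inl_desc, hp]
          rw [Category.assoc, hp, bqComp_comm])
      (by simp only [P, ← Category.assoc, (hP n).inr_desc, hp0]
          rw [Category.assoc, hp0, comp_zero, zero_comp]),
    fun n m => (hP n).hom_ext
      (by simp only [P, ← Category.assoc, (hP n).inl_desc, hp]
          rw [Category.assoc, hp, bqComp_comm'])
      (by simp only [P, ← Category.assoc, (hP n).inr_desc, hp0]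
          rw [Category.assoc, hp0, comp_zero, zero_comp])⟩
  -- The pushout is an extension of C by A', hence lies in B^q N.
  have hconf : ConfB N i₁ p₁ := hc
  let P' : BqObj N := ⟨P, hconf.isBq₂ A'.property C.property⟩
  refine ⟨P', ObjectProperty.homMk f₁, ObjectProperty.homMk i₁,
    ⟨⟨bq_ext fun n => (hP n).w⟩, ⟨PushoutCocone.IsColimit.mk _ (fun s => bqMk
      (fun n => (hP n).desc (bqComp s.inl n) (bqComp s.inr n) (by
        rw [← bqComp_comp, s.condition, bqComp_comp])) (fun n m => ?_) (fun n m => ?_))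
      (fun s => bq_ext fun n => (hP n).inl_desc _ _ _)
      (fun s => bq_ext fun n => (hP n).inr_desc _ _ _) (fun s t h₁ h₂ => bq_ext fun n =>
        (hP n).hom_ext ?_ ?_)⟩⟩, C, ObjectProperty.homMk p₁, hc⟩
  · refine (hP n).hom_ext ?_ ?_ <;> simp [P', P, bqComp_comm]
  · refine (hP n).hom_ext ?_ ?_ <;> simp [P', P, bqComp_comm']
  · exact (congrArg (fun z => bqComp z n) h₁).trans ((hP n).inl_desc _ _ _).symm
  · exact (congrArg (fun z => bqComp z n) h₂).trans ((hP n).inr_desc _ _ _).symm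

theorem bq_deflation_pullback (p : B ⟶ C) (f : A' ⟶ C) (h : (Bq N).Deflation p) :
    ∃ (B' : BqObj N) (f' : B' ⟶ B) (p' : B' ⟶ A'), IsPullback f' p' p f ∧ (Bq N).Deflation p' := by
  obtain ⟨(A : BqObj N), (i : A ⟶ B), h⟩ := h
  replace h : ∀ n, N.conf (bqComp i n) (bqComp p n) := h
  choose B' f' p' i' hP hc hi using fun n => exists_pullback (h n) (bqComp f n)
  have hmono : ∀ n, Mono (biprod.lift (f' n) (p' n)) := fun n => ⟨fun a b hab =>
    (hP n).hom_ext (by simpa using congrArg (fun t => t ≫ biprod.fst) hab)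
      (by simpa using congrArg (fun t => t ≫ biprod.snd) hab)⟩
  have hw : ∀ n m, (f' n ≫ B.obj.d n m) ≫ bqComp p m = (p' n ≫ A'.obj.d n m) ≫ bqComp f m := by
    intro n m
    rw [Category.assoc, ← bqComp_comm, ← Category.assoc, (hP n).w, Category.assoc, bqComp_comm,
      Category.assoc]
  have hw' : ∀ n m, (f' n ≫ B.obj.d' n m) ≫ bqComp p m =
      (p' n ≫ A'.obj.d' n m) ≫ bqComp f m := by
    intro n m
    rw [Category.assoc, ← bqComp_comm', ← Category.assoc, (hP n).w, Category.assoc, bqComp_comm',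
      Category.assoc]
  let P := BinaryComplex.ofMono (BinaryComplex.dsum B.obj A'.obj) B'
    (fun n => biprod.lift (f' n) (p' n))
    (fun n m => (hP m).lift (f' n ≫ B.obj.d n m) (p' n ≫ A'.obj.d n m) (hw n m))
    (fun n m => (hP m).lift (f' n ≫ B.obj.d' n m) (p' n ≫ A'.obj.d' n m) (hw' n m))
    (fun n m => by ext <;> simp) (fun n m => by ext <;> simp)
  let p₁ : P ⟶ A'.obj := ⟨p', fun n m => by simp [P], fun n m => by simp [P]⟩
  let f₁ : P ⟶ B.obj := ⟨f', fun n m => by simp [P], fun n m => by simp [P]⟩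
  have hp0 : ∀ n, i' n ≫ p' n = 0 := fun n => conf_w (hc n)
  let i₁ : A.obj ⟶ P := ⟨i', fun n m => (hP m).hom_ext
      (by simp only [P, Category.assoc, (hP m).lift_fst, hi]
          rw [← Category.assoc, hi, bqComp_comm])
      (by simp only [P, Category.assoc, (hP m).lift_snd, hp0]
          rw [← Category.assoc, hp0, comp_zero, zero_comp]),
    fun n m => (hP m).hom_ext
      (by simp only [P, Category.assoc, (hP m).lift_fst, hi]
          rw [← Category.assoc, hi, bqComp_comm'])
      (by simp only [P, Category.assoc, (hP m).lift_snd, hp0]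
          rw [← Category.assoc, hp0, comp_zero, zero_comp])⟩
  have hconf : ConfB N i₁ p₁ := hc
  let P' : BqObj N := ⟨P, hconf.isBq₂ A.property A'.property⟩
  refine ⟨P', ObjectProperty.homMk f₁, ObjectProperty.homMk p₁,
    ⟨⟨bq_ext fun n => (hP n).w⟩, ⟨PullbackCone.IsLimit.mk _ (fun s => bqMk
      (fun n => (hP n).lift (bqComp s.fst n) (bqComp s.snd n) (by
        rw [← bqComp_comp, s.condition, bqComp_comp])) (fun n m => ?_) (fun n m => ?_))
      (fun s => bq_ext fun n => (hP n).lift_fst _ _ _)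
      (fun s => bq_ext fun n => (hP n).lift_snd _ _ _) (fun s t h₁ h₂ => bq_ext fun n =>
        (hP n).hom_ext ?_ ?_)⟩⟩, A, ObjectProperty.homMk i₁, hc⟩
  · refine (hP m).hom_ext ?_ ?_ <;> simp [P', P, bqComp_comm]
  · refine (hP m).hom_ext ?_ ?_ <;> simp [P', P, bqComp_comm']
  · exact (congrArg (fun z => bqComp z n) h₁).trans ((hP n).lift_fst _ _ _).symm
  · exact (congrArg (fun z => bqComp z n) h₂).trans ((hP n).lift_snd _ _ _).symm

end BqExact

/-- `B^q N` is an exact category that supports long exact sequences. -/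
instance bq_goodExact : GoodExact (Bq N) where
  exact :=
    { hasFiniteBiproducts := bq_hasFiniteBiproducts N
      conf_of_iso := fun α β γ h₁ h₂ h n => exact.conf_of_iso (bqIso α n) (bqIso β n) (bqIso γ n)
        (congrArg (fun t => bqComp t n) h₁) (congrArg (fun t => bqComp t n) h₂) (h n)
      kernel_cokernel := fun h => bq_kernel_cokernel h
      inflation_id := fun A => bq_inflation _ fun n => exact.inflation_id _
      deflation_id := fun A => bq_deflation _ fun n => exact.deflation_id _
      inflation_comp := fun i j ⟨_, _, hi⟩ ⟨_, _, hj⟩ => bq_inflation _ fun n =>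
        exact.inflation_comp _ _ ⟨_, _, hi n⟩ ⟨_, _, hj n⟩
      deflation_comp := fun i j ⟨_, _, hi⟩ ⟨_, _, hj⟩ => bq_deflation _ fun n =>
        exact.deflation_comp _ _ ⟨_, _, hi n⟩ ⟨_, _, hj n⟩
      inflation_pushout := fun i f h => bq_inflation_pushout i f h
      deflation_pullback := fun p f h => bq_deflation_pullback p f h }
  les := by
    intro (B : BqObj N) (C : BqObj N) (r : B ⟶ C) (s : C ⟶ B) hs
    -- A retraction is one in every degree, hence degreewise a deflation, hence a deflation of B^q
    -- N; deflations have kernels.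
    obtain ⟨K, k, hk⟩ := bq_deflation r fun n => deflation_of_comp (bqComp s n) (by
      rw [show bqComp s n ≫ bqComp r n = 𝟙 (C.obj.X n) from congrArg (fun z => bqComp z n) hs]
      exact exact.deflation_id _)
    obtain ⟨w, ⟨hl⟩, _⟩ := bq_kernel_cokernel hk
    exact ⟨⟨_, hl⟩⟩

end

end GoodExact

/-! ### Binary mapping cones -/

namespace BinaryComplex

variable {C : Type u₁} [Category.{v₁} C] [Preadditive C]

/-- A map of binary complexes given by chain maps of the top and of the bottom complexes with the
same components. -/
abbrev homMk {K L : BinaryComplex C} (f : top.obj K ⟶ top.obj L) (f' : bot.obj K ⟶ bot.obj L)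
    (h : ∀ i, f.f i = f'.f i) : K ⟶ L :=
  ⟨fun i => f.f i, fun i j => f.comm i j, fun i j => by
    rw [h, h]
    exact f'.comm i j⟩

/-- The shift of a binary complex. -/
abbrev shift (K : BinaryComplex C) : BinaryComplex C where
  X i := K.X (i - 1)
  d := (shiftC (top.obj K)).d
  d' := (shiftC (bot.obj K)).d
  shape := (shiftC (top.obj K)).shape
  shape' := (shiftC (bot.obj K)).shape
  d_comp_d := (shiftC (top.obj K)).d_comp_d
  d_comp_d' := (shiftC (bot.obj K)).d_comp_d

/-- The binary complex with zero differentials. -/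
abbrev ofGraded (X : ℤ → C) : BinaryComplex C where
  X := X
  d _ _ := 0
  d' _ _ := 0
  shape _ _ _ := rfl
  shape' _ _ _ := rfl
  d_comp_d _ _ _ := comp_zero
  d_comp_d' _ _ _ := comp_zero

variable [HasBinaryBiproducts C]

/-- The binary mapping cone of a pair of chain maps. -/
abbrev bcone {K L : BinaryComplex C} (u : top.obj K ⟶ top.obj L) (u' : bot.obj K ⟶ bot.obj L) :
    BinaryComplex C where
  X i := L.X i ⊞ K.X (i - 1)
  d := (cone u).d
  d' := (cone u').d
  shape := (cone u).shape
  shape' := (cone u').shape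
  d_comp_d := (cone u).d_comp_d
  d_comp_d' := (cone u').d_comp_d

/-- The map of binary mapping cones induced by commutative squares. -/
abbrev bconeMap {K L K' L' : BinaryComplex C} {u : top.obj K ⟶ top.obj L}
    {u' : bot.obj K ⟶ bot.obj L} {t : top.obj K' ⟶ top.obj L'} {t' : bot.obj K' ⟶ bot.obj L'}
    (a : K ⟶ K') (b : L ⟶ L') (h : top.map a ≫ t = u ≫ top.map b)
    (h' : bot.map a ≫ t' = u' ≫ bot.map b) : bcone u u' ⟶ bcone t t' :=
  homMk (coneMap u t _ _ h) (coneMap u' t' _ _ h') fun _ => rfl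

/-- The inclusion of the target in the binary mapping cone. -/
abbrev bconeInl {K L : BinaryComplex C} (u : top.obj K ⟶ top.obj L)
    (u' : bot.obj K ⟶ bot.obj L) : L ⟶ bcone u u' :=
  homMk (coneInl u) (coneInl u') fun _ => rfl

/-- The projection of the binary mapping cone to the shift of the source. -/
abbrev bconeSnd {K L : BinaryComplex C} (u : top.obj K ⟶ top.obj L)
    (u' : bot.obj K ⟶ bot.obj L) : bcone u u' ⟶ shift K :=
  homMk (coneSnd u) (coneSnd u') fun _ => rfl

end BinaryComplex

namespace GoodExact

open BinaryComplex (top bot diag bcone bconeMap bconeInl bconeSnd ofGraded comp)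

section

variable {N : ConflationCat.{v, u}} [GoodExact N]

theorem confB_bcone {K L : BinaryComplex N.carrier} (u : top.obj K ⟶ top.obj L)
    (u' : bot.obj K ⟶ bot.obj L) : ConfB N (bconeInl u u') (bconeSnd u u') :=
  fun _ => conf_biprod _ _

theorem confB_bconeMap {K K' L L' P P' : BinaryComplex N.carrier} {a : K ⟶ L} {a' : L ⟶ P}
    {b : K' ⟶ L'} {b' : L' ⟶ P'} (ha : ConfB N a a') (hb : ConfB N b b')
    {f : top.obj K ⟶ top.obj K'} {g : top.obj L ⟶ top.obj L'} {h : top.obj P ⟶ top.obj P'}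
    {f' : bot.obj K ⟶ bot.obj K'} {g' : bot.obj L ⟶ bot.obj L'} {h' : bot.obj P ⟶ bot.obj P'}
    (w₁ : top.map a ≫ g = f ≫ top.map b) (w₂ : top.map a' ≫ h = g ≫ top.map b')
    (w₁' : bot.map a ≫ g' = f' ≫ bot.map b) (w₂' : bot.map a' ≫ h' = g' ≫ bot.map b') :
    ConfB N (bconeMap a b w₁ w₁') (bconeMap a' b' w₂ w₂') :=
  fun n => conf_biprod_map (hb n) (ha (n - 1))

theorem isBq_shift {K : BinaryComplex N.carrier} (h : IsBq N K) :
    IsBq N (BinaryComplex.shift K) :=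
  ⟨h.1.shift, acyclic_shift h.2.1, acyclic_shift h.2.2⟩

theorem isBq_bcone {K L : BinaryComplex N.carrier} {u : top.obj K ⟶ top.obj L}
    {u' : bot.obj K ⟶ bot.obj L} (hK : GradedBounded K.X) (hL : GradedBounded L.X)
    (h : IsQuasiIso N u) (h' : IsQuasiIso N u') : IsBq N (bcone u u') :=
  ⟨hL.biprod hK.shift, (isQuasiIso_iff u).1 h, (isQuasiIso_iff u').1 h'⟩

theorem isBq_bcone_id {K : BinaryComplex N.carrier} (hK : GradedBounded K.X) :
    IsBq N (bcone (𝟙 (top.obj K)) (𝟙 (bot.obj K))) :=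
  isBq_bcone hK hK (isQuasiIso_of_iso (Iso.refl _)) (isQuasiIso_of_iso (Iso.refl _))

theorem isBq_bcone_of_isBq {K L : BinaryComplex N.carrier} (u : top.obj K ⟶ top.obj L)
    (u' : bot.obj K ⟶ bot.obj L) (hK : IsBq N K) (hL : IsBq N L) : IsBq N (bcone u u') :=
  (confB_bcone u u').isBq₂ hL (isBq_shift hK)

theorem acyclic_of_isZero {K : ChainComplex N.carrier ℤ} (h : ∀ i, IsZero (K.X i)) :
    Acyclic N K :=
  ⟨fun _ => 0, 0, 0, fun _ => conf_split 0 0 ((isZero_zero _).eq_of_src _ _)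
    ((isZero_zero _).eq_of_src _ _) ((isZero_zero _).eq_of_src _ _) ((h _).eq_of_src _ _),
    fun _ => (h _).eq_of_src _ _⟩

theorem isBq_of_isZero {K : BinaryComplex N.carrier} (h : ∀ i, IsZero (K.X i)) : IsBq N K :=
  ⟨⟨0, 0, fun i _ => h i⟩, acyclic_of_isZero h, acyclic_of_isZero h⟩

/-! ### Additive functions on bounded binary complexes -/

/-- An additive function on bounded binary complexes that vanishes on diagonal complexes is
zero. -/
theorem eq_zero_of_additive {G : Type*} [AddCommGroup G] (φ : BinaryComplex N.carrier → G)
    (hadd : ∀ {K L P : BinaryComplex N.carrier} (f : K ⟶ L) (g : L ⟶ P), GradedBounded K.X →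
      GradedBounded L.X → GradedBounded P.X → ConfB N f g → φ L = φ K + φ P)
    (hdiag : ∀ K : ChainComplex N.carrier ℤ, GradedBounded K.X → φ (diag.obj K) = 0)
    (X : BinaryComplex N.carrier) (hX : GradedBounded X.X) : φ X = 0 := by
  have hdiag' : ∀ X : BinaryComplex N.carrier, GradedBounded X.X →
      (∀ i j, X.d i j = X.d' i j) → φ X = 0 := fun X hX h => by
    have : X = diag.obj (top.obj X) := by
      obtain ⟨X, d, d', _, _, _, _⟩ := X
      obtain rfl : d = d' := funext fun i => funext fun j => h i j
      rfl
    rw [this]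
    exact hdiag _ hX
  obtain ⟨a, b, hX⟩ := hX
  obtain ⟨n, hn⟩ : ∃ n : ℕ, b < a + n := ⟨(b - a + 1).toNat, by omega⟩
  replace hX : ∀ i, i < a ∨ a + n ≤ i → IsZero (X.X i) := fun i hi => hX i (by omega)
  clear hn
  induction n generalizing X with
  | zero =>
    exact hdiag' X ⟨a, a, fun i hi => hX i (by omega)⟩
      fun i j => (hX i (by omega)).eq_of_src _ _
  | succ n ih =>
    -- Brutal truncation: A is the part in degrees below a + n, D the part from a + n on. As
    -- differentials lower degree, A is stable under both of them and D is the quotient.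
    have key : ∀ i, ∃ (A C : N.carrier) (ι : A ⟶ X.X i) (π : X.X i ⟶ C), N.conf ι π ∧
        (i < a + n → IsZero C) ∧ (a + n ≤ i → IsZero A) := fun i => by
      by_cases h : i < a + n
      · exact ⟨X.X i, 0, 𝟙 _, 0, conf_iso_zero _ (isZero_zero _) _, fun _ => isZero_zero _,
          fun h' => by omega⟩
      · exact ⟨0, X.X i, 0, 𝟙 _, conf_zero_iso (isZero_zero _) _ _, fun h' => by omega,
          fun h' => isZero_zero _⟩
    choose A D ι π hc hD hA using key
    have hm : ∀ i, Mono (ι i) := fun i => conf_mono (hc i)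
    have he : ∀ i, Epi (π i) := fun i => conf_epi (hc i)
    have hz : ∀ (d : ∀ i j, X.X i ⟶ X.X j) (_ : ∀ i j, ¬ (ComplexShape.down ℤ).Rel i j → d i j = 0)
        (i j : ℤ), ι i ≫ d i j ≫ π j = 0 := fun d hd i j => by
      by_cases h : (ComplexShape.down ℤ).Rel i j
      · have : j + 1 = i := h
        by_cases h' : i < a + n
        · exact (hD j (by omega)).eq_of_tgt _ _
        · exact (hA i (by omega)).eq_of_src _ _
      · rw [hd i j h, zero_comp, comp_zero]
    choose e he₁ using fun i j => conf_lift (hc j) (ι i ≫ X.d i j) (by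
      rw [Category.assoc, hz X.d X.shape])
    choose e' he₁' using fun i j => conf_lift (hc j) (ι i ≫ X.d' i j) (by
      rw [Category.assoc, hz X.d' X.shape'])
    choose r hr using fun i j => conf_desc (hc i) (X.d i j ≫ π j) (hz X.d X.shape i j)
    choose r' hr' using fun i j => conf_desc (hc i) (X.d' i j ≫ π j) (hz X.d' X.shape' i j)
    let P := BinaryComplex.ofMono X A ι e e' he₁ he₁'
    let Q := BinaryComplex.ofEpi X D π r r' hr hr'
    have hP : ∀ i, i < a ∨ a + n ≤ i → IsZero (P.X i) := fun i hi => by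
      by_cases h : a + n ≤ i
      · exact hA i h
      · exact isZero_of_mono (ι i) (hX i (by omega))
    have hQ : ∀ i, i < a + n ∨ a + n < i → IsZero (Q.X i) := fun i hi => by
      by_cases h : i < a + n
      · exact hD i h
      · exact isZero_of_epi (π i) (hX i (by push_cast; omega))
    have hconf : ConfB N (⟨ι, fun i j => (he₁ i j).symm, fun i j => (he₁' i j).symm⟩ : P ⟶ X)
        (⟨π, hr, hr'⟩ : X ⟶ Q) := hc
    rw [hadd _ _ ⟨a, a + n, fun i hi => hP i (by omega)⟩
      ⟨a, a + n + 1, fun i hi => hX i (by push_cast; omega)⟩ ⟨a + n, a + n, hQ⟩ hconf, ih P hP,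
      zero_add]
    -- The quotient lives in the single degree a + n, so both its differentials vanish and it is
    -- diagonal.
    refine hdiag' Q ⟨a + n, a + n, hQ⟩ fun i j => ?_
    by_cases h : (ComplexShape.down ℤ).Rel i j
    · have : j + 1 = i := h
      by_cases h' : i < a + n
      · exact (hQ i (Or.inl h')).eq_of_src _ _
      · by_cases h'' : a + n < i
        · exact (hQ i (Or.inr h'')).eq_of_src _ _
        · exact (hQ j (by omega)).eq_of_tgt _ _
    · rw [Q.shape i j h, Q.shape' i j h]

end

/-! ### Classes in `K_0` -/

section K0

variable {C : Type u₁} [Category.{v₁} C]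
  {conf : ∀ {A B D : C}, (A ⟶ B) → (B ⟶ D) → Prop}

/-- The class of an object in a Grothendieck group. -/
def k0mk (conf : ∀ {A B D : C}, (A ⟶ B) → (B ⟶ D) → Prop) (A : C) : K0Group C conf :=
  QuotientAddGroup.mk (FreeAbelianGroup.of A)

theorem k0mk_add {A B D : C} {i : A ⟶ B} {p : B ⟶ D} (h : conf i p) :
    k0mk conf B = k0mk conf A + k0mk conf D := by
  refine (QuotientAddGroup.eq_iff_sub_mem).2 (AddSubgroup.subset_closure ?_)
  exact ⟨A, B, D, i, p, h, rfl⟩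

/-- Every element of a Grothendieck group is a difference of two classes. -/
theorem exists_k0mk_sub [Nonempty C] (hs : ∀ A D : C, ∃ B : C,
    k0mk conf B = k0mk conf A + k0mk conf D) (x : K0Group C conf) :
    ∃ A D : C, x = k0mk conf A - k0mk conf D := by
  obtain ⟨x, rfl⟩ := QuotientAddGroup.mk_surjective x
  induction x using FreeAbelianGroup.induction_on with
  | zero =>
    obtain ⟨A⟩ := ‹Nonempty C›
    exact ⟨A, A, by simp⟩
  | of A =>
    obtain ⟨B, hB⟩ := hs A A
    exact ⟨B, A, by rw [hB]; simp [k0mk]⟩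
  | neg A _ =>
    obtain ⟨B, hB⟩ := hs A A
    exact ⟨A, B, by rw [hB]; simp [k0mk]⟩
  | add x y hx hy =>
    obtain ⟨A, B, h⟩ := hx
    obtain ⟨A', B', h'⟩ := hy
    obtain ⟨A'', hA⟩ := hs A A'
    obtain ⟨B'', hB⟩ := hs B B'
    refine ⟨A'', B'', ?_⟩
    rw [hA, hB, QuotientAddGroup.mk_add, h, h']
    abel

/-- The homomorphism from a Grothendieck group defined by an additive function. -/
def k0lift {G : Type*} [AddCommGroup G] (φ : C → G)
    (hφ : ∀ {A B D : C} (i : A ⟶ B) (p : B ⟶ D), conf i p → φ B = φ A + φ D) :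
    K0Group C conf →+ G :=
  QuotientAddGroup.lift _ (FreeAbelianGroup.lift φ) ((AddSubgroup.closure_le _).2 (by
    rintro _ ⟨A, B, D, i, p, h, rfl⟩
    simp [hφ i p h]))

@[simp]
theorem k0lift_mk {G : Type*} [AddCommGroup G] (φ : C → G)
    (hφ : ∀ {A B D : C} (i : A ⟶ B) (p : B ⟶ D), conf i p → φ B = φ A + φ D) (A : C) :
    k0lift φ hφ (k0mk conf A) = φ A := by
  exact FreeAbelianGroup.lift_apply_of φ A

end K0

end GoodExact

namespace GoodExact

open BinaryComplex (top bot diag bcone bconeMap bconeInl bconeSnd ofGraded comp)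

/-! ### The group `K_1` -/

theorem cokernel_π_surjective {A B : AddCommGrpCat.{w}} (f : A ⟶ B) :
    Function.Surjective (cokernel.π f) :=
  (AddCommGrpCat.epi_iff_surjective _).1 inferInstance

theorem vertexK_surjective : ∀ (n : ℕ) (N : ConflationCat.{v, u}),
    Function.Surjective (vertexK n N)
  | 0, N => fun x => ⟨x, rfl⟩
  | n + 1, N => by
    have h₁ := vertexK_surjective n (BqFunctor.obj N)
    have h₂ := cokernel_π_surjective ((K n).map (diagNat.app N))
    exact (h₂.comp h₁ :)

/-- The class in `K_1 N` of an object of `B^q N`. -/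
def bqClass (N : ConflationCat.{v, u}) (X : BinaryComplex N.carrier) : (K 1).obj N :=
  -- The value 0 outside B^q N makes the class a total function on binary complexes, as the
  -- dévissage `eq_zero_of_additive` requires.
  open Classical in if h : IsBq N X then vertexK 1 N (K0Class (Bq N) ⟨X, h⟩) else 0

theorem bqClass_eq {N : ConflationCat.{v, u}} {X : BinaryComplex N.carrier} (h : IsBq N X) :
    bqClass N X = vertexK 1 N (K0Class (Bq N) ⟨X, h⟩) := dif_pos h

theorem bqClass_add {N : ConflationCat.{v, u}} {X Y Z : BinaryComplex N.carrier} {f : X ⟶ Y}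
    {g : Y ⟶ Z} (h : ConfB N f g) (hX : IsBq N X) (hY : IsBq N Y) (hZ : IsBq N Z) :
    bqClass N Y = bqClass N X + bqClass N Z := by
  rw [bqClass_eq hX, bqClass_eq hY, bqClass_eq hZ]
  refine Eq.trans (congrArg (vertexK 1 N) (k0mk_add (conf := (Bq N).conf)
    (A := (⟨X, hX⟩ : BqObj N)) (B := (⟨Y, hY⟩ : BqObj N)) (D := (⟨Z, hZ⟩ : BqObj N))
    (i := ObjectProperty.homMk f) (p := ObjectProperty.homMk g) h)) ?_
  exact map_add (vertexK 1 N).hom _ _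

theorem bqClass_diag {N : ConflationCat.{v, u}} {X : ChainComplex N.carrier ℤ}
    (h : GradedBounded X.X) (h' : Acyclic N X) : bqClass N (diag.obj X) = 0 := by
  rw [bqClass_eq ⟨h, h', h'⟩]
  exact ConcreteCategory.congr_hom (cokernel.condition ((K 0).map (diagNat.app N)))
    (K0Class (Cq N) ⟨X, h, h'⟩)

/-- Every element of `K_1 N` is the difference of the classes of two objects of `B^q N`. -/
theorem exists_bqClass_sub {N : ConflationCat.{v, u}} [GoodExact N] (x : (K 1).obj N) :
    ∃ X Y : BinaryComplex N.carrier, IsBq N X ∧ IsBq N Y ∧ x = bqClass N X - bqClass N Y := by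
  obtain ⟨x, rfl⟩ := vertexK_surjective 1 N x
  have : Nonempty (BqObj N) := ⟨⟨ofGraded fun _ => 0, isBq_of_isZero fun _ => isZero_zero _⟩⟩
  obtain ⟨X, Y, h⟩ := exists_k0mk_sub (C := BqObj N) (conf := (Bq N).conf) (fun X Y =>
    ⟨⟨BinaryComplex.dsum X.obj Y.obj, isBq_dsum X.property Y.property⟩,
      k0mk_add (i := bqMk (fun n => biprod.inl) (fun n m => by simp) (fun n m => by simp))
        (p := bqMk (fun n => biprod.snd) (fun n m => by simp) (fun n m => by simp))
        fun n => conf_biprod _ _⟩) x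
  refine ⟨X.obj, Y.obj, X.property, Y.property, ?_⟩
  rw [bqClass_eq X.property, bqClass_eq Y.property]
  exact (congrArg (vertexK 1 N) h).trans (map_sub (vertexK 1 N).hom _ _)

theorem map_bqClass {M N : ConflationCat.{v, u}} (F : M ⟶ N) {X : BinaryComplex M.carrier}
    (h : IsBq M X) : (K 1).map F (bqClass M X) = bqClass N ((mapB F).obj X) := by
  have h' : IsBq N ((mapB F).obj X) := ⟨h.1.map F, h.2.1.map F, h.2.2.map F⟩
  rw [bqClass_eq h, bqClass_eq h']
  have : vertexK 1 M ≫ (K 1).map F = K0.map (BqFunctor.map F) ≫ vertexK 1 N :=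
    cokernel.π_desc _ _ _
  exact ConcreteCategory.congr_hom this _

section

variable {N : ConflationCat.{v, u}} [GoodExact N]

theorem isIso_biprod_map {A B A' B' : N.carrier} (f : A ⟶ B) (g : A' ⟶ B') [IsIso f] [IsIso g] :
    IsIso (biprod.map f g) :=
  (biprod.mapIso (asIso f) (asIso g)).isIso_hom

theorem bqClass_of_isZero {X : BinaryComplex N.carrier} (h : ∀ i, IsZero (X.X i)) :
    bqClass N X = 0 := by
  have hX := isBq_of_isZero h
  have hc : ConfB N (𝟙 X) (𝟙 X) := fun i => conf_zero_iso (h i) (𝟙 _) (𝟙 _)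
  have := bqClass_add hc hX hX hX
  simpa using this

theorem bqClass_iso {X Y : BinaryComplex N.carrier} (e : X ⟶ Y) (he : ∀ i, IsIso (comp e i))
    (hX : IsBq N X) (hY : IsBq N Y) : bqClass N X = bqClass N Y := by
  have h0 : ∀ i, IsZero ((ofGraded fun _ => (0 : N.carrier)).X i) := fun i => isZero_zero _
  have hc : ConfB N e (0 : Y ⟶ ofGraded fun _ => 0) := fun i =>
    conf_iso_zero (comp e i) (isZero_zero _) _
  rw [bqClass_add hc hX hY (isBq_of_isZero h0), bqClass_of_isZero h0, add_zero]

/-- The cone of the identity is acyclic without any acyclicity of X, so its class is an additive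
function on all bounded binary complexes. This freedom is essential, because brutal truncations of
acyclic complexes need not be acyclic. -/
theorem bqClass_bcone_id {X : BinaryComplex N.carrier} (hX : GradedBounded X.X) :
    bqClass N (bcone (𝟙 (top.obj X)) (𝟙 (bot.obj X))) = 0 := by
  refine eq_zero_of_additive (fun X => bqClass N (bcone (𝟙 (top.obj X)) (𝟙 (bot.obj X))))
    (fun f g hK hL hP h => ?_) (fun X hX => ?_) X hX
  · exact bqClass_add (confB_bconeMap h h (by simp) (by simp) (by simp) (by simp))
      (isBq_bcone_id hK) (isBq_bcone_id hL) (isBq_bcone_id hP)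
  · exact bqClass_diag (X := cone (𝟙 X)) (hX.cone hX _) (acyclic_cone_id X)

theorem bqClass_shift {X : BinaryComplex N.carrier} (h : IsBq N X) :
    bqClass N (BinaryComplex.shift X) = - bqClass N X := by
  have := bqClass_add (confB_bcone (𝟙 (top.obj X)) (𝟙 (bot.obj X))) h (isBq_bcone_id h.1)
    (isBq_shift h)
  rw [bqClass_bcone_id h.1] at this
  exact (neg_eq_of_add_eq_zero_right this.symm).symm

theorem bqClass_bcone_of_isBq {X Y : BinaryComplex N.carrier} (u : top.obj X ⟶ top.obj Y)
    (u' : bot.obj X ⟶ bot.obj Y) (hX : IsBq N X) (hY : IsBq N Y) :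
    bqClass N (bcone u u') = bqClass N Y - bqClass N X := by
  rw [bqClass_add (confB_bcone u u') hY (isBq_bcone_of_isBq u u' hX hY) (isBq_shift hX),
    bqClass_shift hX, sub_eq_add_neg]

/-- The binary mapping cone of an isomorphism has class zero. -/
theorem bqClass_bcone_of_isIso {X Y : BinaryComplex N.carrier} (hX : GradedBounded X.X)
    (hY : GradedBounded Y.X) (e : X ⟶ Y) [IsIso e] :
    bqClass N (bcone (top.map e) (bot.map e)) = 0 := by
  rw [← bqClass_bcone_id hX]
  refine (bqClass_iso (bconeMap (𝟙 X) e (by simp) (by simp)) (fun i => ?_) (isBq_bcone_id hX)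
    (isBq_bcone hX hY (isQuasiIso_of_iso (top.mapIso (asIso e)))
      (isQuasiIso_of_iso (bot.mapIso (asIso e))))).symm
  have : IsIso (comp e i) := inferInstanceAs (IsIso ((top.map e).f i))
  exact isIso_biprod_map (comp e i) (𝟙 (X.X (i - 1)))

/-- The map from the mapping cone of the inclusion to the quotient, for a short exact sequence of
complexes. -/
abbrev coneDesc {X Y Z : ChainComplex N.carrier ℤ} (i : X ⟶ Y) (p : Y ⟶ Z) (w : i ≫ p = 0) :
    cone i ⟶ Z :=
  chainMk (fun n => (biprod.fst : Y.X n ⊞ X.X (n - 1) ⟶ _) ≫ p.f n) fun n => by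
    have := HomologicalComplex.congr_hom w (n - 1)
    rw [← Category.assoc, cone_d_fst]
    simp only [HomologicalComplex.comp_f, HomologicalComplex.zero_f] at this
    simp [this]

/-- The map from the binary mapping cone of the inclusion to the quotient, for a short exact
sequence of binary complexes. -/
abbrev bconeDesc {X Y Z : BinaryComplex N.carrier} (i : X ⟶ Y) (p : Y ⟶ Z) (w : i ≫ p = 0) :
    bcone (top.map i) (bot.map i) ⟶ Z :=
  BinaryComplex.homMk
    (coneDesc (top.map i) (top.map p) (by rw [← top.map_comp, w]; rfl))
    (coneDesc (bot.map i) (bot.map p) (by rw [← bot.map_comp, w]; rfl)) fun _ => rfl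

theorem ConfB.w {X Y Z : BinaryComplex N.carrier} {i : X ⟶ Y} {p : Y ⟶ Z} (h : ConfB N i p) :
    i ≫ p = 0 := BinaryComplex.hom_ext fun n => conf_w (h n)

/-- The acyclic complex underlying the quasi-isomorphism from the mapping cone of the inclusion to
the quotient. -/
theorem ConfB.confB_bconeDesc {X Y Z : BinaryComplex N.carrier} {i : X ⟶ Y} {p : Y ⟶ Z}
    (h : ConfB N i p) :
    ConfB N (bconeMap (𝟙 X) i (by simp) (by simp) :
      bcone (𝟙 (top.obj X)) (𝟙 (bot.obj X)) ⟶ bcone (top.map i) (bot.map i))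
      (bconeDesc i p h.w) := fun n => by
  have hm := conf_mono (conf_biprod_map (h n) (conf_iso_zero (𝟙 (X.X (n - 1)))
    (isZero_zero N.carrier) 0))
  refine conf_of_deflation (i := biprod.map (comp i n) (𝟙 (X.X (n - 1))))
    (p := (biprod.fst : Y.X n ⊞ X.X (n - 1) ⟶ _) ≫ comp p n)
    (exact.deflation_comp _ _ ⟨_, _, conf_biprod' _ _⟩ ⟨_, _, h n⟩) ?_ fun x hx => ?_
  · simp [conf_w (h n)]
  · rw [← Category.assoc] at hx
    obtain ⟨y, hy⟩ := conf_lift (h n) _ hx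
    refine ⟨biprod.lift y (x ≫ biprod.snd), ?_⟩
    ext <;> simp [hy]

/-- The class of the total complex of a short exact sequence of binary complexes is zero. -/
theorem ConfB.bqClass_bcone_bconeDesc {X Y Z : BinaryComplex N.carrier} {i : X ⟶ Y} {p : Y ⟶ Z}
    (h : ConfB N i p) (hX : GradedBounded X.X) (hY : GradedBounded Y.X) (hZ : GradedBounded Z.X) :
    IsBq N (bcone (top.map (bconeDesc i p h.w)) (bot.map (bconeDesc i p h.w))) ∧
      bqClass N (bcone (top.map (bconeDesc i p h.w)) (bot.map (bconeDesc i p h.w))) = 0 := by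
  let O : BinaryComplex N.carrier := ofGraded fun _ => 0
  have hO : IsBq N O := isBq_of_isZero fun i => isZero_zero _
  have h₀ : ConfB N (0 : O ⟶ Z) (𝟙 Z) := fun n => conf_zero_iso (isZero_zero _) 0 (𝟙 _)
  -- The conflation formed by bcone(1_X), bcone(i) and Z maps to the trivial conflation formed by 0,
  -- Z and Z. Taking cones exhibits the total complex as an extension of bcone(1_Z) by the cone of
  -- bcone(1_X) ⟶ 0, both of class zero.
  have hc := confB_bconeMap (f := (0 : _ ⟶ top.obj O)) (f' := (0 : _ ⟶ bot.obj O))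
    (g := top.map (bconeDesc i p h.w)) (g' := bot.map (bconeDesc i p h.w))
    (h := 𝟙 (top.obj Z)) (h' := 𝟙 (bot.obj Z))
    h.confB_bconeDesc h₀ (by rw [← top.map_comp, h.confB_bconeDesc.w, zero_comp]; rfl) (by simp)
    (by rw [← bot.map_comp, h.confB_bconeDesc.w, zero_comp]; rfl) (by simp)
  have h₁ := isBq_bcone_of_isBq (0 : _ ⟶ top.obj O) (0 : _ ⟶ bot.obj O) (isBq_bcone_id hX) hO
  have h₂ := hc.isBq₂ h₁ (isBq_bcone_id hZ)
  refine ⟨h₂, ?_⟩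
  rw [show bqClass N (bcone (top.map (bconeDesc i p h.w)) (bot.map (bconeDesc i p h.w))) = _ from
    bqClass_add hc h₁ h₂ (isBq_bcone_id hZ), bqClass_bcone_id hZ,
    bqClass_bcone_of_isBq _ _ (isBq_bcone_id hX) hO, bqClass_bcone_id hX,
    bqClass_of_isZero fun i => isZero_zero _]
  simp

end

end GoodExact

/-! ### Monoids of isomorphism classes -/

section IsoCl

variable (C : Type u₁) [Category.{v₁} C]

/-- The type of isomorphism classes of objects. -/
def IsoCl : Type u₁ := Quotient (isIsomorphicSetoid C)

variable {C}

/-- The isomorphism class of an object. -/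
def isoCl (X : C) : IsoCl C := Quotient.mk (isIsomorphicSetoid C) X

theorem isoCl_eq_iff {X Y : C} : isoCl X = isoCl Y ↔ Nonempty (X ≅ Y) :=
  Quotient.eq (r := isIsomorphicSetoid C)

theorem isoCl_eq {X Y : C} (e : X ≅ Y) : isoCl X = isoCl Y := isoCl_eq_iff.2 ⟨e⟩

theorem isoCl_surjective : Function.Surjective (isoCl : C → IsoCl C) := Quotient.mk_surjective

variable [HasBinaryProducts C] [HasTerminal C]

instance : Zero (IsoCl C) := ⟨isoCl (⊤_ C)⟩

instance : Add (IsoCl C) :=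
  ⟨Quotient.map₂ (fun X Y => X ⨯ Y) fun _ _ ⟨e⟩ _ _ ⟨e'⟩ => ⟨prod.mapIso e e'⟩⟩

instance : AddCommMonoid (IsoCl C) where
  nsmul := nsmulRec
  add_assoc := by
    rintro ⟨X⟩ ⟨Y⟩ ⟨Z⟩
    exact isoCl_eq (prod.associator X Y Z)
  add_comm := by
    rintro ⟨X⟩ ⟨Y⟩
    exact isoCl_eq (prod.braiding X Y)
  zero_add := by
    rintro ⟨X⟩
    exact isoCl_eq (prod.leftUnitor X)
  add_zero := by
    rintro ⟨X⟩
    exact isoCl_eq (prod.rightUnitor X)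

theorem isoCl_add_of_isLimit {X Y : C} (c : BinaryFan X Y) (h : IsLimit c) :
    isoCl c.pt = isoCl X + isoCl Y :=
  isoCl_eq (h.conePointUniqueUpToIso (limit.isLimit _))

theorem isoCl_of_isTerminal {X : C} (h : IsTerminal X) : isoCl X = 0 :=
  isoCl_eq (h.uniqueUpToIso terminalIsTerminal)

end IsoCl

section Monoids

variable {S : Type w} [AddCommMonoid S]

theorem grothendieckAddGroup_of_eq_iff {x y : S} :
    Algebra.GrothendieckAddGroup.of x = Algebra.GrothendieckAddGroup.of y ↔
      ∃ c, c + x = c + y := by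
  refine (AddLocalization.mk_eq_mk_iff (b := 0) (d := 0)).trans
    (AddLocalization.r_iff_exists.trans ?_)
  simp

/-- The universal group in which the elements of a submonoid vanish. -/
theorem exists_hom_of_submonoid (A : AddSubmonoid S) :
    ∃ (G : Type w) (_ : AddCommGroup G) (q : S →+ G), (∀ a ∈ A, q a = 0) ∧
      ∀ x y, q x = q y → ∃ w, ∃ a ∈ A, ∃ b ∈ A, x + w + a = y + w + b := by
  let c : AddCon S :=
    { r := fun x y => ∃ a ∈ A, ∃ b ∈ A, x + a = y + b
      iseqv := ⟨fun x => ⟨0, A.zero_mem, 0, A.zero_mem, rfl⟩,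
        fun ⟨a, ha, b, hb, h⟩ => ⟨b, hb, a, ha, h.symm⟩,
        fun {x y z} ⟨a, ha, b, hb, h⟩ ⟨a', ha', b', hb', h'⟩ => ⟨a + a', A.add_mem ha ha', b' + b,
          A.add_mem hb' hb, by rw [← add_assoc, h, add_right_comm, h', add_assoc]⟩⟩
      add' := fun {x y z t} ⟨a, ha, b, hb, h⟩ ⟨a', ha', b', hb', h'⟩ => ⟨a + a', A.add_mem ha ha',
        b + b', A.add_mem hb hb', by rw [add_add_add_comm, h, h', add_add_add_comm]⟩ }
  refine ⟨Algebra.GrothendieckAddGroup c.Quotient, inferInstance,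
    Algebra.GrothendieckAddGroup.of.comp c.mk', fun a ha => ?_, fun x y h => ?_⟩
  · have : c.mk' a = 0 := (AddCon.eq c).2 ⟨0, A.zero_mem, a, ha, by simp⟩
    rw [AddMonoidHom.comp_apply, this, map_zero]
  · obtain ⟨w, hw⟩ := grothendieckAddGroup_of_eq_iff.1 h
    obtain ⟨w, rfl⟩ := AddCon.mk'_surjective w
    obtain ⟨a, ha, b, hb, h'⟩ := (AddCon.eq c (a := w + x) (b := w + y)).1 hw
    exact ⟨w, a, ha, b, hb, by rw [add_comm x, add_comm y, h']⟩

/-- A group to which an additive partial function to a group extends. -/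
theorem exists_hom_of_partial {H : Type*} [AddCommGroup H] (R : S → H → Prop) (h0 : R 0 0)
    (huniq : ∀ {s h h'}, R s h → R s h' → h = h')
    (hadd : ∀ {s t h h'}, R s h → R t h' → R (s + t) (h + h')) (hex : ∀ s, ∃ t h, R (s + t) h) :
    ∃ (G : Type w) (_ : AddCommGroup G) (q : S →+ G),
      (∀ s t u h, R (s + u) h → R (t + u) h → q s = q t) ∧
      ∀ s t h h', R s h → R t h' → q s = q t → h = h' := by
  -- Two elements are identified when some common complement u brings both into the domain of R with
  -- the same value.
  let c : AddCon S :=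
    { r := fun s t => ∃ u h, R (s + u) h ∧ R (t + u) h
      iseqv := ⟨fun s => by
          obtain ⟨t, h, ht⟩ := hex s
          exact ⟨t, h, ht, ht⟩, fun ⟨u, h, h₁, h₂⟩ => ⟨u, h, h₂, h₁⟩,
        fun {x y z} ⟨u, h, h₁, h₂⟩ ⟨u', h', h₁', h₂'⟩ => ⟨u + (y + u'), h + h', by
            simpa only [add_assoc] using hadd h₁ h₁', by
            simpa only [add_comm, add_left_comm] using hadd h₂ h₂'⟩⟩
      add' := fun {x y z t} ⟨u, h, h₁, h₂⟩ ⟨u', h', h₁', h₂'⟩ => ⟨u + u', h + h', by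
        rw [add_add_add_comm]
        exact hadd h₁ h₁', by
        rw [add_add_add_comm]
        exact hadd h₂ h₂'⟩ }
  refine ⟨Algebra.GrothendieckAddGroup c.Quotient, inferInstance,
    Algebra.GrothendieckAddGroup.of.comp c.mk', fun s t u h h₁ h₂ => ?_,
    fun s t h h' h₁ h₂ hst => ?_⟩
  · have : c.mk' s = c.mk' t := (AddCon.eq c).2 ⟨u, h, h₁, h₂⟩
    rw [AddMonoidHom.comp_apply, AddMonoidHom.comp_apply, this]
  · obtain ⟨w, hw⟩ := grothendieckAddGroup_of_eq_iff.1 hst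
    obtain ⟨w, rfl⟩ := AddCon.mk'_surjective w
    obtain ⟨u, k, h₃, h₄⟩ := (AddCon.eq c (a := w + s) (b := w + t)).1 hw
    -- The element w + s + t + u gets two values, k + h' and k + h; uniqueness and cancellation in H
    -- conclude.
    have h₅ := hadd h₃ h₂
    have h₆ := hadd h₄ h₁
    rw [show w + t + u + s = w + s + u + t by abel] at h₆
    exact add_left_cancel (huniq h₆ h₅)

end Monoids

/-! ### Graded objects with equal Euler characteristic -/

namespace GoodExact

open BinaryComplex (top bot diag bcone bconeMap bconeInl bconeSnd ofGraded comp)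

section

variable {N : ConflationCat.{v, u}} [GoodExact N]

instance : HasBinaryProducts N.carrier := inferInstance

theorem isoCl_biprod (A B : N.carrier) : isoCl (A ⊞ B) = isoCl A + isoCl B :=
  isoCl_eq (biprod.isoProd A B)

theorem isoCl_of_isZero {A : N.carrier} (h : IsZero A) : isoCl A = 0 :=
  isoCl_eq (h.isoZero ≪≫ HasZeroObject.zeroIsoTerminal)

variable (N) in
/-- The graded isomorphism classes of bounded acyclic complexes. -/
def acyclicClasses : AddSubmonoid (ℤ →₀ IsoCl N.carrier) where
  carrier := {x | ∃ A : ChainComplex N.carrier ℤ, GradedBounded A.X ∧ Acyclic N A ∧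
    ∀ i, x i = isoCl (A.X i)}
  zero_mem' := ⟨(ofGraded fun _ => 0 : BinaryComplex N.carrier) |> top.obj,
    ⟨0, 0, fun _ _ => isZero_zero _⟩, acyclic_of_isZero fun _ => isZero_zero _,
    fun _ => (isoCl_of_isZero (isZero_zero _)).symm⟩
  add_mem' := by
    rintro x y ⟨A, hA, hA', hx⟩ ⟨B, hB, hB', hy⟩
    refine ⟨dsum A B, hA.biprod hB, (confC_dsum A B).acyclic₂ (hA.biprod hB) hA' hB', fun i => ?_⟩
    rw [Finsupp.add_apply, hx, hy]
    exact (isoCl_biprod _ _).symm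

open Classical in
/-- The graded isomorphism class of a bounded graded object. -/
def gradedClass (X : ℤ → N.carrier) (hX : GradedBounded X) : ℤ →₀ IsoCl N.carrier :=
  Finsupp.ofSupportFinite (fun i => isoCl (X i)) (by
    obtain ⟨a, b, h⟩ := hX
    refine (Set.finite_Icc a b).subset fun i hi => ?_
    by_contra h'
    exact hi (isoCl_of_isZero (h i (by simp at h'; omega))))

@[simp]
theorem gradedClass_apply (X : ℤ → N.carrier) (hX : GradedBounded X) (i : ℤ) :
    gradedClass X hX i = isoCl (X i) := rfl

theorem exists_gradedClass (x : ℤ →₀ IsoCl N.carrier) :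
    ∃ (X : ℤ → N.carrier) (hX : GradedBounded X), gradedClass X hX = x := by
  choose r hr using fun i => isoCl_surjective (x i)
  refine ⟨r, ?_, Finsupp.ext hr⟩
  obtain ⟨a, ha⟩ := x.support.bddBelow
  obtain ⟨b, hb⟩ := x.support.bddAbove
  refine ⟨a, b, fun i hi => ?_⟩
  have : i ∉ x.support := fun h => by
    have := ha h
    have := hb h
    omega
  rw [Finsupp.notMem_support_iff, ← hr, ← isoCl_of_isZero (isZero_zero N.carrier),
    isoCl_eq_iff] at this
  exact (isZero_zero _).of_iso this.some

theorem K0Class_of_isZero {A : N.carrier} (h : IsZero A) : K0Class N A = 0 := by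
  have := k0mk_add (conf := N.conf) (conf_zero_iso h (𝟙 A) (𝟙 A))
  simpa [k0mk, K0Class] using this

theorem eulerChar_eq_sum {X : ℤ → N.carrier} (s : Finset ℤ) (h : ∀ i, i ∉ s → IsZero (X i)) :
    eulerChar N X = ∑ i ∈ s, (i.negOnePow : ℤ) • K0Class N (X i) := by
  refine finsum_eq_sum_of_support_subset _ fun i hi => ?_
  by_contra h'
  refine hi ?_
  simp only
  rw [K0Class_of_isZero (h i h'), smul_zero]

theorem _root_.GradedBounded.exists_finset {C : Type u₁} [Category.{v₁} C] {X : ℤ → C}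
    (h : GradedBounded X) : ∃ s : Finset ℤ, ∀ i, i ∉ s → IsZero (X i) := by
  obtain ⟨a, b, h⟩ := h
  exact ⟨Finset.Icc a b, fun i hi => h i (by simp at hi; omega)⟩

/-- Bounded graded objects with the same Euler characteristic become isomorphic after adding
bounded acyclic complexes. -/
theorem exists_acyclic_of_eulerChar_eq {X Y : ℤ → N.carrier} (hX : GradedBounded X)
    (hY : GradedBounded Y) (h : eulerChar N X = eulerChar N Y) :
    ∃ A B : ChainComplex N.carrier ℤ, GradedBounded A.X ∧ Acyclic N A ∧ GradedBounded B.X ∧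
      Acyclic N B ∧ ∀ i, Nonempty (X i ⊞ A.X i ≅ Y i ⊞ B.X i) := by
  -- G is universal among groups in which graded isomorphism classes of bounded acyclic complexes
  -- vanish. The aim is to show that q factors through the Euler characteristic.
  obtain ⟨G, _, q, hq, hq'⟩ := exists_hom_of_submonoid (acyclicClasses N)
  have hshift : ∀ (W : ℤ → N.carrier) (hW : GradedBounded W),
      q (gradedClass _ hW.shift) = - q (gradedClass W hW) := fun W hW => by
    -- Give W zero differentials: the cone of its identity is acyclic, with terms W and its shift.
    have hc := hq (gradedClass W hW + gradedClass _ hW.shift)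
      ⟨cone (𝟙 (top.obj (ofGraded W))), hW.biprod hW.shift, acyclic_cone_id _,
        fun i => (isoCl_biprod _ _).symm⟩
    rw [map_add] at hc
    exact (neg_eq_of_add_eq_zero_right hc).symm
  have hsingle : ∀ (i : ℤ) (x : IsoCl N.carrier),
      q (Finsupp.single (i + 1) x) = - q (Finsupp.single i x) := fun i x => by
    obtain ⟨W, hW, hWx⟩ := exists_gradedClass (Finsupp.single i x)
    rw [← hWx, ← hshift]
    congr 1
    ext j
    have hj := DFunLike.congr_fun hWx (j - 1)
    rw [gradedClass_apply] at hj
    rw [gradedClass_apply, hj, Finsupp.single_apply, Finsupp.single_apply]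
    exact if_congr (by omega) rfl rfl
  have hsingle' : ∀ (i : ℤ) (x : IsoCl N.carrier),
      q (Finsupp.single i x) = (i.negOnePow : ℤ) • q (Finsupp.single 0 x) := fun i x => by
    induction i with
    | zero => simp
    | succ i ih => rw [hsingle, ih, Int.negOnePow_succ, Units.val_neg, neg_smul]
    | pred i ih =>
      rw [← neg_eq_iff_eq_neg.2 (hsingle (-i - 1) x), sub_add_cancel, ih]
      rw [Int.negOnePow_sub, Int.negOnePow_one, mul_neg, mul_one, Units.val_neg, neg_smul]
  let S : N.carrier ⥤ ChainComplex N.carrier ℤ := HomologicalComplex.single _ _ 0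
  have hS : ∀ (A : N.carrier) (j : ℤ), j ≠ 0 → IsZero ((S.obj A).X j) := fun A j hj =>
    HomologicalComplex.isZero_single_obj_X _ _ _ _ hj
  have hSb : ∀ A : N.carrier, GradedBounded (S.obj A).X := fun A =>
    ⟨0, 0, fun j hj => hS A j (by omega)⟩
  have hScl : ∀ A : N.carrier, gradedClass _ (hSb A) = Finsupp.single 0 (isoCl A) := fun A => by
    ext j
    rw [gradedClass_apply]
    by_cases hj : j = 0
    · subst hj
      rw [Finsupp.single_eq_same]
      exact isoCl_eq (HomologicalComplex.singleObjXSelf _ _ _)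
    · rw [Finsupp.single_eq_of_ne (by simpa using hj), isoCl_of_isZero (hS A j hj)]
  let Φ : K0Group N.carrier N.conf →+ G := k0lift (fun A => q (Finsupp.single 0 (isoCl A))) (by
    intro A B D i p hip
    have hc : ConfB N (diag.map (S.map i)) (diag.map (S.map p)) := fun j => by
      by_cases hj : j = 0
      · subst hj
        let e : ∀ A, A ≅ (S.obj A).X 0 := fun A => (HomologicalComplex.singleObjXSelf _ _ _).symm
        have he : ∀ {A B : N.carrier} (f : A ⟶ B), f ≫ (e B).hom = (e A).hom ≫ (S.map f).f 0 :=
          fun f => by simp [S, e, HomologicalComplex.single_map_f_self]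
        exact exact.conf_of_iso (e A) (e B) (e D) (he i) (he p) hip
      · have : IsIso (comp (diag.map (S.map p)) j) := by
          rw [show comp (diag.map (S.map p)) j = ((hS B j hj).iso (hS D j hj)).hom from
            (hS B j hj).eq_of_src _ _]
          exact Iso.isIso_hom _
        exact conf_zero_iso (hS A j hj) _ _
    -- A conflation placed in degree zero has an acyclic total complex with terms D, the shift of B
    -- and the double shift of A. Its vanishing in G is the additivity relation.
    obtain ⟨⟨hT, hT', _⟩, _⟩ := hc.bqClass_bcone_bconeDesc (hSb A) (hSb B) (hSb D)
    have hz := hq (gradedClass _ (hSb D) + (gradedClass _ (hSb B).shift +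
      gradedClass _ (hSb A).shift.shift)) ⟨_, hT, hT', fun i =>
        ((isoCl_biprod _ _).trans (congrArg _ (isoCl_biprod _ _))).symm⟩
    rw [map_add, map_add, hshift _ (hSb B), hshift _ (hSb A).shift,
      hshift _ (hSb A), neg_neg, hScl, hScl, hScl] at hz
    rw [← sub_eq_zero, ← neg_eq_zero, ← hz]
    abel)
  have hΦ : ∀ (W : ℤ → N.carrier) (hW : GradedBounded W), q (gradedClass W hW) =
      Φ (eulerChar N W) := fun W hW => by
    obtain ⟨s, hs⟩ := hW.exists_finset
    have : gradedClass W hW = ∑ i ∈ s, Finsupp.single i (isoCl (W i)) := by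
      ext j
      rw [Finsupp.finsetSum_apply]
      simp only [Finsupp.single_apply, Finset.sum_ite_eq', gradedClass_apply]
      split_ifs with hj
      · rfl
      · exact isoCl_of_isZero (hs j hj)
    rw [this, map_sum, eulerChar_eq_sum s hs, map_sum]
    refine Finset.sum_congr rfl fun i _ => ?_
    rw [hsingle', map_zsmul]
    exact congrArg _ (k0lift_mk (conf := N.conf)
      (fun A => q (Finsupp.single 0 (isoCl A))) _ (W i)).symm
  obtain ⟨w, a, ⟨A, hA, hA', ha⟩, b, ⟨B, hB, hB', hb⟩, hw⟩ :=
    hq' (gradedClass X hX) (gradedClass Y hY) (by rw [hΦ, hΦ, h])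
  obtain ⟨W, hW, rfl⟩ := exists_gradedClass w
  -- The element w left over from group completion need not be acyclic. Adding the shift of W as
  -- well replaces it by the acyclic cone of the identity of W.
  let T := cone (𝟙 (top.obj (ofGraded W)))
  have hT : GradedBounded T.X := hW.biprod hW.shift
  have hT' : Acyclic N T := acyclic_cone_id _
  refine ⟨dsum T A, dsum T B, hT.biprod hA, (confC_dsum T A).acyclic₂ (hT.biprod hA) hT' hA',
    hT.biprod hB, (confC_dsum T B).acyclic₂ (hT.biprod hB) hT' hB', fun i => ?_⟩
  rw [← isoCl_eq_iff]
  have hi := DFunLike.congr_fun hw i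
  simp only [Finsupp.add_apply, gradedClass_apply, ha, hb] at hi
  simp only [isoCl_biprod]
  change isoCl (X i) + (isoCl (W i ⊞ W (i - 1)) + isoCl (A.X i)) =
    isoCl (Y i) + (isoCl (W i ⊞ W (i - 1)) + isoCl (B.X i))
  rw [isoCl_biprod, show isoCl (X i) + (isoCl (W i) + isoCl (W (i - 1)) + isoCl (A.X i)) =
    isoCl (X i) + isoCl (W i) + isoCl (A.X i) + isoCl (W (i - 1)) by abel, hi]
  abel

end

end GoodExact

namespace GoodExact

open BinaryComplex (top bot diag bcone bconeMap bconeInl bconeSnd ofGraded comp)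

section

variable {M N : ConflationCat.{v, u}} [GoodExact M] [GoodExact N] {F : M ⟶ N}

/-! ### Mapping cones and exact functors -/

theorem map_comp_eq_of_eq {A A' B' : M.carrier} {D D' : N.carrier} (y : A ⟶ A') (x : A' ⟶ B')
    (z : (fn F).obj B' ⟶ D) (z' : (fn F).obj A' ⟶ D') (t : D' ⟶ D)
    (h : (fn F).map x ≫ z = z' ≫ t) :
    (fn F).map (y ≫ x) ≫ z = ((fn F).map y ≫ z') ≫ t := by
  rw [Functor.map_comp, Category.assoc, h, Category.assoc]

theorem map_comp_map_comp_of_id {A B : M.carrier} {D : N.carrier} (x : A ⟶ B) (y : B ⟶ A)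
    (h : x ≫ y = 𝟙 A) (z : (fn F).obj A ⟶ D) : (fn F).map x ≫ (fn F).map y ≫ z = z := by
  rw [← Functor.map_comp_assoc, h, CategoryTheory.Functor.map_id, Category.id_comp]

theorem map_comp_map_comp_of_zero {A B C : M.carrier} {D : N.carrier} (x : A ⟶ B) (y : B ⟶ C)
    (h : x ≫ y = 0) (z : (fn F).obj C ⟶ D) : (fn F).map x ≫ (fn F).map y ≫ z = 0 := by
  rw [← Functor.map_comp_assoc, h, Functor.map_zero, zero_comp]

theorem map_comp_map_comp_of_eq {A B A' B' : M.carrier} {D D' : N.carrier} (x : A ⟶ B)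
    (y : B ⟶ B') (y' : A ⟶ A') (x' : A' ⟶ B') (h : x ≫ y = y' ≫ x') (z : (fn F).obj B' ⟶ D)
    (z' : (fn F).obj A' ⟶ D') (t : D' ⟶ D) (hz : (fn F).map x' ≫ z = z' ≫ t) :
    (fn F).map x ≫ (fn F).map y ≫ z = ((fn F).map y' ≫ z') ≫ t := by
  rw [← Functor.map_comp_assoc, h, map_comp_eq_of_eq _ _ _ _ _ hz]

/-- An exact functor commutes with mapping cones. -/
def mapConeIso {K L : ChainComplex M.carrier ℤ} (F : M ⟶ N) (f : K ⟶ L) :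
    (mapC F).obj (cone f) ≅ cone ((mapC F).map f) := ((conePresentation f).map F).iso

/-- The map from the image of a mapping cone under an exact functor to a mapping cone. -/
abbrev mapConeTo {K L : ChainComplex M.carrier ℤ} {K' L' : ChainComplex N.carrier ℤ}
    (f : K ⟶ L) (g : K' ⟶ L') (a : (mapC F).obj K ⟶ K') (b : (mapC F).obj L ⟶ L')
    (h : a ≫ g = (mapC F).map f ≫ b) : (mapC F).obj (cone f) ⟶ cone g :=
  (mapConeIso F f).hom ≫ coneMap _ _ a b h

theorem mapConeTo_f_fst {K L : ChainComplex M.carrier ℤ} {K' L' : ChainComplex N.carrier ℤ}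
    {f : K ⟶ L} {g : K' ⟶ L'} {a : (mapC F).obj K ⟶ K'} {b : (mapC F).obj L ⟶ L'}
    (h : a ≫ g = (mapC F).map f ≫ b) (i : ℤ) :
    (mapConeTo f g a b h).f i ≫ (biprod.fst : L'.X i ⊞ K'.X (i - 1) ⟶ _) =
      (fn F).map biprod.fst ≫ b.f i := by
  change (biprod.lift _ _ ≫ biprod.map _ _) ≫ biprod.fst = _
  rw [Category.assoc, biprod.map_fst, biprod.lift_fst_assoc]
  rfl

theorem mapConeTo_f_snd {K L : ChainComplex M.carrier ℤ} {K' L' : ChainComplex N.carrier ℤ}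
    {f : K ⟶ L} {g : K' ⟶ L'} {a : (mapC F).obj K ⟶ K'} {b : (mapC F).obj L ⟶ L'}
    (h : a ≫ g = (mapC F).map f ≫ b) (i : ℤ) :
    (mapConeTo f g a b h).f i ≫ (biprod.snd : L'.X i ⊞ K'.X (i - 1) ⟶ _) =
      (fn F).map biprod.snd ≫ a.f (i - 1) := by
  change (biprod.lift _ _ ≫ biprod.map _ _) ≫ biprod.snd = _
  rw [Category.assoc, biprod.map_snd, biprod.lift_snd_assoc]
  rfl

/-- An exact functor commutes with shifts. -/
def mapShiftIso (F : M ⟶ N) (K : ChainComplex M.carrier ℤ) :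
    (mapC F).obj (shiftC K) ≅ shiftC ((mapC F).obj K) :=
  HomologicalComplex.Hom.isoOfComponents (fun i => Iso.refl _) fun i j _ => by
    change 𝟙 _ ≫ (- (fn F).map _) = (fn F).map (- _) ≫ 𝟙 _
    simp

/-- The shift of a map from the image of a complex under an exact functor. -/
abbrev mapShiftTo {K : ChainComplex M.carrier ℤ} {K' : ChainComplex N.carrier ℤ}
    (a : (mapC F).obj K ⟶ K') : (mapC F).obj (shiftC K) ⟶ shiftC K' :=
  (mapShiftIso F K).hom ≫ shiftMap a

theorem mapShiftTo_f {K : ChainComplex M.carrier ℤ} {K' : ChainComplex N.carrier ℤ}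
    (a : (mapC F).obj K ⟶ K') (i : ℤ) : (mapShiftTo a).f i = a.f (i - 1) :=
  Category.id_comp _

variable {K L : ChainComplex M.carrier ℤ} {K' L' : ChainComplex N.carrier ℤ}
  {f : K ⟶ L} {g : K' ⟶ L'} {a : (mapC F).obj K ⟶ K'} {b : (mapC F).obj L ⟶ L'}

theorem map_coneInl_mapConeTo (h : a ≫ g = (mapC F).map f ≫ b) :
    (mapC F).map (coneInl f) ≫ mapConeTo f g a b h = b ≫ coneInl g := by
  refine HomologicalComplex.hom_ext _ _ fun i => biprod.hom_ext _ _ ?_ ?_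
  · rw [HomologicalComplex.comp_f, Category.assoc, mapConeTo_f_fst]
    refine (map_comp_map_comp_of_id _ _ biprod.inl_fst _).trans ?_
    rw [HomologicalComplex.comp_f, coneInl_f, Category.assoc, biprod.inl_fst]
    exact (Category.comp_id _).symm
  · rw [HomologicalComplex.comp_f, Category.assoc, mapConeTo_f_snd]
    refine (map_comp_map_comp_of_zero _ _ biprod.inl_snd _).trans ?_
    rw [HomologicalComplex.comp_f, coneInl_f, Category.assoc, biprod.inl_snd]
    exact comp_zero.symm

theorem mapConeTo_coneSnd (h : a ≫ g = (mapC F).map f ≫ b) :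
    mapConeTo f g a b h ≫ coneSnd g = (mapC F).map (coneSnd f) ≫ mapShiftTo a := by
  refine HomologicalComplex.hom_ext _ _ fun i => ?_
  refine (mapConeTo_f_snd h i).trans ?_
  rw [HomologicalComplex.comp_f, mapShiftTo_f]
  rfl

theorem map_coneMap_mapConeTo (h : a ≫ g = (mapC F).map f ≫ b)
    {K₁ L₁ : ChainComplex M.carrier ℤ} {K₁' L₁' : ChainComplex N.carrier ℤ}
    {f₁ : K₁ ⟶ L₁} {g₁ : K₁' ⟶ L₁'} {a₁ : (mapC F).obj K₁ ⟶ K₁'} {b₁ : (mapC F).obj L₁ ⟶ L₁'}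
    (h₁ : a₁ ≫ g₁ = (mapC F).map f₁ ≫ b₁) (α : K ⟶ K₁) (β : L ⟶ L₁) (w : α ≫ f₁ = f ≫ β)
    (α' : K' ⟶ K₁') (β' : L' ⟶ L₁') (w' : α' ≫ g₁ = g ≫ β')
    (hα : (mapC F).map α ≫ a₁ = a ≫ α') (hβ : (mapC F).map β ≫ b₁ = b ≫ β') :
    (mapC F).map (coneMap f f₁ α β w) ≫ mapConeTo f₁ g₁ a₁ b₁ h₁ =
      mapConeTo f g a b h ≫ coneMap g g₁ α' β' w' := by
  refine HomologicalComplex.hom_ext _ _ fun i => biprod.hom_ext _ _ ?_ ?_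
  · rw [HomologicalComplex.comp_f, Category.assoc, mapConeTo_f_fst, HomologicalComplex.comp_f,
      Category.assoc, coneMap_f, biprod.map_fst, ← Category.assoc _ biprod.fst, mapConeTo_f_fst]
    exact map_comp_map_comp_of_eq _ _ _ _ (biprod.map_fst _ _) _ _ _
      (HomologicalComplex.congr_hom hβ i)
  · rw [HomologicalComplex.comp_f, Category.assoc, mapConeTo_f_snd, HomologicalComplex.comp_f,
      Category.assoc, coneMap_f, biprod.map_snd, ← Category.assoc _ biprod.snd, mapConeTo_f_snd]
    exact map_comp_map_comp_of_eq _ _ _ _ (biprod.map_snd _ _) _ _ _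
      (HomologicalComplex.congr_hom hα (i - 1))

theorem map_coneDesc (h : a ≫ g = (mapC F).map f ≫ b) {P : ChainComplex M.carrier ℤ}
    {P' : ChainComplex N.carrier ℤ} (p : L ⟶ P) (p' : L' ⟶ P') (w : f ≫ p = 0) (w' : g ≫ p' = 0)
    (c : (mapC F).obj P ⟶ P') (hc : (mapC F).map p ≫ c = b ≫ p') :
    (mapC F).map (coneDesc f p w) ≫ c = mapConeTo f g a b h ≫ coneDesc g p' w' := by
  refine HomologicalComplex.hom_ext _ _ fun i => ?_
  change _ = (mapConeTo f g a b h).f i ≫ biprod.fst ≫ p'.f i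
  rw [← Category.assoc, mapConeTo_f_fst]
  exact map_comp_eq_of_eq _ _ _ _ _ (HomologicalComplex.congr_hom hc i)

theorem ConfC.map {X Y Z : ChainComplex M.carrier ℤ} {i : X ⟶ Y} {p : Y ⟶ Z} (F : M ⟶ N)
    (h : ConfC M i p) : ConfC N ((mapC F).map i) ((mapC F).map p) :=
  fun n => ConflationCat.Hom.map_conf F _ _ (h n)

theorem ConfB.map {X Y Z : BinaryComplex M.carrier} {i : X ⟶ Y} {p : Y ⟶ Z} (F : M ⟶ N)
    (h : ConfB M i p) : ConfB N ((mapB F).map i) ((mapB F).map p) :=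
  fun n => ConflationCat.Hom.map_conf F _ _ (h n)

theorem isQuasiIso_mapShiftTo {K : ChainComplex M.carrier ℤ} {K' : ChainComplex N.carrier ℤ}
    {a : (mapC F).obj K ⟶ K'} (hK : GradedBounded K.X) (hK' : GradedBounded K'.X)
    (ha : IsQuasiIso N a) : IsQuasiIso N (mapShiftTo a) :=
  ((isQuasiIso_shiftMap_iff a (hK.map F) hK').2 ha).iso_comp _ _

/-- The cones of the three vertical maps form a conflation whose outer terms are acyclic. -/
theorem isQuasiIso_of_confC {X Y Z X' Y' Z' : ChainComplex N.carrier ℤ} {i : X ⟶ Y} {p : Y ⟶ Z}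
    {i' : X' ⟶ Y'} {p' : Y' ⟶ Z'} (h : ConfC N i p) (h' : ConfC N i' p') {f : X ⟶ X'}
    {g : Y ⟶ Y'} {k : Z ⟶ Z'} (w : i ≫ g = f ≫ i') (w' : p ≫ k = g ≫ p')
    (hY : GradedBounded Y.X) (hY' : GradedBounded Y'.X) (hf : IsQuasiIso N f)
    (hk : IsQuasiIso N k) : IsQuasiIso N g := by
  rw [isQuasiIso_iff] at hf hk ⊢
  exact (h.coneMap h' w w').acyclic₂ (hY.cone hY' g) hf hk

theorem isQuasiIso_mapConeTo (h : a ≫ g = (mapC F).map f ≫ b) (hK : GradedBounded K.X)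
    (hL : GradedBounded L.X) (hK' : GradedBounded K'.X) (hL' : GradedBounded L'.X)
    (ha : IsQuasiIso N a) (hb : IsQuasiIso N b) : IsQuasiIso N (mapConeTo f g a b h) :=
  isQuasiIso_of_confC ((confC_cone f).map F) (confC_cone g) (map_coneInl_mapConeTo h)
    (mapConeTo_coneSnd h).symm ((hK.cone hL f).map F) (hK'.cone hL' g) hb
    (isQuasiIso_mapShiftTo hK hK' ha)

end

end GoodExact

/-! ### Direct sums of complexes -/

section Dsum

variable {C : Type u₁} [Category.{v₁} C] [Preadditive C] [HasBinaryBiproducts C]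

/-- The map to a direct sum of complexes given by its coordinates. -/
def dsumLift {K L L' : ChainComplex C ℤ} (a : K ⟶ L) (b : K ⟶ L') : K ⟶ dsum L L' :=
  a ≫ dsumInl L L' + b ≫ dsumInr L L'

theorem dsum_hom_ext {K L L' : ChainComplex C ℤ} {f g : K ⟶ dsum L L'}
    (h : f ≫ dsumFst L L' = g ≫ dsumFst L L') (h' : f ≫ dsumSnd L L' = g ≫ dsumSnd L L') :
    f = g :=
  HomologicalComplex.hom_ext _ _ fun i => biprod.hom_ext _ _
    (HomologicalComplex.congr_hom h i) (HomologicalComplex.congr_hom h' i)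

theorem dsumInl_snd (K L : ChainComplex C ℤ) : dsumInl K L ≫ dsumSnd K L = 0 := by
  ext i
  simp

theorem dsumInr_fst (K L : ChainComplex C ℤ) : dsumInr K L ≫ dsumFst K L = 0 := by
  ext i
  simp

theorem dsumInr_snd (K L : ChainComplex C ℤ) : dsumInr K L ≫ dsumSnd K L = 𝟙 _ := by
  ext i
  simp

@[simp]
theorem dsumLift_fst {K L L' : ChainComplex C ℤ} (a : K ⟶ L) (b : K ⟶ L') :
    dsumLift a b ≫ dsumFst L L' = a := by
  simp [dsumLift, dsumInl_fst, dsumInr_fst]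

@[simp]
theorem dsumLift_snd {K L L' : ChainComplex C ℤ} (a : K ⟶ L) (b : K ⟶ L') :
    dsumLift a b ≫ dsumSnd L L' = b := by
  simp [dsumLift, dsumInl_snd, dsumInr_snd]

theorem dsumMap_fst {K L K' L' : ChainComplex C ℤ} (a : K ⟶ K') (b : L ⟶ L') :
    dsumMap a b ≫ dsumFst K' L' = dsumFst K L ≫ a := by
  refine HomologicalComplex.hom_ext _ _ fun i => ?_
  simp

theorem dsumMap_snd {K L K' L' : ChainComplex C ℤ} (a : K ⟶ K') (b : L ⟶ L') :
    dsumMap a b ≫ dsumSnd K' L' = dsumSnd K L ≫ b := by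
  refine HomologicalComplex.hom_ext _ _ fun i => ?_
  simp

theorem dsumInl_map {K L K' L' : ChainComplex C ℤ} (a : K ⟶ K') (b : L ⟶ L') :
    dsumInl K L ≫ dsumMap a b = a ≫ dsumInl K' L' := by
  refine HomologicalComplex.hom_ext _ _ fun i => ?_
  simp

end Dsum

namespace BinaryComplex

variable {C : Type u₁} [Category.{v₁} C] [Preadditive C]

theorem isIso_of_comp {K L : BinaryComplex C} (f : K ⟶ L) (h : ∀ i, IsIso (comp f i)) :
    IsIso f := by
  refine ⟨⟨⟨fun i => inv (comp f i), fun i j => ?_, fun i j => ?_⟩, hom_ext fun i => ?_,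
    hom_ext fun i => ?_⟩⟩
  · rw [IsIso.inv_comp_eq, ← Category.assoc, IsIso.eq_comp_inv]
    exact (Hom.comm f i j).symm
  · rw [IsIso.inv_comp_eq, ← Category.assoc, IsIso.eq_comp_inv]
    exact (Hom.comm' f i j).symm
  · exact IsIso.hom_inv_id (comp f i)
  · exact IsIso.inv_hom_id (comp f i)

instance {K L : BinaryComplex C} (f : K ⟶ L) [IsIso f] (i : ℤ) : IsIso (comp f i) :=
  inferInstanceAs (IsIso ((top.map f).f i))

/-- The binary complex with the two differentials exchanged. -/
abbrev swap (K : BinaryComplex C) : BinaryComplex C where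
  X := K.X
  d := K.d'
  d' := K.d
  shape := K.shape'
  shape' := K.shape
  d_comp_d := K.d_comp_d'
  d_comp_d' := K.d_comp_d

variable [HasBinaryBiproducts C]

/-- The map of direct sums of binary complexes induced by two maps. -/
abbrev dsumMap {K L K' L' : BinaryComplex C} (a : K ⟶ K') (b : L ⟶ L') : dsum K L ⟶ dsum K' L' :=
  homMk (_root_.dsumMap (top.map a) (top.map b)) (_root_.dsumMap (bot.map a) (bot.map b))
    fun _ => rfl

end BinaryComplex

namespace GoodExact

open BinaryComplex (top bot diag bcone bconeMap bconeInl bconeSnd ofGraded comp)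

section

variable {M N : ConflationCat.{v, u}} [GoodExact M] [GoodExact N] {F : M ⟶ N}

theorem biprod_map_comp_map {A B C D : N.carrier} {f : A ⟶ B} {f' : B ⟶ A} {g : C ⟶ D}
    {g' : D ⟶ C} (hf : f ≫ f' = 𝟙 A) (hg : g ≫ g' = 𝟙 C) :
    biprod.map f g ≫ biprod.map f' g' = 𝟙 (A ⊞ C) := by
  ext <;> simp [hf, hg]

theorem isQuasiIso_dsumMap {K L K' L' : ChainComplex N.carrier ℤ} {a : K ⟶ K'} {b : L ⟶ L'}
    (hK : GradedBounded K.X) (hL : GradedBounded L.X) (hK' : GradedBounded K'.X)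
    (hL' : GradedBounded L'.X) (ha : IsQuasiIso N a) (hb : IsQuasiIso N b) :
    IsQuasiIso N (dsumMap a b) :=
  isQuasiIso_of_confC (confC_dsum _ _) (confC_dsum _ _) (dsumInl_map a b) (dsumMap_snd a b).symm
    (hK.biprod hL) (hK'.biprod hL') ha hb

theorem isQuasiIso_coneMap {K L K' L' : ChainComplex N.carrier ℤ} {f : K ⟶ L} {f' : K' ⟶ L'}
    {a : K ⟶ K'} {b : L ⟶ L'} (w : a ≫ f' = f ≫ b)
    (hK : GradedBounded K.X) (hL : GradedBounded L.X) (hK' : GradedBounded K'.X)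
    (hL' : GradedBounded L'.X) (ha : IsQuasiIso N a) (hb : IsQuasiIso N b) :
    IsQuasiIso N (coneMap f f' a b w) :=
  isQuasiIso_of_confC (confC_cone f) (confC_cone f') (coneInl_map _ _ _ _ _)
    (coneMap_snd _ _ _ _ _).symm (hK.cone hL f) (hK'.cone hL' f') hb
    ((isQuasiIso_shiftMap_iff a hK hK').2 ha)

/-! ### Constructions in `B[F]` -/

/-- The map from the image of a direct sum under an exact functor to a direct sum. -/
abbrev mapDsumTo {K L : ChainComplex M.carrier ℤ} {K' L' : ChainComplex N.carrier ℤ}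
    (a : (mapC F).obj K ⟶ K') (b : (mapC F).obj L ⟶ L') :
    (mapC F).obj (dsum K L) ⟶ dsum K' L' :=
  dsumLift ((mapC F).map (dsumFst K L) ≫ a) ((mapC F).map (dsumSnd K L) ≫ b)

theorem map_dsumInl_mapDsumTo {K L : ChainComplex M.carrier ℤ} {K' L' : ChainComplex N.carrier ℤ}
    (a : (mapC F).obj K ⟶ K') (b : (mapC F).obj L ⟶ L') :
    (mapC F).map (dsumInl K L) ≫ mapDsumTo a b = a ≫ dsumInl K' L' := by
  refine dsum_hom_ext ?_ ?_
  · rw [Category.assoc, dsumLift_fst, Category.assoc, dsumInl_fst, ← Category.assoc,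
      ← Functor.map_comp, dsumInl_fst, CategoryTheory.Functor.map_id, Category.id_comp,
      Category.comp_id]
  · rw [Category.assoc, dsumLift_snd, Category.assoc, dsumInl_snd, ← Category.assoc,
      ← Functor.map_comp, dsumInl_snd, Functor.map_zero, zero_comp, comp_zero]

theorem isQuasiIso_mapDsumTo {K L : ChainComplex M.carrier ℤ} {K' L' : ChainComplex N.carrier ℤ}
    {a : (mapC F).obj K ⟶ K'} {b : (mapC F).obj L ⟶ L'}
    (hK : GradedBounded K.X) (hL : GradedBounded L.X) (hK' : GradedBounded K'.X)
    (hL' : GradedBounded L'.X) (ha : IsQuasiIso N a) (hb : IsQuasiIso N b) :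
    IsQuasiIso N (mapDsumTo a b) :=
  isQuasiIso_of_confC ((confC_dsum _ _).map F) (confC_dsum _ _) (map_dsumInl_mapDsumTo a b)
    (dsumLift_snd _ _).symm ((hK.biprod hL).map F) (hK'.biprod hL') ha hb

/-- A map in `B[F]`. -/
abbrev bpHom {X Y : BPair F} (a : X.srcTop ⟶ Y.srcTop) (b : X.srcBot ⟶ Y.srcBot)
    (c : X.tar ⟶ Y.tar) (h : X.compTop ≫ top.map c = (mapC F).map a ≫ Y.compTop)
    (h' : X.compBot ≫ bot.map c = (mapC F).map b ≫ Y.compBot) : X ⟶ Y :=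
  ⟨a, b, c, h, h'⟩

theorem bp_ext {X Y : BPair F} {f g : X ⟶ Y} (h₁ : BPair.Hom.srcTop f = BPair.Hom.srcTop g)
    (h₂ : BPair.Hom.srcBot f = BPair.Hom.srcBot g) (h₃ : BPair.Hom.tar f = BPair.Hom.tar g) :
    f = g := BPair.Hom.ext h₁ h₂ h₃

/-- The object `(0, X, 0)` of `B[F]`. -/
def bpOfBq (F : M ⟶ N) (X : BinaryComplex N.carrier) (hX : IsBq N X) : BPair F where
  srcTop := top.obj (ofGraded fun _ => 0)
  srcBot := bot.obj (ofGraded fun _ => 0)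
  tar := X
  bounded_srcTop := ⟨0, 0, fun _ _ => isZero_zero _⟩
  bounded_srcBot := ⟨0, 0, fun _ _ => isZero_zero _⟩
  bounded_tar := hX.1
  compTop := 0
  compBot := 0
  quasiIsoTop := isQuasiIso_of_acyclic _ (GradedBounded.map F ⟨0, 0, fun _ _ => isZero_zero _⟩)
    hX.1 (Acyclic.map F (acyclic_of_isZero fun _ => isZero_zero _)) hX.2.1
  quasiIsoBot := isQuasiIso_of_acyclic _ (GradedBounded.map F ⟨0, 0, fun _ _ => isZero_zero _⟩)
    hX.1 (Acyclic.map F (acyclic_of_isZero fun _ => isZero_zero _)) hX.2.2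

/-- The map from `(0, X, 0)` to an object of `B[F]` with target `X`. -/
def bpOfBqHom (Y : BPair F) (h : IsBq N Y.tar) : bpOfBq F Y.tar h ⟶ Y :=
  bpHom 0 0 (𝟙 _)
    (zero_comp.trans ((congrArg (fun z => z ≫ Y.compTop) ((mapC F).map_zero _ _)).trans
      zero_comp).symm)
    (zero_comp.trans ((congrArg (fun z => z ≫ Y.compBot) ((mapC F).map_zero _ _)).trans
      zero_comp).symm)

/-- The map from 0 to an acyclic complex is a quasi-isomorphism. In K_0 Ω[F] an acyclic source can
therefore be discarded when the target lies in B^q N. -/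
theorem weakEquiv_bpOfBqHom (Y : BPair F) (h : IsBq N Y.tar) (h₁ : Acyclic M Y.srcTop)
    (h₂ : Acyclic M Y.srcBot) : BPair.WeakEquiv (bpOfBqHom Y h) :=
  ⟨isQuasiIso_of_acyclic _ ⟨0, 0, fun _ _ => isZero_zero _⟩ Y.bounded_srcTop
    (acyclic_of_isZero fun _ => isZero_zero _) h₁,
    isQuasiIso_of_acyclic _ ⟨0, 0, fun _ _ => isZero_zero _⟩ Y.bounded_srcBot
    (acyclic_of_isZero fun _ => isZero_zero _) h₂, inferInstanceAs (IsIso (𝟙 Y.tar))⟩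

theorem weakEquiv_of_isIso {X Y : BPair F} (e : X ≅ Y) : BPair.WeakEquiv e.hom := by
  refine ⟨isQuasiIso_of_iso ⟨BPair.Hom.srcTop e.hom, BPair.Hom.srcTop e.inv,
      congrArg BPair.Hom.srcTop e.hom_inv_id, congrArg BPair.Hom.srcTop e.inv_hom_id⟩,
    isQuasiIso_of_iso ⟨BPair.Hom.srcBot e.hom, BPair.Hom.srcBot e.inv,
      congrArg BPair.Hom.srcBot e.hom_inv_id, congrArg BPair.Hom.srcBot e.inv_hom_id⟩,
    ⟨BPair.Hom.tar e.inv, congrArg BPair.Hom.tar e.hom_inv_id,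
      congrArg BPair.Hom.tar e.inv_hom_id⟩⟩

theorem weakEquiv_comp {X Y Z : BPair F} {f : X ⟶ Y} {g : Y ⟶ Z} (hf : BPair.WeakEquiv f)
    (hg : BPair.WeakEquiv g) : BPair.WeakEquiv (f ≫ g) := by
  refine ⟨(isQuasiIso_comp_iff X.bounded_srcTop Y.bounded_srcTop Z.bounded_srcTop _ _ hf.1).2 hg.1,
    (isQuasiIso_comp_iff X.bounded_srcBot Y.bounded_srcBot Z.bounded_srcBot _ _ hf.2.1).2 hg.2.1,
    ?_⟩
  have := hf.2.2
  have := hg.2.2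
  exact inferInstanceAs (IsIso (BPair.Hom.tar f ≫ BPair.Hom.tar g))

/-- The mapping cone of a map in `B[F]`. -/
def bpCone {X Y : BPair F} (g : X ⟶ Y) : BPair F where
  srcTop := cone (BPair.Hom.srcTop g)
  srcBot := cone (BPair.Hom.srcBot g)
  tar := bcone (top.map (BPair.Hom.tar g)) (bot.map (BPair.Hom.tar g))
  bounded_srcTop := X.bounded_srcTop.cone Y.bounded_srcTop _
  bounded_srcBot := X.bounded_srcBot.cone Y.bounded_srcBot _
  bounded_tar := Y.bounded_tar.biprod X.bounded_tar.shift
  compTop := mapConeTo _ _ X.compTop Y.compTop (BPair.Hom.wTop g)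
  compBot := mapConeTo _ _ X.compBot Y.compBot (BPair.Hom.wBot g)
  quasiIsoTop := isQuasiIso_mapConeTo _ X.bounded_srcTop Y.bounded_srcTop X.bounded_tar
    Y.bounded_tar X.quasiIsoTop Y.quasiIsoTop
  quasiIsoBot := isQuasiIso_mapConeTo _ X.bounded_srcBot Y.bounded_srcBot X.bounded_tar
    Y.bounded_tar X.quasiIsoBot Y.quasiIsoBot

/-- The map of mapping cones in `B[F]` induced by a commutative square. -/
def bpConeMap {X Y X' Y' : BPair F} (g : X ⟶ Y) (g' : X' ⟶ Y') (a : X ⟶ X') (b : Y ⟶ Y')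
    (w : a ≫ g' = g ≫ b) : bpCone g ⟶ bpCone g' :=
  have w₁ : top.map (BPair.Hom.tar a) ≫ top.map (BPair.Hom.tar g') =
    top.map (BPair.Hom.tar g) ≫ top.map (BPair.Hom.tar b) :=
      congrArg (fun z => top.map (BPair.Hom.tar z)) w
  have w₂ : bot.map (BPair.Hom.tar a) ≫ bot.map (BPair.Hom.tar g') =
    bot.map (BPair.Hom.tar g) ≫ bot.map (BPair.Hom.tar b) :=
      congrArg (fun z => bot.map (BPair.Hom.tar z)) w
  bpHom (coneMap _ _ (BPair.Hom.srcTop a) (BPair.Hom.srcTop b) (congrArg BPair.Hom.srcTop w))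
    (coneMap _ _ (BPair.Hom.srcBot a) (BPair.Hom.srcBot b) (congrArg BPair.Hom.srcBot w))
    (bconeMap (BPair.Hom.tar a) (BPair.Hom.tar b) w₁ w₂)
    (map_coneMap_mapConeTo _ _ _ _ _ _ _ w₁ (BPair.Hom.wTop a).symm (BPair.Hom.wTop b).symm).symm
    (map_coneMap_mapConeTo _ _ _ _ _ _ _ w₂ (BPair.Hom.wBot a).symm (BPair.Hom.wBot b).symm).symm

theorem weakEquiv_bpConeMap {X Y X' Y' : BPair F} {g : X ⟶ Y} {g' : X' ⟶ Y'} {a : X ⟶ X'}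
    {b : Y ⟶ Y'} (w : a ≫ g' = g ≫ b) (ha : BPair.WeakEquiv a) (hb : BPair.WeakEquiv b) :
    BPair.WeakEquiv (bpConeMap g g' a b w) := by
  refine ⟨isQuasiIso_coneMap (congrArg BPair.Hom.srcTop w) X.bounded_srcTop Y.bounded_srcTop X'.bounded_srcTop
      Y'.bounded_srcTop ha.1 hb.1,
    isQuasiIso_coneMap (congrArg BPair.Hom.srcBot w) X.bounded_srcBot Y.bounded_srcBot X'.bounded_srcBot
      Y'.bounded_srcBot ha.2.1 hb.2.1, BinaryComplex.isIso_of_comp _ fun i => ?_⟩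
  have := ha.2.2
  have := hb.2.2
  exact isIso_biprod_map (comp (BPair.Hom.tar b) i) (comp (BPair.Hom.tar a) (i - 1))

/-- Mapping cones of retracts are retracts; this is what makes `HasClass` stable under cones. -/
theorem bpConeMap_comp_eq_id {X Y X' Y' : BPair F} {g : X ⟶ Y} {g' : X' ⟶ Y'} {a : X ⟶ X'}
    {b : Y ⟶ Y'} {a' : X' ⟶ X} {b' : Y' ⟶ Y} (w : a ≫ g' = g ≫ b) (w' : a' ≫ g = g' ≫ b')
    (ha : a ≫ a' = 𝟙 X) (hb : b ≫ b' = 𝟙 Y) :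
    bpConeMap g g' a b w ≫ bpConeMap g' g a' b' w' = 𝟙 _ := by
  refine bp_ext (HomologicalComplex.hom_ext _ _ fun i => ?_)
    (HomologicalComplex.hom_ext _ _ fun i => ?_) (BinaryComplex.hom_ext fun i => ?_)
  · have h₁ := HomologicalComplex.congr_hom (congrArg BPair.Hom.srcTop ha) (i - 1)
    have h₂ := HomologicalComplex.congr_hom (congrArg BPair.Hom.srcTop hb) i
    exact biprod_map_comp_map h₂ h₁
  · have h₁ := HomologicalComplex.congr_hom (congrArg BPair.Hom.srcBot ha) (i - 1)
    have h₂ := HomologicalComplex.congr_hom (congrArg BPair.Hom.srcBot hb) i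
    exact biprod_map_comp_map h₂ h₁
  · have h₁ := congrArg (fun z => comp (BPair.Hom.tar z) (i - 1)) ha
    have h₂ := congrArg (fun z => comp (BPair.Hom.tar z) i) hb
    exact biprod_map_comp_map h₂ h₁

/-- The map from the mapping cone of the inclusion to the quotient, for a short exact sequence in
`B[F]`. -/
def bpDesc {X Y Z : BPair F} {i : X ⟶ Y} {p : Y ⟶ Z} (h : BPair.Conf i p) : bpCone i ⟶ Z :=
  have h₁ : ConfC M (BPair.Hom.srcTop i) (BPair.Hom.srcTop p) := h.1
  have h₂ : ConfC M (BPair.Hom.srcBot i) (BPair.Hom.srcBot p) := h.2.1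
  have h₃ : ConfB N (BPair.Hom.tar i) (BPair.Hom.tar p) := h.2.2
  bpHom (coneDesc (BPair.Hom.srcTop i) (BPair.Hom.srcTop p) h₁.w)
    (coneDesc (BPair.Hom.srcBot i) (BPair.Hom.srcBot p) h₂.w)
    (bconeDesc (BPair.Hom.tar i) (BPair.Hom.tar p) h₃.w)
    (map_coneDesc _ _ _ _ (h₃.confC_top.w) _ (BPair.Hom.wTop p).symm).symm
    (map_coneDesc _ _ _ _ (h₃.confC_bot.w) _ (BPair.Hom.wBot p).symm).symm

/-- The direct sum in `B[F]`. -/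
def bpDsum (X Y : BPair F) : BPair F where
  srcTop := dsum X.srcTop Y.srcTop
  srcBot := dsum X.srcBot Y.srcBot
  tar := BinaryComplex.dsum X.tar Y.tar
  bounded_srcTop := X.bounded_srcTop.biprod Y.bounded_srcTop
  bounded_srcBot := X.bounded_srcBot.biprod Y.bounded_srcBot
  bounded_tar := X.bounded_tar.biprod Y.bounded_tar
  compTop := mapDsumTo X.compTop Y.compTop
  compBot := mapDsumTo X.compBot Y.compBot
  quasiIsoTop := isQuasiIso_mapDsumTo X.bounded_srcTop Y.bounded_srcTop X.bounded_tar
    Y.bounded_tar X.quasiIsoTop Y.quasiIsoTop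
  quasiIsoBot := isQuasiIso_mapDsumTo X.bounded_srcBot Y.bounded_srcBot X.bounded_tar
    Y.bounded_tar X.quasiIsoBot Y.quasiIsoBot

end

end GoodExact

namespace GoodExact

open BinaryComplex (top bot diag bcone bconeMap bconeInl bconeSnd ofGraded comp)

section

variable {M N : ConflationCat.{v, u}} [GoodExact M] [GoodExact N] {F : M ⟶ N}

/-! ### Direct sums in `B[F]` -/

/-- The first projection of a direct sum of binary complexes. -/
abbrev bdsumFst (K L : BinaryComplex N.carrier) : BinaryComplex.dsum K L ⟶ K :=
  BinaryComplex.homMk (dsumFst (top.obj K) (top.obj L)) (dsumFst (bot.obj K) (bot.obj L))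
    fun _ => rfl

/-- The second projection of a direct sum of binary complexes. -/
abbrev bdsumSnd (K L : BinaryComplex N.carrier) : BinaryComplex.dsum K L ⟶ L :=
  BinaryComplex.homMk (dsumSnd (top.obj K) (top.obj L)) (dsumSnd (bot.obj K) (bot.obj L))
    fun _ => rfl

/-- The first inclusion in a direct sum of binary complexes. -/
abbrev bdsumInl (K L : BinaryComplex N.carrier) : K ⟶ BinaryComplex.dsum K L :=
  BinaryComplex.homMk (dsumInl (top.obj K) (top.obj L)) (dsumInl (bot.obj K) (bot.obj L))
    fun _ => rfl

/-- The map to a direct sum of binary complexes given by its coordinates. -/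
abbrev bdsumLift {K L L' : BinaryComplex N.carrier} (a : K ⟶ L) (b : K ⟶ L') :
    K ⟶ BinaryComplex.dsum L L' :=
  BinaryComplex.homMk (dsumLift (top.map a) (top.map b)) (dsumLift (bot.map a) (bot.map b))
    fun _ => rfl

theorem bdsum_hom_ext {K L L' : BinaryComplex N.carrier} {f g : K ⟶ BinaryComplex.dsum L L'}
    (h : f ≫ bdsumFst L L' = g ≫ bdsumFst L L') (h' : f ≫ bdsumSnd L L' = g ≫ bdsumSnd L L') :
    f = g :=
  BinaryComplex.hom_ext fun i => biprod.hom_ext _ _ (congrArg (fun z => comp z i) h)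
    (congrArg (fun z => comp z i) h')

/-- The projection of a direct sum in `B[F]`. -/
def bpFst (X Y : BPair F) : bpDsum X Y ⟶ X :=
  bpHom (dsumFst _ _) (dsumFst _ _) (bdsumFst _ _) (dsumLift_fst _ _) (dsumLift_fst _ _)

/-- The projection of a direct sum in `B[F]`. -/
def bpSnd (X Y : BPair F) : bpDsum X Y ⟶ Y :=
  bpHom (dsumSnd _ _) (dsumSnd _ _) (bdsumSnd _ _) (dsumLift_snd _ _) (dsumLift_snd _ _)

theorem map_dsumLift_mapDsumTo {Z K L : ChainComplex M.carrier ℤ}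
    {Z' K' L' : ChainComplex N.carrier ℤ} {c : (mapC F).obj Z ⟶ Z'} {k : (mapC F).obj K ⟶ K'}
    {l : (mapC F).obj L ⟶ L'} {a : Z ⟶ K} {b : Z ⟶ L} {a' : Z' ⟶ K'} {b' : Z' ⟶ L'}
    (h : c ≫ a' = (mapC F).map a ≫ k) (h' : c ≫ b' = (mapC F).map b ≫ l) :
    c ≫ dsumLift a' b' = (mapC F).map (dsumLift a b) ≫ mapDsumTo k l := by
  refine dsum_hom_ext ?_ ?_
  · rw [Category.assoc, dsumLift_fst, Category.assoc, dsumLift_fst, ← Category.assoc,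
      ← Functor.map_comp, dsumLift_fst, h]
  · rw [Category.assoc, dsumLift_snd, Category.assoc, dsumLift_snd, ← Category.assoc,
      ← Functor.map_comp, dsumLift_snd, h']

/-- The map to a direct sum in `B[F]` given by its coordinates. -/
def bpLift {X Y Z : BPair F} (f : Z ⟶ X) (g : Z ⟶ Y) : Z ⟶ bpDsum X Y :=
  bpHom (dsumLift (BPair.Hom.srcTop f) (BPair.Hom.srcTop g))
    (dsumLift (BPair.Hom.srcBot f) (BPair.Hom.srcBot g))
    (bdsumLift (BPair.Hom.tar f) (BPair.Hom.tar g))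
    (map_dsumLift_mapDsumTo (BPair.Hom.wTop f) (BPair.Hom.wTop g))
    (map_dsumLift_mapDsumTo (BPair.Hom.wBot f) (BPair.Hom.wBot g))

/-- The direct sum is a product in `B[F]`. -/
def bpIsLimit (X Y : BPair F) : IsLimit (BinaryFan.mk (bpFst X Y) (bpSnd X Y)) :=
  BinaryFan.isLimitMk (fun s => bpLift s.fst s.snd)
    (fun s => bp_ext (dsumLift_fst _ _) (dsumLift_fst _ _)
      (BinaryComplex.hom_ext fun i => HomologicalComplex.congr_hom
        (dsumLift_fst (top.map (BPair.Hom.tar s.fst)) (top.map (BPair.Hom.tar s.snd))) i))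
    (fun s => bp_ext (dsumLift_snd _ _) (dsumLift_snd _ _)
      (BinaryComplex.hom_ext fun i => HomologicalComplex.congr_hom
        (dsumLift_snd (top.map (BPair.Hom.tar s.fst)) (top.map (BPair.Hom.tar s.snd))) i))
    (fun s m h₁ h₂ => bp_ext
      (dsum_hom_ext ((congrArg BPair.Hom.srcTop h₁).trans (dsumLift_fst _ _).symm)
        ((congrArg BPair.Hom.srcTop h₂).trans (dsumLift_snd _ _).symm))
      (dsum_hom_ext ((congrArg BPair.Hom.srcBot h₁).trans (dsumLift_fst _ _).symm)
        ((congrArg BPair.Hom.srcBot h₂).trans (dsumLift_snd _ _).symm))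
      (bdsum_hom_ext ((congrArg BPair.Hom.tar h₁).trans (BinaryComplex.hom_ext fun i =>
          HomologicalComplex.congr_hom (dsumLift_fst (top.map (BPair.Hom.tar s.fst))
            (top.map (BPair.Hom.tar s.snd))) i).symm)
        ((congrArg BPair.Hom.tar h₂).trans (BinaryComplex.hom_ext fun i =>
          HomologicalComplex.congr_hom (dsumLift_snd (top.map (BPair.Hom.tar s.fst))
            (top.map (BPair.Hom.tar s.snd))) i).symm)))

instance : HasBinaryProducts (BPair F) :=
  have : ∀ X Y : BPair F, HasLimit (pair X Y) := fun X Y => ⟨⟨_, bpIsLimit X Y⟩⟩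
  hasBinaryProducts_of_hasLimit_pair _

variable (F) in
/-- The zero object of `B[F]`. -/
def bpZero : BPair F := bpOfBq F (ofGraded fun _ => 0) (isBq_of_isZero fun _ => isZero_zero _)

theorem bp_hom_ext_of_isZero {X Y : BPair F} (h₁ : ∀ i, IsZero (Y.srcTop.X i))
    (h₂ : ∀ i, IsZero (Y.srcBot.X i)) (h₃ : ∀ i, IsZero (Y.tar.X i)) (f g : X ⟶ Y) : f = g :=
  bp_ext (HomologicalComplex.hom_ext _ _ fun i => (h₁ i).eq_of_tgt _ _)
    (HomologicalComplex.hom_ext _ _ fun i => (h₂ i).eq_of_tgt _ _)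
    (BinaryComplex.hom_ext fun i => (h₃ i).eq_of_tgt _ _)

variable (F) in
/-- The zero object is terminal in `B[F]`. -/
def bpZeroIsTerminal : IsTerminal (bpZero F) :=
  have h : ∀ (X : BPair F) (f g : X ⟶ bpZero F), f = g := fun X =>
    bp_hom_ext_of_isZero (fun _ => isZero_zero _) (fun _ => isZero_zero _) fun _ => isZero_zero _
  IsTerminal.ofUniqueHom (fun X => bpHom 0 0 0
    (HomologicalComplex.hom_ext _ _ fun _ => (isZero_zero _).eq_of_tgt _ _)
    (HomologicalComplex.hom_ext _ _ fun _ => (isZero_zero _).eq_of_tgt _ _)) fun X f => h X _ _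

instance : HasTerminal (BPair F) := (bpZeroIsTerminal F).hasTerminal

theorem isoCl_bpDsum (X Y : BPair F) : isoCl (bpDsum X Y) = isoCl X + isoCl Y :=
  isoCl_add_of_isLimit _ (bpIsLimit X Y)

theorem isoCl_bpZero : isoCl (bpZero F) = 0 := isoCl_of_isTerminal (bpZeroIsTerminal F)

/-- The map of direct sums in `B[F]` induced by two maps. -/
def bpDsumMap {X Y X' Y' : BPair F} (f : X ⟶ X') (g : Y ⟶ Y') : bpDsum X Y ⟶ bpDsum X' Y' :=
  bpLift (bpFst X Y ≫ f) (bpSnd X Y ≫ g)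

theorem bpDsumMap_comp {X Y X' Y' X'' Y'' : BPair F} (f : X ⟶ X') (g : Y ⟶ Y') (f' : X' ⟶ X'')
    (g' : Y' ⟶ Y'') : bpDsumMap f g ≫ bpDsumMap f' g' = bpDsumMap (f ≫ f') (g ≫ g') := by
  have h₁ : ∀ {Z X Y : BPair F} (f : Z ⟶ X) (g : Z ⟶ Y), bpLift f g ≫ bpFst X Y = f :=
    fun f g => (bpIsLimit _ _).fac (BinaryFan.mk f g) ⟨WalkingPair.left⟩
  have h₂ : ∀ {Z X Y : BPair F} (f : Z ⟶ X) (g : Z ⟶ Y), bpLift f g ≫ bpSnd X Y = g :=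
    fun f g => (bpIsLimit _ _).fac (BinaryFan.mk f g) ⟨WalkingPair.right⟩
  refine BinaryFan.IsLimit.hom_ext (bpIsLimit X'' Y'') ?_ ?_
  · change (bpDsumMap f g ≫ bpDsumMap f' g') ≫ bpFst _ _ = bpDsumMap _ _ ≫ bpFst _ _
    rw [bpDsumMap, bpDsumMap, bpDsumMap, Category.assoc, h₁, h₁, ← Category.assoc, h₁,
      Category.assoc]
  · change (bpDsumMap f g ≫ bpDsumMap f' g') ≫ bpSnd _ _ = bpDsumMap _ _ ≫ bpSnd _ _
    rw [bpDsumMap, bpDsumMap, bpDsumMap, Category.assoc, h₂, h₂, ← Category.assoc, h₂,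
      Category.assoc]

theorem bpDsumMap_id (X Y : BPair F) : bpDsumMap (𝟙 X) (𝟙 Y) = 𝟙 _ := by
  have h₁ : ∀ {Z X Y : BPair F} (f : Z ⟶ X) (g : Z ⟶ Y), bpLift f g ≫ bpFst X Y = f :=
    fun f g => (bpIsLimit _ _).fac (BinaryFan.mk f g) ⟨WalkingPair.left⟩
  have h₂ : ∀ {Z X Y : BPair F} (f : Z ⟶ X) (g : Z ⟶ Y), bpLift f g ≫ bpSnd X Y = g :=
    fun f g => (bpIsLimit _ _).fac (BinaryFan.mk f g) ⟨WalkingPair.right⟩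
  refine BinaryFan.IsLimit.hom_ext (bpIsLimit X Y) ?_ ?_
  · change bpLift (bpFst X Y ≫ 𝟙 X) (bpSnd X Y ≫ 𝟙 Y) ≫ bpFst _ _ = 𝟙 _ ≫ bpFst _ _
    rw [h₁, Category.comp_id, Category.id_comp]
  · change bpLift (bpFst X Y ≫ 𝟙 X) (bpSnd X Y ≫ 𝟙 Y) ≫ bpSnd _ _ = 𝟙 _ ≫ bpSnd _ _
    rw [h₂, Category.comp_id, Category.id_comp]

theorem dsumLift_dsumFst_comp {C : Type u₁} [Category.{v₁} C] [Preadditive C]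
    [HasBinaryBiproducts C] {K L K' L' : ChainComplex C ℤ} (a : K ⟶ K') (b : L ⟶ L') :
    dsumLift (dsumFst K L ≫ a) (dsumSnd K L ≫ b) = dsumMap a b := by
  refine dsum_hom_ext ?_ ?_
  · rw [dsumLift_fst, dsumMap_fst]
  · rw [dsumLift_snd, dsumMap_snd]

theorem bpDsumMap_srcTop {X Y X' Y' : BPair F} (f : X ⟶ X') (g : Y ⟶ Y') :
    BPair.Hom.srcTop (bpDsumMap f g) = dsumMap (BPair.Hom.srcTop f) (BPair.Hom.srcTop g) :=
  dsumLift_dsumFst_comp _ _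

theorem bpDsumMap_srcBot {X Y X' Y' : BPair F} (f : X ⟶ X') (g : Y ⟶ Y') :
    BPair.Hom.srcBot (bpDsumMap f g) = dsumMap (BPair.Hom.srcBot f) (BPair.Hom.srcBot g) :=
  dsumLift_dsumFst_comp _ _

theorem bpDsumMap_tar {X Y X' Y' : BPair F} (f : X ⟶ X') (g : Y ⟶ Y') :
    BPair.Hom.tar (bpDsumMap f g) =
      BinaryComplex.dsumMap (BPair.Hom.tar f) (BPair.Hom.tar g) :=
  BinaryComplex.hom_ext fun i => HomologicalComplex.congr_hom
    (dsumLift_dsumFst_comp (top.map (BPair.Hom.tar f)) (top.map (BPair.Hom.tar g))) i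

theorem weakEquiv_bpDsumMap {X Y X' Y' : BPair F} {f : X ⟶ X'} {g : Y ⟶ Y'}
    (hf : BPair.WeakEquiv f) (hg : BPair.WeakEquiv g) : BPair.WeakEquiv (bpDsumMap f g) := by
  refine ⟨?_, ?_, ?_⟩
  · rw [bpDsumMap_srcTop]
    exact isQuasiIso_dsumMap X.bounded_srcTop Y.bounded_srcTop X'.bounded_srcTop
      Y'.bounded_srcTop hf.1 hg.1
  · rw [bpDsumMap_srcBot]
    exact isQuasiIso_dsumMap X.bounded_srcBot Y.bounded_srcBot X'.bounded_srcBot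
      Y'.bounded_srcBot hf.2.1 hg.2.1
  · rw [bpDsumMap_tar]
    have := hf.2.2
    have := hg.2.2
    exact BinaryComplex.isIso_of_comp _ fun i => isIso_biprod_map (comp (BPair.Hom.tar f) i)
      (comp (BPair.Hom.tar g) i)

theorem conf_bpDsumMap {X Y Z X' Y' Z' : BPair F} {i : X ⟶ Y} {p : Y ⟶ Z} {i' : X' ⟶ Y'}
    {p' : Y' ⟶ Z'} (h : BPair.Conf i p) (h' : BPair.Conf i' p') :
    BPair.Conf (bpDsumMap i i') (bpDsumMap p p') := by
  refine ⟨fun n => ?_, fun n => ?_, fun n => ?_⟩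
  · rw [bpDsumMap_srcTop, bpDsumMap_srcTop]
    exact conf_biprod_map (h.1 n) (h'.1 n)
  · rw [bpDsumMap_srcBot, bpDsumMap_srcBot]
    exact conf_biprod_map (h.2.1 n) (h'.2.1 n)
  · rw [bpDsumMap_tar, bpDsumMap_tar]
    exact conf_biprod_map (h.2.2 n) (h'.2.2 n)

/-- The inclusion in a direct sum in `B[F]`. -/
def bpInl (X Y : BPair F) : X ⟶ bpDsum X Y :=
  bpHom (dsumInl _ _) (dsumInl _ _) (bdsumInl _ _) (map_dsumInl_mapDsumTo X.compTop Y.compTop).symm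
    (map_dsumInl_mapDsumTo X.compBot Y.compBot).symm

theorem conf_bpInl (X Y : BPair F) : BPair.Conf (bpInl X Y) (bpSnd X Y) :=
  ⟨fun _ => conf_biprod _ _, fun _ => conf_biprod _ _,
    fun n => conf_biprod (X.tar.X n) (Y.tar.X n)⟩

/-- The object of `B[F]` with top and bottom exchanged. -/
def bpSwap (X : BPair F) : BPair F where
  srcTop := X.srcBot
  srcBot := X.srcTop
  tar := BinaryComplex.swap X.tar
  bounded_srcTop := X.bounded_srcBot
  bounded_srcBot := X.bounded_srcTop
  bounded_tar := X.bounded_tar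
  compTop := X.compBot
  compBot := X.compTop
  quasiIsoTop := X.quasiIsoBot
  quasiIsoBot := X.quasiIsoTop

/-! ### Euler characteristics -/

theorem eulerChar_add {X Y Z : ℤ → N.carrier} (hX : GradedBounded X) (hY : GradedBounded Y)
    (hZ : GradedBounded Z) (i : ∀ n, X n ⟶ Y n) (p : ∀ n, Y n ⟶ Z n)
    (h : ∀ n, N.conf (i n) (p n)) : eulerChar N Y = eulerChar N X + eulerChar N Z := by
  obtain ⟨s₁, h₁⟩ := hX.exists_finset
  obtain ⟨s₂, h₂⟩ := hY.exists_finset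
  obtain ⟨s₃, h₃⟩ := hZ.exists_finset
  classical
  rw [eulerChar_eq_sum (s₁ ∪ s₂ ∪ s₃) fun i hi => h₁ i (by simp at hi; tauto),
    eulerChar_eq_sum (s₁ ∪ s₂ ∪ s₃) fun i hi => h₂ i (by simp at hi; tauto),
    eulerChar_eq_sum (s₁ ∪ s₂ ∪ s₃) fun i hi => h₃ i (by simp at hi; tauto),
    ← Finset.sum_add_distrib]
  refine Finset.sum_congr rfl fun n _ => ?_
  rw [← smul_add]
  exact congrArg _ (k0mk_add (conf := N.conf) (h n))

theorem eulerChar_shift {X : ℤ → N.carrier} : eulerChar N (fun i => X (i - 1)) =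
    - eulerChar N X := by
  rw [eulerChar, eulerChar, ← finsum_neg_distrib,
    ← finsum_comp_equiv (Equiv.addRight (1 : ℤ))]
  refine finsum_congr fun i => ?_
  simp [Int.negOnePow_succ]

/-- X is degreewise an extension of the shift of its cycles by its cycles, and a shift changes the
sign. -/
theorem eulerChar_of_acyclic {X : ChainComplex N.carrier ℤ} (hX : GradedBounded X.X)
    (h : Acyclic N X) : eulerChar N X.X = 0 := by
  obtain ⟨Z, j, q, h, -⟩ := h
  have hZ : GradedBounded Z := by
    obtain ⟨a, b, hX⟩ := hX
    exact ⟨a, b, fun i hi => have := conf_mono (h i); isZero_of_mono (j i) (hX i hi)⟩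
  rw [eulerChar_add hZ hX hZ.shift j q h, eulerChar_shift, add_neg_cancel]

theorem eulerChar_of_isQuasiIso {X Y : ChainComplex N.carrier ℤ} (hX : GradedBounded X.X)
    (hY : GradedBounded Y.X) (f : X ⟶ Y) (h : IsQuasiIso N f) :
    eulerChar N X.X = eulerChar N Y.X := by
  have := eulerChar_of_acyclic (hX.cone hY f) ((isQuasiIso_iff f).1 h)
  rw [eulerChar_add hY (hX.cone hY f) hX.shift _ _ (confC_cone f), eulerChar_shift,
    ← sub_eq_add_neg, sub_eq_zero] at this
  exact this.symm

/-- The Euler characteristic of an object of `B[F]`. -/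
def bpEuler (Y : BPair F) : K0Group M.carrier M.conf :=
  eulerChar M Y.srcTop.X - eulerChar M Y.srcBot.X

theorem bpEuler_conf {X Y Z : BPair F} {i : X ⟶ Y} {p : Y ⟶ Z} (h : BPair.Conf i p) :
    bpEuler Y = bpEuler X + bpEuler Z := by
  rw [bpEuler, eulerChar_add X.bounded_srcTop Y.bounded_srcTop Z.bounded_srcTop _ _ h.1,
    eulerChar_add X.bounded_srcBot Y.bounded_srcBot Z.bounded_srcBot _ _ h.2.1, bpEuler, bpEuler]
  abel

theorem bpEuler_weakEquiv {X Y : BPair F} {f : X ⟶ Y} (h : BPair.WeakEquiv f) :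
    bpEuler X = bpEuler Y := by
  rw [bpEuler, bpEuler, eulerChar_of_isQuasiIso X.bounded_srcTop Y.bounded_srcTop _ h.1,
    eulerChar_of_isQuasiIso X.bounded_srcBot Y.bounded_srcBot _ h.2.1]

theorem bpEuler_bpDsum (X Y : BPair F) : bpEuler (bpDsum X Y) = bpEuler X + bpEuler Y :=
  bpEuler_conf (conf_bpInl X Y)

/-- Exchanging top and bottom provides every object with a complement making the Euler
characteristic zero. Its class in K_0 Ω[F] is never computed: it cancels wherever it is used. -/
theorem bpEuler_bpSwap (X : BPair F) : bpEuler (bpSwap X) = - bpEuler X :=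
  (neg_sub _ _).symm

end

end GoodExact

/-! ### Objects of `B[F]` with a binary source -/

/-- An object of `B[F]` whose source is a binary complex. -/
structure BinaryPair {M N : ConflationCat.{v, u}} (F : M ⟶ N) where
  src : BinaryComplex M.carrier
  tar : BinaryComplex N.carrier
  bounded_src : GradedBounded src.X
  bounded_tar : GradedBounded tar.X
  compTop : BinaryComplex.top.obj ((mapB F).obj src) ⟶ BinaryComplex.top.obj tar
  compBot : BinaryComplex.bot.obj ((mapB F).obj src) ⟶ BinaryComplex.bot.obj tar
  quasiIsoTop : IsQuasiIso N compTop
  quasiIsoBot : IsQuasiIso N compBot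

namespace GoodExact

open BinaryComplex (top bot diag bcone bconeMap bconeInl bconeSnd ofGraded comp)

section

variable {M N : ConflationCat.{v, u}} [GoodExact M] [GoodExact N] {F : M ⟶ N}

/-- The object of `B[F]` underlying an object with a binary source. -/
def _root_.BinaryPair.toBPair (β : BinaryPair F) : BPair F where
  srcTop := top.obj β.src
  srcBot := bot.obj β.src
  tar := β.tar
  bounded_srcTop := β.bounded_src
  bounded_srcBot := β.bounded_src
  bounded_tar := β.bounded_tar
  compTop := β.compTop
  compBot := β.compBot
  quasiIsoTop := β.quasiIsoTop
  quasiIsoBot := β.quasiIsoBot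

variable (F) in
/-- The cokernel of `K_1 M ⟶ K_1 N`. -/
abbrev K1Coker : Type (max u v) := (K 1).obj N ⧸ ((K 1).map F).hom.range

/-- The binary mapping cone of an object with a binary source. -/
abbrev bpairCone (β : BinaryPair F) : BinaryComplex N.carrier := bcone β.compTop β.compBot

theorem isBq_bpairCone (β : BinaryPair F) : IsBq N (bpairCone β) :=
  isBq_bcone (β.bounded_src.map F) β.bounded_tar β.quasiIsoTop β.quasiIsoBot

/-- The class of the binary mapping cone in the cokernel of `K_1 M ⟶ K_1 N`. -/
def bpairClass (β : BinaryPair F) : K1Coker F := QuotientAddGroup.mk (bqClass N (bpairCone β))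

/-- The class of the cone is that of the target minus that of the image of the source; the latter
comes from K_1 M, which is the reason for working in the cokernel. -/
theorem bpairClass_of_isBq (β : BinaryPair F) (h : IsBq M β.src) (h' : IsBq N β.tar) :
    bpairClass β = QuotientAddGroup.mk (bqClass N β.tar) := by
  refine QuotientAddGroup.eq.2 ⟨bqClass M β.src, ?_⟩
  rw [bpairCone, bqClass_bcone_of_isBq _ _ ⟨h.1.map F, h.2.1.map F, h.2.2.map F⟩ h']
  refine (map_bqClass F h).trans ?_
  abel

theorem bpairClass_add {β₁ β₂ β₃ : BinaryPair F} {a : β₁.src ⟶ β₂.src} {a' : β₂.src ⟶ β₃.src}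
    {b : β₁.tar ⟶ β₂.tar} {b' : β₂.tar ⟶ β₃.tar} (ha : ConfB M a a') (hb : ConfB N b b')
    (w₁ : (mapC F).map (top.map a) ≫ β₂.compTop = β₁.compTop ≫ top.map b)
    (w₂ : (mapC F).map (top.map a') ≫ β₃.compTop = β₂.compTop ≫ top.map b')
    (w₁' : (mapC F).map (bot.map a) ≫ β₂.compBot = β₁.compBot ≫ bot.map b)
    (w₂' : (mapC F).map (bot.map a') ≫ β₃.compBot = β₂.compBot ≫ bot.map b') :
    bpairClass β₂ = bpairClass β₁ + bpairClass β₃ :=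
  congrArg QuotientAddGroup.mk (bqClass_add (confB_bconeMap (ha.map F) hb w₁ w₂ w₁' w₂')
    (isBq_bpairCone β₁) (isBq_bpairCone β₂) (isBq_bpairCone β₃))

/-- The mapping cone of a map between objects with binary sources. -/
def bpairMapCone {β₁ β₀ : BinaryPair F} (g : β₁.toBPair ⟶ β₀.toBPair) : BinaryPair F where
  -- The top and bottom components of g on the sources may differ, so g need not be a map of binary
  -- complexes there; a binary cone requires only a pair of chain maps.
  src := bcone (K := β₁.src) (L := β₀.src) (BPair.Hom.srcTop g) (BPair.Hom.srcBot g)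
  tar := (bpCone g).tar
  bounded_src := (bpCone g).bounded_srcTop
  bounded_tar := (bpCone g).bounded_tar
  compTop := (bpCone g).compTop
  compBot := (bpCone g).compBot
  quasiIsoTop := (bpCone g).quasiIsoTop
  quasiIsoBot := (bpCone g).quasiIsoBot

/-- The shift of an object with a binary source. -/
def bpairShift (β : BinaryPair F) : BinaryPair F where
  src := BinaryComplex.shift β.src
  tar := BinaryComplex.shift β.tar
  bounded_src := β.bounded_src.shift
  bounded_tar := β.bounded_tar.shift
  compTop := mapShiftTo (K := top.obj β.src) β.compTop
  compBot := mapShiftTo (K := bot.obj β.src) β.compBot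
  quasiIsoTop := isQuasiIso_mapShiftTo (K := top.obj β.src) β.bounded_src β.bounded_tar
    β.quasiIsoTop
  quasiIsoBot := isQuasiIso_mapShiftTo (K := bot.obj β.src) β.bounded_src β.bounded_tar
    β.quasiIsoBot

theorem bpairClass_mapCone_eq_add {β₁ β₀ : BinaryPair F} (g : β₁.toBPair ⟶ β₀.toBPair) :
    bpairClass (bpairMapCone g) = bpairClass β₀ + bpairClass (bpairShift β₁) :=
  bpairClass_add
    (confB_bcone (K := β₁.src) (L := β₀.src) (BPair.Hom.srcTop g) (BPair.Hom.srcBot g))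
    (confB_bcone (top.map (BPair.Hom.tar g)) (bot.map (BPair.Hom.tar g)))
    (map_coneInl_mapConeTo (BPair.Hom.wTop g)) (mapConeTo_coneSnd (BPair.Hom.wTop g)).symm
    (map_coneInl_mapConeTo (BPair.Hom.wBot g)) (mapConeTo_coneSnd (BPair.Hom.wBot g)).symm

/-- For a weak equivalence the cone has its source in B^q M, so only the target counts, and the
target is the binary cone of an isomorphism, of class zero. -/
theorem bpairClass_mapCone_of_weakEquiv {β₁ β₀ : BinaryPair F} (g : β₁.toBPair ⟶ β₀.toBPair)
    (h : BPair.WeakEquiv g) : bpairClass (bpairMapCone g) = 0 := by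
  have := h.2.2
  have h₁ : IsBq M (bpairMapCone g).src :=
    isBq_bcone (K := β₁.src) (L := β₀.src) β₁.bounded_src β₀.bounded_src h.1 h.2.1
  have h₂ : IsBq N (bpairMapCone g).tar := isBq_bcone β₁.bounded_tar β₀.bounded_tar
    (isQuasiIso_of_iso (top.mapIso (asIso (BPair.Hom.tar g))))
    (isQuasiIso_of_iso (bot.mapIso (asIso (BPair.Hom.tar g))))
  rw [bpairClass_of_isBq _ h₁ h₂]
  exact congrArg QuotientAddGroup.mk
    (bqClass_bcone_of_isIso β₁.toBPair.bounded_tar β₀.toBPair.bounded_tar (BPair.Hom.tar g))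

theorem weakEquiv_id (Y : BPair F) : BPair.WeakEquiv (𝟙 Y) := weakEquiv_of_isIso (Iso.refl Y)

theorem bpairClass_shift (β : BinaryPair F) : bpairClass (bpairShift β) = - bpairClass β := by
  have := bpairClass_mapCone_eq_add (𝟙 β.toBPair)
  rw [bpairClass_mapCone_of_weakEquiv _ (weakEquiv_id _)] at this
  exact (neg_eq_of_add_eq_zero_right this.symm).symm

theorem bpairClass_mapCone {β₁ β₀ : BinaryPair F} (g : β₁.toBPair ⟶ β₀.toBPair) :
    bpairClass (bpairMapCone g) = bpairClass β₀ - bpairClass β₁ := by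
  rw [bpairClass_mapCone_eq_add, bpairClass_shift, sub_eq_add_neg]

theorem bpairClass_eq_of_weakEquiv {β₁ β₀ : BinaryPair F} (g : β₁.toBPair ⟶ β₀.toBPair)
    (h : BPair.WeakEquiv g) : bpairClass β₁ = bpairClass β₀ := by
  have := bpairClass_mapCone g
  rw [bpairClass_mapCone_of_weakEquiv g h] at this
  exact (sub_eq_zero.1 this.symm).symm

/-- The direct sum of objects with binary sources. -/
def bpairDsum (β₁ β₂ : BinaryPair F) : BinaryPair F where
  src := BinaryComplex.dsum β₁.src β₂.src
  tar := (bpDsum β₁.toBPair β₂.toBPair).tar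
  bounded_src := (bpDsum β₁.toBPair β₂.toBPair).bounded_srcTop
  bounded_tar := (bpDsum β₁.toBPair β₂.toBPair).bounded_tar
  compTop := (bpDsum β₁.toBPair β₂.toBPair).compTop
  compBot := (bpDsum β₁.toBPair β₂.toBPair).compBot
  quasiIsoTop := (bpDsum β₁.toBPair β₂.toBPair).quasiIsoTop
  quasiIsoBot := (bpDsum β₁.toBPair β₂.toBPair).quasiIsoBot

theorem bpairClass_dsum (β₁ β₂ : BinaryPair F) :
    bpairClass (bpairDsum β₁ β₂) = bpairClass β₁ + bpairClass β₂ :=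
  bpairClass_add (a := bdsumInl _ _) (a' := bdsumSnd _ _) (b := bdsumInl _ _) (b' := bdsumSnd _ _)
    (fun n => conf_biprod (β₁.src.X n) (β₂.src.X n))
    (fun n => conf_biprod (β₁.tar.X n) (β₂.tar.X n))
    (map_dsumInl_mapDsumTo (K := top.obj β₁.src) (L := top.obj β₂.src) β₁.compTop β₂.compTop)
    (dsumLift_snd _ _).symm
    (map_dsumInl_mapDsumTo (K := bot.obj β₁.src) (L := bot.obj β₂.src) β₁.compBot β₂.compBot)
    (dsumLift_snd _ _).symm

/-! ### The class of an object of `B[F]` in the cokernel of `K_1 M ⟶ K_1 N` -/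

/-- The object `Y` of `B[F]` has class `h` if it is a retract, by weak equivalences, of an object
with a binary source of class `h`. -/
def HasClass (Y : BPair F) (h : K1Coker F) : Prop :=
  ∃ (β : BinaryPair F) (i : Y ⟶ β.toBPair) (p : β.toBPair ⟶ Y), BPair.WeakEquiv i ∧
    BPair.WeakEquiv p ∧ i ≫ p = 𝟙 Y ∧ bpairClass β = h

theorem hasClass_toBPair (β : BinaryPair F) : HasClass β.toBPair (bpairClass β) :=
  ⟨β, 𝟙 _, 𝟙 _, weakEquiv_id _, weakEquiv_id _, Category.comp_id _, rfl⟩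

/-- The composite p₁ ≫ f ≫ i₀ is a weak equivalence between the chosen objects with binary sources.
With f an isomorphism this is the uniqueness of the class. -/
theorem HasClass.eq_of_weakEquiv {Y₁ Y₀ : BPair F} {h₁ h₀ : K1Coker F} (H₁ : HasClass Y₁ h₁)
    (H₀ : HasClass Y₀ h₀) (f : Y₁ ⟶ Y₀) (hf : BPair.WeakEquiv f) : h₁ = h₀ := by
  obtain ⟨β₁, i₁, p₁, -, hp₁, -, rfl⟩ := H₁
  obtain ⟨β₀, i₀, p₀, hi₀, -, -, rfl⟩ := H₀
  exact bpairClass_eq_of_weakEquiv (p₁ ≫ f ≫ i₀) (weakEquiv_comp hp₁ (weakEquiv_comp hf hi₀))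

theorem HasClass.dsum {Y₁ Y₂ : BPair F} {h₁ h₂ : K1Coker F} (H₁ : HasClass Y₁ h₁)
    (H₂ : HasClass Y₂ h₂) : HasClass (bpDsum Y₁ Y₂) (h₁ + h₂) := by
  obtain ⟨β₁, i₁, p₁, hi₁, hp₁, e₁, rfl⟩ := H₁
  obtain ⟨β₂, i₂, p₂, hi₂, hp₂, e₂, rfl⟩ := H₂
  exact ⟨bpairDsum β₁ β₂, bpDsumMap i₁ i₂, bpDsumMap p₁ p₂, weakEquiv_bpDsumMap hi₁ hi₂,
    weakEquiv_bpDsumMap hp₁ hp₂, (bpDsumMap_comp _ _ _ _).trans (by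
      rw [e₁, e₂, bpDsumMap_id]), bpairClass_dsum _ _⟩

/-- The map p₁ ≫ f ≫ i₀ between objects with binary sources has the cone of f as a retract. Here
both directions of the retraction are needed, which explains the form of `HasClass`. -/
theorem HasClass.cone {Y₁ Y₀ : BPair F} {h₁ h₀ : K1Coker F} (H₁ : HasClass Y₁ h₁)
    (H₀ : HasClass Y₀ h₀) (f : Y₁ ⟶ Y₀) : HasClass (bpCone f) (h₀ - h₁) := by
  obtain ⟨β₁, i₁, p₁, hi₁, hp₁, e₁, rfl⟩ := H₁
  obtain ⟨β₀, i₀, p₀, hi₀, hp₀, e₀, rfl⟩ := H₀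
  have w₁ : i₁ ≫ (p₁ ≫ f ≫ i₀) = f ≫ i₀ := by rw [← Category.assoc, e₁, Category.id_comp]
  have w₂ : p₁ ≫ f = (p₁ ≫ f ≫ i₀) ≫ p₀ := by
    rw [Category.assoc, Category.assoc, e₀, Category.comp_id]
  exact ⟨bpairMapCone (p₁ ≫ f ≫ i₀), bpConeMap _ _ i₁ i₀ w₁, bpConeMap _ _ p₁ p₀ w₂,
    weakEquiv_bpConeMap _ hi₁ hi₀, weakEquiv_bpConeMap _ hp₁ hp₀,
    bpConeMap_comp_eq_id _ _ e₁ e₀, bpairClass_mapCone _⟩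

theorem hasClass_bpOfBq (X : BinaryComplex N.carrier) (hX : IsBq N X) :
    HasClass (bpOfBq F X hX) (QuotientAddGroup.mk (bqClass N X)) := by
  let β : BinaryPair F :=
    { src := ofGraded fun _ => 0
      tar := X
      bounded_src := (bpOfBq F X hX).bounded_srcTop
      bounded_tar := hX.1
      compTop := (bpOfBq F X hX).compTop
      compBot := (bpOfBq F X hX).compBot
      quasiIsoTop := (bpOfBq F X hX).quasiIsoTop
      quasiIsoBot := (bpOfBq F X hX).quasiIsoBot }
  rw [← bpairClass_of_isBq β (isBq_of_isZero fun _ => isZero_zero _) hX]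
  exact hasClass_toBPair β

theorem hasClass_diag (X : CPair F) : HasClass X.diag 0 := by
  let β : BinaryPair F :=
    { src := diag.obj X.src
      tar := diag.obj X.tar
      bounded_src := X.bounded_src
      bounded_tar := X.bounded_tar
      compTop := X.comp
      compBot := X.comp
      quasiIsoTop := X.quasiIso
      quasiIsoBot := X.quasiIso }
  have : bpairClass β = 0 := congrArg QuotientAddGroup.mk
    (bqClass_diag (X := cone X.comp) ((X.bounded_src.map F).cone X.bounded_tar _)
      ((isQuasiIso_iff _).1 X.quasiIso))
  rw [← this]
  exact hasClass_toBPair β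

theorem ConfC.acyclic_cone_coneDesc {X Y Z : ChainComplex N.carrier ℤ} {i : X ⟶ Y} {p : Y ⟶ Z}
    (h : ConfC N i p) (hX : GradedBounded X.X) (hY : GradedBounded Y.X) (hZ : GradedBounded Z.X) :
    Acyclic N (cone (coneDesc i p h.w)) := by
  have h' : ConfB N (diag.map i) (diag.map p) := h
  exact (h'.bqClass_bcone_bconeDesc hX hY hZ).1.2.1

/-- The maps i and p need not respect the chosen binary sources, so additivity goes through cones.
The iterated cone of the conflation has class hZ - (hY - hX); it also has acyclic sources and a
target of class zero, so this difference is zero. -/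
theorem HasClass.eq_add_of_conf {X Y Z : BPair F} {hX hY hZ : K1Coker F} (HX : HasClass X hX)
    (HY : HasClass Y hY) (HZ : HasClass Z hZ) {i : X ⟶ Y} {p : Y ⟶ Z} (h : BPair.Conf i p) :
    hY = hX + hZ := by
  have h₃ : ConfB N (BPair.Hom.tar i) (BPair.Hom.tar p) := h.2.2
  obtain ⟨h₄, h₅⟩ := h₃.bqClass_bcone_bconeDesc X.bounded_tar Y.bounded_tar Z.bounded_tar
  have H := (HX.cone HY i).cone HZ (bpDesc h)
  have H' := hasClass_bpOfBq (F := F) (bpCone (bpDesc h)).tar h₄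
  have hc := H'.eq_of_weakEquiv H (bpOfBqHom _ h₄) (weakEquiv_bpOfBqHom _ h₄
    (ConfC.acyclic_cone_coneDesc h.1 X.bounded_srcTop Y.bounded_srcTop Z.bounded_srcTop)
    (ConfC.acyclic_cone_coneDesc h.2.1 X.bounded_srcBot Y.bounded_srcBot Z.bounded_srcBot))
  have h₆ : (QuotientAddGroup.mk (bqClass N (bpCone (bpDesc h)).tar) : K1Coker F) = 0 :=
    congrArg QuotientAddGroup.mk h₅
  rw [h₆] at hc
  rw [← sub_eq_zero, ← neg_eq_zero, hc]
  abel

end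

end GoodExact

/-! ### Binary complexes with prescribed top and bottom, and existence of classes -/

namespace BinaryComplex

variable {C : Type u₁} [Category.{v₁} C] [Preadditive C]

/-- The binary complex with a given top complex, and a given bottom complex up to degreewise
isomorphisms. -/
abbrev ofIso (K L : ChainComplex C ℤ) (e : ∀ i, K.X i ≅ L.X i) : BinaryComplex C where
  X := K.X
  d := K.d
  d' i j := (e i).hom ≫ L.d i j ≫ (e j).inv
  shape := K.shape
  shape' i j h := by rw [L.shape i j h, zero_comp, comp_zero]
  d_comp_d := K.d_comp_d
  d_comp_d' i j k := by simp

/-- The identification of the bottom complex. -/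
def ofIsoBot (K L : ChainComplex C ℤ) (e : ∀ i, K.X i ≅ L.X i) : bot.obj (ofIso K L e) ≅ L :=
  HomologicalComplex.Hom.isoOfComponents e fun i j _ => by
    change _ = ((e i).hom ≫ L.d i j ≫ (e j).inv) ≫ (e j).hom
    simp
    rfl

end BinaryComplex

namespace GoodExact

open BinaryComplex (top bot diag bcone bconeMap bconeInl bconeSnd ofGraded comp)

section

variable {M N : ConflationCat.{v, u}} [GoodExact M] [GoodExact N] {F : M ⟶ N}

theorem mapC_comp_comp_of_id {K L : ChainComplex M.carrier ℤ} {P : ChainComplex N.carrier ℤ}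
    (x : K ⟶ L) (y : L ⟶ K) (h : x ≫ y = 𝟙 K) (z : (mapC F).obj K ⟶ P) :
    (mapC F).map x ≫ (mapC F).map y ≫ z = z := by
  rw [← Category.assoc, ← Functor.map_comp, h, CategoryTheory.Functor.map_id, Category.id_comp]

theorem isQuasiIso_comp {K L P : ChainComplex N.carrier ℤ} (hK : GradedBounded K.X)
    (hL : GradedBounded L.X) (hP : GradedBounded P.X) {f : K ⟶ L} {g : L ⟶ P}
    (hf : IsQuasiIso N f) (hg : IsQuasiIso N g) : IsQuasiIso N (f ≫ g) :=
  (isQuasiIso_comp_iff hK hL hP f g hf).2 hg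

/-- Equal Euler characteristics make the two sources degreewise isomorphic once acyclic complexes A
and B are added. Transporting the bottom differential gives a binary source; inclusion of and
projection to the original summands are the two weak equivalences. -/
theorem exists_hasClass (Y : BPair F) (h : bpEuler Y = 0) : ∃ k, HasClass Y k := by
  obtain ⟨A, B, hA, hA', hB, hB', ⟨e⟩⟩ : ∃ A B : ChainComplex M.carrier ℤ, GradedBounded A.X ∧
      Acyclic M A ∧ GradedBounded B.X ∧ Acyclic M B ∧
      Nonempty (∀ i, Y.srcTop.X i ⊞ A.X i ≅ Y.srcBot.X i ⊞ B.X i) := by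
    obtain ⟨A, B, hA, hA', hB, hB', e⟩ := exists_acyclic_of_eulerChar_eq Y.bounded_srcTop
      Y.bounded_srcBot (sub_eq_zero.1 h)
    exact ⟨A, B, hA, hA', hB, hB', ⟨fun i => (e i).some⟩⟩
  let ε := BinaryComplex.ofIsoBot (dsum Y.srcTop A) (dsum Y.srcBot B) e
  have hT := Y.bounded_srcTop.biprod hA
  have hS := Y.bounded_srcBot.biprod hB
  have q₁ : IsQuasiIso M (dsumFst Y.srcTop A) := isQuasiIso_dsumFst Y.bounded_srcTop hA hA'
  have q₂ : IsQuasiIso M (ε.hom ≫ dsumFst Y.srcBot B) := isQuasiIso_comp hT hS Y.bounded_srcBot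
    (isQuasiIso_of_iso ε) (isQuasiIso_dsumFst Y.bounded_srcBot hB hB')
  have q₁' : IsQuasiIso M (dsumInl Y.srcTop A) := isQuasiIso_dsumInl Y.bounded_srcTop hA hA'
  have q₂' : IsQuasiIso M (dsumInl Y.srcBot B ≫ ε.inv) := isQuasiIso_comp Y.bounded_srcBot hS hT
    (isQuasiIso_dsumInl Y.bounded_srcBot hB hB') (isQuasiIso_of_iso ε.symm)
  have e₂ : (dsumInl Y.srcBot B ≫ ε.inv) ≫ ε.hom ≫ dsumFst Y.srcBot B = 𝟙 _ := by
    rw [Category.assoc, ε.inv_hom_id_assoc, dsumInl_fst]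
  let β : BinaryPair F :=
    { src := BinaryComplex.ofIso (dsum Y.srcTop A) (dsum Y.srcBot B) e
      tar := Y.tar
      bounded_src := hT
      bounded_tar := Y.bounded_tar
      compTop := (mapC F).map (dsumFst Y.srcTop A) ≫ Y.compTop
      compBot := (mapC F).map (ε.hom ≫ dsumFst Y.srcBot B) ≫ Y.compBot
      quasiIsoTop := isQuasiIso_comp (hT.map F) (Y.bounded_srcTop.map F) Y.bounded_tar
        (q₁.map F) Y.quasiIsoTop
      quasiIsoBot := isQuasiIso_comp (hT.map F) (Y.bounded_srcBot.map F) Y.bounded_tar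
        (q₂.map F) Y.quasiIsoBot }
  refine ⟨bpairClass β, β,
    bpHom (dsumInl Y.srcTop A) (dsumInl Y.srcBot B ≫ ε.inv) (𝟙 _) ?_ ?_,
    bpHom (dsumFst Y.srcTop A) (ε.hom ≫ dsumFst Y.srcBot B) (𝟙 _) ?_ ?_,
    ⟨q₁', q₂', (inferInstance : IsIso (𝟙 Y.tar))⟩, ⟨q₁, q₂, (inferInstance : IsIso (𝟙 Y.tar))⟩,
    bp_ext (dsumInl_fst _ _) e₂ (Category.comp_id _), rfl⟩
  · exact (Category.comp_id _).trans (mapC_comp_comp_of_id _ _ (dsumInl_fst _ _) _).symm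
  · exact (Category.comp_id _).trans (mapC_comp_comp_of_id _ _ e₂ _).symm
  · exact Category.comp_id _
  · exact Category.comp_id _

/-! ### The relative Grothendieck group -/

theorem relClass_conf {X Y Z : BPair F} {i : X ⟶ Y} {p : Y ⟶ Z} (h : BPair.Conf i p) :
    K0OmegaClass Y = K0OmegaClass X + K0OmegaClass Z :=
  congrArg QuotientAddGroup.mk (k0mk_add (conf := BPair.Conf) h)

theorem relClass_weakEquiv {X Y : BPair F} (f : X ⟶ Y) (h : BPair.WeakEquiv f) :
    K0OmegaClass X = K0OmegaClass Y :=
  QuotientAddGroup.eq_iff_sub_mem.2 (AddSubgroup.subset_closure (Or.inr ⟨X, Y, f, h, rfl⟩))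

theorem relClass_diag (X : CPair F) : K0OmegaClass X.diag = 0 :=
  (QuotientAddGroup.eq_zero_iff _).2 (AddSubgroup.subset_closure (Or.inl ⟨X, rfl⟩))

theorem relClass_bpDsum (X Y : BPair F) :
    K0OmegaClass (bpDsum X Y) = K0OmegaClass X + K0OmegaClass Y := relClass_conf (conf_bpInl X Y)

theorem exists_relClass_sub (x : K0OmegaGroup F) :
    ∃ X Y : BPair F, x = K0OmegaClass X - K0OmegaClass Y := by
  obtain ⟨x, rfl⟩ := QuotientAddGroup.mk_surjective x
  have : Nonempty (BPair F) := ⟨bpZero F⟩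
  obtain ⟨X, Y, rfl⟩ := exists_k0mk_sub (conf := BPair.Conf (F := F))
    (fun X Y => ⟨bpDsum X Y, k0mk_add (conf := BPair.Conf) (conf_bpInl X Y)⟩) x
  exact ⟨X, Y, rfl⟩

/-- The homomorphism from the relative Grothendieck group defined by an additive function. -/
def relLift {G : Type*} [AddCommGroup G] (φ : BPair F → G)
    (h : ∀ {X Y Z : BPair F} (i : X ⟶ Y) (p : Y ⟶ Z), BPair.Conf i p → φ Y = φ X + φ Z)
    (hd : ∀ X : CPair F, φ X.diag = 0)
    (hw : ∀ {X Y : BPair F} (f : X ⟶ Y), BPair.WeakEquiv f → φ X = φ Y) :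
    K0OmegaGroup F →+ G :=
  QuotientAddGroup.lift _ (k0lift φ h) ((AddSubgroup.closure_le _).2 (by
    rintro _ (⟨X, rfl⟩ | ⟨X, Y, f, hf, rfl⟩)
    · exact (k0lift_mk φ h _).trans (hd X)
    · refine (map_sub (k0lift φ h) (k0mk BPair.Conf X) (k0mk BPair.Conf Y)).trans ?_
      rw [k0lift_mk, k0lift_mk, hw f hf, sub_self]))

theorem relLift_class {G : Type*} [AddCommGroup G] (φ : BPair F → G)
    (h : ∀ {X Y Z : BPair F} (i : X ⟶ Y) (p : Y ⟶ Z), BPair.Conf i p → φ Y = φ X + φ Z)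
    (hd : ∀ X : CPair F, φ X.diag = 0)
    (hw : ∀ {X Y : BPair F} (f : X ⟶ Y), BPair.WeakEquiv f → φ X = φ Y) (X : BPair F) :
    relLift φ h hd hw (K0OmegaClass X) = φ X := k0lift_mk φ h X

variable (F) in
/-- The object `((⊤ X, ⊥ X), F X, 1)` of `B[F]`. -/
def bpOfSrc (X : BinaryComplex M.carrier) (hX : GradedBounded X.X) : BPair F where
  srcTop := top.obj X
  srcBot := bot.obj X
  tar := (mapB F).obj X
  bounded_srcTop := hX
  bounded_srcBot := hX
  bounded_tar := hX.map F
  compTop := 𝟙 _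
  compBot := 𝟙 _
  quasiIsoTop := isQuasiIso_of_iso (Iso.refl _)
  quasiIsoBot := isQuasiIso_of_iso (Iso.refl _)

/-- The class is additive in X and diagonal complexes give diagonal objects, so dévissage applies
although X need not be acyclic. -/
theorem relClass_bpOfSrc (X : BinaryComplex M.carrier) (hX : GradedBounded X.X) :
    K0OmegaClass (bpOfSrc F X hX) = 0 := by
  classical
  have := eq_zero_of_additive (fun X : BinaryComplex M.carrier =>
    if h : GradedBounded X.X then K0OmegaClass (bpOfSrc F X h) else 0)
    (fun {K L P} f g hK hL hP h => by
      rw [dif_pos hK, dif_pos hL, dif_pos hP]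
      exact relClass_conf (X := bpOfSrc F K hK) (Y := bpOfSrc F L hL) (Z := bpOfSrc F P hP)
        (i := bpHom (top.map f) (bot.map f) ((mapB F).map f)
          ((Category.id_comp _).trans (Category.comp_id _).symm)
          ((Category.id_comp _).trans (Category.comp_id _).symm))
        (p := bpHom (top.map g) (bot.map g) ((mapB F).map g)
          ((Category.id_comp _).trans (Category.comp_id _).symm)
          ((Category.id_comp _).trans (Category.comp_id _).symm)) ⟨h, h, h.map F⟩)
    (fun K hK => by
      refine (dif_pos hK).trans ?_
      exact relClass_diag (F := F) ⟨K, (mapC F).obj K, hK, hK.map F, 𝟙 _,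
        isQuasiIso_of_iso (Iso.refl _)⟩) X hX
  rwa [dif_pos hX] at this

/-- There is a conflation from β to Y₂ with quotient Y₃. Y₂ has cones of identities as sources and
the binary cone of β as target, so its sources can be discarded. Y₃ is a shift of ((⊤, ⊥), F, 1) for
the source of β and has class zero. -/
theorem relClass_toBPair (β : BinaryPair F) :
    K0OmegaClass β.toBPair = K0OmegaClass (bpOfBq F (bpairCone β) (isBq_bpairCone β)) := by
  have w₁ : 𝟙 (top.obj ((mapB F).obj β.src)) ≫ β.compTop =
      (mapC F).map (𝟙 (top.obj β.src)) ≫ β.compTop := by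
    rw [CategoryTheory.Functor.map_id]
    rfl
  have w₂ : 𝟙 (bot.obj ((mapB F).obj β.src)) ≫ β.compBot =
      (mapC F).map (𝟙 (bot.obj β.src)) ≫ β.compBot := by
    rw [CategoryTheory.Functor.map_id]
    rfl
  have q₁ : IsQuasiIso N (𝟙 ((mapC F).obj (top.obj β.src))) := isQuasiIso_of_iso (Iso.refl _)
  have q₂ : IsQuasiIso N (𝟙 ((mapC F).obj (bot.obj β.src))) := isQuasiIso_of_iso (Iso.refl _)
  let Y₂ : BPair F :=
    { srcTop := cone (𝟙 (top.obj β.src))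
      srcBot := cone (𝟙 (bot.obj β.src))
      tar := bpairCone β
      bounded_srcTop := β.bounded_src.biprod β.bounded_src.shift
      bounded_srcBot := β.bounded_src.biprod β.bounded_src.shift
      bounded_tar := (isBq_bpairCone β).1
      compTop := mapConeTo (𝟙 (top.obj β.src)) β.compTop (𝟙 _) β.compTop w₁
      compBot := mapConeTo (𝟙 (bot.obj β.src)) β.compBot (𝟙 _) β.compBot w₂
      quasiIsoTop := isQuasiIso_mapConeTo w₁ β.bounded_src β.bounded_src (β.bounded_src.map F)
        β.bounded_tar q₁ β.quasiIsoTop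
      quasiIsoBot := isQuasiIso_mapConeTo w₂ β.bounded_src β.bounded_src (β.bounded_src.map F)
        β.bounded_tar q₂ β.quasiIsoBot }
  let Y₃ : BPair F :=
    { srcTop := shiftC (top.obj β.src)
      srcBot := shiftC (bot.obj β.src)
      tar := BinaryComplex.shift ((mapB F).obj β.src)
      bounded_srcTop := β.bounded_src.shift
      bounded_srcBot := β.bounded_src.shift
      bounded_tar := (β.bounded_src.map F).shift
      compTop := mapShiftTo (𝟙 ((mapC F).obj (top.obj β.src)))
      compBot := mapShiftTo (𝟙 ((mapC F).obj (bot.obj β.src)))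
      quasiIsoTop := isQuasiIso_mapShiftTo β.bounded_src (β.bounded_src.map F)
        (isQuasiIso_of_iso (Iso.refl _))
      quasiIsoBot := isQuasiIso_mapShiftTo β.bounded_src (β.bounded_src.map F)
        (isQuasiIso_of_iso (Iso.refl _)) }
  have c₁ := (map_coneInl_mapConeTo (F := F) (f := 𝟙 (top.obj β.src)) (g := β.compTop)
    (a := 𝟙 _) (b := β.compTop) w₁).symm
  have c₂ := (map_coneInl_mapConeTo (F := F) (f := 𝟙 (bot.obj β.src)) (g := β.compBot)
    (a := 𝟙 _) (b := β.compBot) w₂).symm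
  have c₃ := mapConeTo_coneSnd (F := F) (f := 𝟙 (top.obj β.src)) (g := β.compTop)
    (a := 𝟙 _) (b := β.compTop) w₁
  have c₄ := mapConeTo_coneSnd (F := F) (f := 𝟙 (bot.obj β.src)) (g := β.compBot)
    (a := 𝟙 _) (b := β.compBot) w₂
  have h₁ := relClass_conf (X := β.toBPair) (Y := Y₂) (Z := Y₃)
    (i := bpHom (coneInl (𝟙 (top.obj β.src))) (coneInl (𝟙 (bot.obj β.src)))
      (bconeInl β.compTop β.compBot) c₁ c₂)
    (p := bpHom (coneSnd (𝟙 (top.obj β.src))) (coneSnd (𝟙 (bot.obj β.src)))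
      (bconeSnd β.compTop β.compBot) c₃ c₄)
    ⟨confC_cone _, confC_cone _, confB_bcone _ _⟩
  have h₂ : K0OmegaClass Y₃ = 0 := by
    rw [← relClass_bpOfSrc (F := F) (BinaryComplex.shift β.src) β.bounded_src.shift]
    -- The shift of the image and the image of the shift have the differentials - F d and F (- d),
    -- so they are compared by an isomorphism with identity components.
    refine (relClass_weakEquiv (X := bpOfSrc F (BinaryComplex.shift β.src) β.bounded_src.shift)
      (Y := Y₃) (bpHom (𝟙 _) (𝟙 _) (BinaryComplex.homMk (mapShiftIso F (top.obj β.src)).hom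
        (mapShiftIso F (bot.obj β.src)).hom fun _ => rfl) ?_ ?_)
      ⟨isQuasiIso_of_iso (Iso.refl _), isQuasiIso_of_iso (Iso.refl _),
        BinaryComplex.isIso_of_comp _ fun i => ?_⟩).symm
    · refine HomologicalComplex.hom_ext _ _ fun i => ?_
      rw [HomologicalComplex.comp_f, HomologicalComplex.comp_f, mapShiftTo_f]
      change 𝟙 ((fn F).obj (β.src.X (i - 1))) ≫ 𝟙 _ = (fn F).map (𝟙 (β.src.X (i - 1))) ≫ 𝟙 _
      rw [CategoryTheory.Functor.map_id]
    · refine HomologicalComplex.hom_ext _ _ fun i => ?_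
      rw [HomologicalComplex.comp_f, HomologicalComplex.comp_f, mapShiftTo_f]
      change 𝟙 ((fn F).obj (β.src.X (i - 1))) ≫ 𝟙 _ = (fn F).map (𝟙 (β.src.X (i - 1))) ≫ 𝟙 _
      rw [CategoryTheory.Functor.map_id]
    · exact inferInstanceAs (IsIso (𝟙 _))
  rw [h₂, add_zero] at h₁
  rw [← h₁]
  exact (relClass_weakEquiv _ (weakEquiv_bpOfBqHom Y₂ (isBq_bpairCone β) (acyclic_cone_id _)
    (acyclic_cone_id _))).symm

end

end GoodExact

/-! ### Exactness at K_0 Ω[F] and at K_1 N -/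

namespace GoodExact

open BinaryComplex (top bot diag bcone bconeMap bconeInl bconeSnd ofGraded comp)

section

variable {M N : ConflationCat.{v, u}} [GoodExact M] [GoodExact N] (F : M ⟶ N)

theorem relClass_bpOfBq_conf {X Y Z : BinaryComplex N.carrier} {f : X ⟶ Y} {g : Y ⟶ Z}
    (h : ConfB N f g) (hX : IsBq N X) (hY : IsBq N Y) (hZ : IsBq N Z) :
    K0OmegaClass (bpOfBq F Y hY) = K0OmegaClass (bpOfBq F X hX) +
      K0OmegaClass (bpOfBq F Z hZ) := by
  have conf_zero : ∀ n : ℤ, M.conf ((0 : top.obj (ofGraded fun _ => (0 : M.carrier)) ⟶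
      top.obj (ofGraded fun _ => 0)).f n) ((0 : top.obj (ofGraded fun _ => (0 : M.carrier)) ⟶
      top.obj (ofGraded fun _ => 0)).f n) := fun _ =>
    have : IsIso (0 : (0 : M.carrier) ⟶ 0) := (isZero_zero M.carrier).isIso (isZero_zero M.carrier) 0
    conf_zero_iso (A := (0 : M.carrier)) (isZero_zero _) (0 : (0 : M.carrier) ⟶ 0) (0 : (0 : M.carrier) ⟶ 0)
  exact
  relClass_conf (X := bpOfBq F X hX) (Y := bpOfBq F Y hY) (Z := bpOfBq F Z hZ)
    (i := bpHom 0 0 f (zero_comp.trans ((congrArg (fun z => z ≫ _)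
      ((mapC F).map_zero _ _)).trans zero_comp).symm) (zero_comp.trans ((congrArg (fun z => z ≫ _)
      ((mapC F).map_zero _ _)).trans zero_comp).symm))
    (p := bpHom 0 0 g (zero_comp.trans ((congrArg (fun z => z ≫ _)
      ((mapC F).map_zero _ _)).trans zero_comp).symm) (zero_comp.trans ((congrArg (fun z => z ≫ _)
      ((mapC F).map_zero _ _)).trans zero_comp).symm))
    ⟨conf_zero, conf_zero, h⟩

/-- The map `K_0 B^q N ⟶ K_0 Ω[F]`. -/
def relOfBq : K0Group (BqObj N) (Bq N).conf →+ K0OmegaGroup F :=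
  k0lift (fun X => K0OmegaClass (bpOfBq F X.obj X.property))
    fun {X Y Z} i p h => relClass_bpOfBq_conf F (f := i.hom) (g := p.hom) h X.property Y.property
      Z.property

theorem relOfBq_class (X : BqObj N) :
    relOfBq F (K0Class (Bq N) X) = K0OmegaClass (bpOfBq F X.obj X.property) :=
  k0lift_mk (C := BqObj N) (conf := (Bq N).conf)
    (fun X => K0OmegaClass (bpOfBq F X.obj X.property))
    (fun {X Y Z} i p h => relClass_bpOfBq_conf F (f := i.hom) (g := p.hom) h X.property Y.property
      Z.property) X

theorem map_diag_relOfBq : K0.map (diagNat.app N) ≫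
    AddCommGrpCat.ofHom (relOfBq F) = 0 := by
  refine AddCommGrpCat.hom_ext (QuotientAddGroup.addMonoidHom_ext _
    (FreeAbelianGroup.lift_ext _ _ fun X => ?_))
  exact (relOfBq_class F ((CqObj.diag N).obj X)).trans (relClass_diag (F := F)
    ⟨top.obj (ofGraded fun _ => 0), X.obj, ⟨0, 0, fun _ _ => isZero_zero _⟩, X.property.1, 0,
      (bpOfBq F (BinaryComplex.diag.obj X.obj)
        ⟨X.property.1, X.property.2, X.property.2⟩).quasiIsoTop⟩)

/-- The boundary map `K_1 N ⟶ K_0 Ω[F]`. -/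
def bdryOfBq : (K 1).obj N →+ K0OmegaGroup F :=
  (cokernel.desc (K0.map (diagNat.app N)) (AddCommGrpCat.ofHom (relOfBq F))
    (map_diag_relOfBq F)).hom

theorem bdryOfBq_bqClass {X : BinaryComplex N.carrier} (hX : IsBq N X) :
    bdryOfBq F (bqClass N X) = K0OmegaClass (bpOfBq F X hX) := by
  rw [bqClass_eq hX]
  have := cokernel.π_desc (K0.map (diagNat.app N)) (AddCommGrpCat.ofHom (relOfBq F))
    (map_diag_relOfBq F)
  exact (ConcreteCategory.congr_hom this (K0Class (Bq N) ⟨X, hX⟩)).trans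
    (relOfBq_class F ⟨X, hX⟩)

-- The boundary does not depend on which zero complexes serve as sources: 0 maps to Y by a weak
-- equivalence that is the identity on the target.
variable {F} in
theorem bdryOfBq_vertexK (X : BqObj N) (Y : BPair F) (h₁ : ∀ i, IsZero (Y.srcTop.X i))
    (h₂ : ∀ i, IsZero (Y.srcBot.X i)) (h : Y.tar = X.obj) :
    bdryOfBq F (vertexK 1 N (K0Class (Bq N) X)) = K0OmegaClass Y := by
  have hY : IsBq N Y.tar := h ▸ X.property
  have : X = ⟨Y.tar, hY⟩ := by
    cases X
    cases h
    rfl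
  rw [this, ← bqClass_eq hY, bdryOfBq_bqClass F hY]
  exact relClass_weakEquiv _ (weakEquiv_bpOfBqHom Y hY (acyclic_of_isZero h₁)
    (acyclic_of_isZero h₂))

/-- The difference of the Euler characteristics, as a map `K_0 Ω[F] ⟶ K_0 M`. -/
def relEuler : K0OmegaGroup F →+ K0Group M.carrier M.conf :=
  relLift (F := F) bpEuler (fun _ _ => bpEuler_conf) (fun _ => sub_self _)
    fun _ => bpEuler_weakEquiv

theorem relEuler_class (Y : BPair F) : relEuler F (K0OmegaClass Y) = bpEuler Y :=
  relLift_class (F := F) bpEuler (fun _ _ => bpEuler_conf) (fun _ => sub_self _)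
    (fun _ => bpEuler_weakEquiv) Y

/-- An object of Euler characteristic zero is weakly equivalent to one with a binary source, whose
class is that of its binary cone in B^q N. -/
theorem exact_bdryOfBq_relEuler : Function.Exact (bdryOfBq F) (relEuler F) := by
  intro z
  constructor
  · intro hz
    obtain ⟨Y₁, Y₂, rfl⟩ := exists_relClass_sub (F := F) z
    -- A difference Y₁ - Y₂ of Euler characteristic zero does not have terms of Euler characteristic
    -- zero; adding the swap of Y₂ to both terms achieves this without changing the difference.
    have h : bpEuler (bpDsum Y₁ (bpSwap Y₂)) = 0 := by
      rw [bpEuler_bpDsum, bpEuler_bpSwap, ← sub_eq_add_neg, ← relEuler_class, ← relEuler_class,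
        ← map_sub, hz]
    have h' : bpEuler (bpDsum Y₂ (bpSwap Y₂)) = 0 := by
      rw [bpEuler_bpDsum, bpEuler_bpSwap, add_neg_cancel]
    have key : ∀ Y : BPair F, bpEuler Y = 0 → ∃ x, bdryOfBq F x = K0OmegaClass Y := by
      intro Y hY
      obtain ⟨k, β, i, -, hi, -⟩ := exists_hasClass Y hY
      exact ⟨bqClass N (bpairCone β), by
        rw [bdryOfBq_bqClass F (isBq_bpairCone β), relClass_weakEquiv i hi, relClass_toBPair]⟩
    obtain ⟨x, hx⟩ := key _ h
    obtain ⟨y, hy⟩ := key _ h'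
    refine ⟨x - y, ?_⟩
    rw [map_sub, hx, hy, relClass_bpDsum, relClass_bpDsum, add_sub_add_right_eq_sub]
  · rintro ⟨x, rfl⟩
    obtain ⟨X, Y, hX, hY, rfl⟩ := exists_bqClass_sub x
    rw [map_sub, map_sub, bdryOfBq_bqClass F hX, bdryOfBq_bqClass F hY, relEuler_class,
      relEuler_class]
    exact (congrArg₂ (fun a b => a - b) (sub_self _) (sub_self _)).trans (sub_self _)

theorem exact_map_bdryOfBq : Function.Exact ((K 1).map F) (bdryOfBq F) := by
  intro x
  constructor
  · intro hx
    -- R is the partial inverse of the boundary map, defined on isomorphism classes that possess a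
    -- class in the cokernel.
    let R : IsoCl (BPair F) → K1Coker F → Prop := fun s h => ∃ Y, isoCl Y = s ∧ HasClass Y h
    have hadd : ∀ {s t h h'}, R s h → R t h' → R (s + t) (h + h') := by
      rintro _ _ h h' ⟨Y, rfl, H⟩ ⟨Y', rfl, H'⟩
      exact ⟨_, isoCl_bpDsum _ _, H.dsum H'⟩
    have hsum : ∀ Y : BPair F, ∃ h, HasClass (bpDsum Y (bpSwap Y)) h := fun Y =>
      exists_hasClass _ (by rw [bpEuler_bpDsum, bpEuler_bpSwap, add_neg_cancel])
    have h0 : R 0 0 := ⟨bpZero F, isoCl_bpZero, by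
      have := hasClass_bpOfBq (F := F) _ (isBq_of_isZero (K := ofGraded fun _ => (0 : N.carrier))
        fun _ => isZero_zero _)
      rwa [bqClass_of_isZero (X := ofGraded fun _ => (0 : N.carrier)) fun _ => isZero_zero _]
        at this⟩
    obtain ⟨G, _, q, hq, hq'⟩ := exists_hom_of_partial R h0
      (by
        rintro _ h h' ⟨Y, rfl, H⟩ ⟨Y', hY', H'⟩
        obtain ⟨e⟩ := isoCl_eq_iff.1 hY'
        exact (H'.eq_of_weakEquiv H e.hom (weakEquiv_of_isIso e)).symm)
      hadd
      (by
        intro s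
        obtain ⟨Y, rfl⟩ := isoCl_surjective s
        obtain ⟨h, H⟩ := hsum Y
        exact ⟨isoCl (bpSwap Y), h, _, isoCl_bpDsum _ _, H⟩)
    -- The relations of K_0 Ω[F] are checked after adding a complement that makes the Euler
    -- characteristics zero, where R is defined and known to respect them.
    let Q : K0OmegaGroup F →+ G := relLift (fun Y => q (isoCl Y))
      (by
        intro X Y Z i p h
        obtain ⟨k, H⟩ := hsum X
        obtain ⟨l, L⟩ := hsum Z
        -- The complement swap X ⊕ swap Z turns the conflation into one between objects that all
        -- have a class, with outer terms X ⊕ swap X and Z ⊕ swap Z.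
        obtain ⟨m, H'⟩ := exists_hasClass (bpDsum Y (bpDsum (bpSwap X) (bpSwap Z))) (by
          rw [bpEuler_bpDsum, bpEuler_bpDsum, bpEuler_bpSwap, bpEuler_bpSwap, bpEuler_conf h]
          abel)
        have hm := H.eq_add_of_conf H' L (conf_bpDsumMap h (conf_bpInl (bpSwap X) (bpSwap Z)))
        rw [hm] at H'
        refine (hq (isoCl Y) (isoCl X + isoCl Z) (isoCl (bpSwap X) + isoCl (bpSwap Z)) (k + l)
          ⟨_, by rw [isoCl_bpDsum, isoCl_bpDsum], H'⟩ ⟨_, ?_, H.dsum L⟩).trans (map_add q _ _)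
        rw [isoCl_bpDsum, isoCl_bpDsum, isoCl_bpDsum, add_add_add_comm])
      (fun X => (hq (isoCl X.diag) 0 0 0 ⟨X.diag, (add_zero _).symm, hasClass_diag X⟩
        (by rwa [add_zero])).trans (map_zero q))
      (fun {X Y} f hf => by
        obtain ⟨k, H⟩ := hsum Y
        obtain ⟨l, L⟩ := exists_hasClass (bpDsum X (bpSwap Y)) (by
          rw [bpEuler_bpDsum, bpEuler_bpSwap, bpEuler_weakEquiv hf, add_neg_cancel])
        have hl := L.eq_of_weakEquiv H _ (weakEquiv_bpDsumMap hf (weakEquiv_id (bpSwap Y)))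
        rw [hl] at L
        exact hq _ _ (isoCl (bpSwap Y)) k ⟨_, isoCl_bpDsum _ _, L⟩ ⟨_, isoCl_bpDsum _ _, H⟩)
    have hQ : ∀ Y : BPair F, Q (K0OmegaClass Y) = q (isoCl Y) := fun Y =>
      relLift_class (F := F) (fun Y => q (isoCl Y)) _ _ _ Y
    obtain ⟨X, X', hX, hX', rfl⟩ := exists_bqClass_sub x
    have hXX : (K0OmegaClass (bpOfBq F X hX) : K0OmegaGroup F) = K0OmegaClass (bpOfBq F X' hX') := by
      rw [← sub_eq_zero, ← bdryOfBq_bqClass F hX, ← bdryOfBq_bqClass F hX']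
      exact (map_sub (bdryOfBq F) _ _).symm.trans hx
    -- The objects (0, X, 0) and (0, X', 0) lie in the domain of R, where q separates values; so X
    -- and X' agree modulo the image of K_1 M.
    have := hq' _ _ _ _ ⟨_, rfl, hasClass_bpOfBq (F := F) X hX⟩
      ⟨_, rfl, hasClass_bpOfBq (F := F) X' hX'⟩ (by rw [← hQ, ← hQ, hXX])
    exact (QuotientAddGroup.eq_iff_sub_mem.1 this)
  · rintro ⟨x, rfl⟩
    obtain ⟨X, Y, hX, hY, rfl⟩ := exists_bqClass_sub x
    -- For X in B^q M, the object (0, FX, 0) is weakly equivalent to ((⊤X, ⊥X), FX, 1), which is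
    -- zero.
    have key : ∀ (X : BinaryComplex M.carrier) (hX : IsBq M X),
        bdryOfBq F ((K 1).map F (bqClass M X)) = 0 := by
      intro X hX
      have hX' : IsBq N ((mapB F).obj X) := ⟨hX.1.map F, hX.2.1.map F, hX.2.2.map F⟩
      rw [map_bqClass F hX, bdryOfBq_bqClass F hX', ← relClass_bpOfSrc (F := F) X hX.1]
      exact relClass_weakEquiv _ (weakEquiv_bpOfBqHom (bpOfSrc F X hX.1) hX' hX.2.1 hX.2.2)
    rw [map_sub, map_sub, key X hX, key Y hY, sub_self]

end

end GoodExact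

/-! ### Exactness at K_0 M -/

namespace GoodExact

open BinaryComplex (top bot diag bcone bconeMap bconeInl bconeSnd ofGraded comp)

section

variable {M N : ConflationCat.{v, u}} [GoodExact M] [GoodExact N] (F : M ⟶ N)

theorem map_eulerChar {X : ℤ → M.carrier} (hX : GradedBounded X) :
    K0.map F (eulerChar M X) = eulerChar N fun i => (fn F).obj (X i) := by
  obtain ⟨s, hs⟩ := hX.exists_finset
  rw [eulerChar_eq_sum s hs, eulerChar_eq_sum s fun i hi => (fn F).map_isZero (hs i hi)]
  refine (map_sum (K0.map F).hom _ _).trans (Finset.sum_congr rfl fun i _ => ?_)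
  exact map_zsmul (K0.map F).hom _ _

theorem exists_K0Class_sub (x : K0Group M.carrier M.conf) :
    ∃ A B : M.carrier, x = K0Class M A - K0Class M B := by
  have : Nonempty M.carrier := ⟨0⟩
  exact exists_k0mk_sub (fun A D => ⟨A ⊞ D, k0mk_add (conf_biprod A D)⟩) x

/-- A complex concentrated in degree zero. -/
def singleZero (A : M.carrier) : BinaryComplex M.carrier :=
  ofGraded fun i => if i = 0 then A else 0

theorem isZero_singleZero (A : M.carrier) {i : ℤ} (hi : i ≠ 0) :
    IsZero ((singleZero A).X i) := by
  change IsZero (if i = 0 then A else 0)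
  rw [if_neg hi]
  exact isZero_zero _

theorem bounded_singleZero (A : M.carrier) : GradedBounded (singleZero A).X :=
  ⟨0, 0, fun _ hi => isZero_singleZero A (by omega)⟩

theorem eulerChar_singleZero (A : M.carrier) :
    eulerChar M (singleZero A).X = K0Class M A := by
  rw [eulerChar_eq_sum {0} fun i hi => isZero_singleZero A (by simpa using hi),
    Finset.sum_singleton]
  exact one_zsmul _

/-- In one direction, both sources of an object of B[F] are quasi-isomorphic over N to complexes
with the same terms. Conversely, an element [A] - [B] killed by F is lifted by building a common
target for FA and FB out of acyclic summands. -/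
theorem exact_relEuler_map : Function.Exact (relEuler F) (K0.map F) := by
  intro x
  constructor
  · intro hx
    obtain ⟨A, B, rfl⟩ := exists_K0Class_sub x
    have h : eulerChar N ((mapB F).obj (singleZero A)).X =
        eulerChar N ((mapB F).obj (singleZero B)).X := by
      refine (map_eulerChar F (bounded_singleZero A)).symm.trans
        (Eq.trans ?_ (map_eulerChar F (bounded_singleZero B)))
      rw [eulerChar_singleZero, eulerChar_singleZero, ← sub_eq_zero]
      exact (map_sub (K0.map F).hom _ _).symm.trans hx
    let P : ChainComplex M.carrier ℤ := top.obj (singleZero A)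
    let Q : ChainComplex M.carrier ℤ := top.obj (singleZero B)
    have hP : GradedBounded ((mapC F).obj P).X := (bounded_singleZero A).map F
    have hQ : GradedBounded ((mapC F).obj Q).X := (bounded_singleZero B).map F
    obtain ⟨S, T, hS, hS', hT, hT', e⟩ := exists_acyclic_of_eulerChar_eq hP hQ h
    let e' : ∀ i, (dsum ((mapC F).obj P) S).X i ≅ (dsum ((mapC F).obj Q) T).X i :=
      fun i => (e i).some
    let ε := BinaryComplex.ofIsoBot (dsum ((mapC F).obj P) S) (dsum ((mapC F).obj Q) T) e'
    -- The target has FA ⊕ S as top and, up to the isomorphism ε, FB ⊕ T as bottom; the inclusions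
    -- of FA and FB are quasi-isomorphisms since S and T are acyclic.
    let Y : BPair F :=
      { srcTop := P
        srcBot := Q
        tar := BinaryComplex.ofIso (dsum ((mapC F).obj P) S) (dsum ((mapC F).obj Q) T) e'
        bounded_srcTop := bounded_singleZero A
        bounded_srcBot := bounded_singleZero B
        bounded_tar := hP.biprod hS
        compTop := dsumInl _ _
        compBot := dsumInl ((mapC F).obj Q) T ≫ ε.inv
        quasiIsoTop := isQuasiIso_dsumInl hP hS hS'
        quasiIsoBot := isQuasiIso_comp hQ (hQ.biprod hT) (hP.biprod hS)
          (isQuasiIso_dsumInl hQ hT hT') (isQuasiIso_of_iso ε.symm) }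
    refine ⟨K0OmegaClass Y, (relEuler_class F Y).trans ?_⟩
    exact congrArg₂ (fun a b => a - b) (eulerChar_singleZero A) (eulerChar_singleZero B)
  · rintro ⟨z, rfl⟩
    obtain ⟨Y₁, Y₂, rfl⟩ := exists_relClass_sub (F := F) z
    have key : ∀ Y : BPair F, K0.map F (bpEuler Y) = 0 := by
      intro Y
      refine (map_sub (K0.map F).hom _ _).trans (sub_eq_zero.2 ?_)
      refine (map_eulerChar F Y.bounded_srcTop).trans
        (Eq.trans ?_ (map_eulerChar F Y.bounded_srcBot).symm)
      exact (eulerChar_of_isQuasiIso (Y.bounded_srcTop.map F) Y.bounded_tar _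
        Y.quasiIsoTop).trans (eulerChar_of_isQuasiIso (Y.bounded_srcBot.map F) Y.bounded_tar _
        Y.quasiIsoBot).symm
    rw [map_sub, relEuler_class, relEuler_class]
    exact (map_sub (K0.map F).hom _ _).trans
      ((congrArg₂ (fun a b => a - b) (key Y₁) (key Y₂)).trans (sub_self _))

end

end GoodExact

/-! ### Cokernels of split monomorphisms of abelian groups -/

section

variable {C : Type u₁} [Category.{v₁} C] (G : C ⥤ AddCommGrpCat.{w}) {X Y : C} (δ : X ⟶ Y)
  (t : Y ⟶ X) (h : δ ≫ t = 𝟙 X)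

theorem map_comp_cokernel_π : G.map (t ≫ δ) ≫ cokernel.π (G.map δ) = 0 := by
  rw [Functor.map_comp, Category.assoc, cokernel.condition, comp_zero]

include h

/-- The endomorphism 1 - G(t ≫ δ) kills the image of δ, so it factors through the cokernel and
vanishes on the kernel of the projection. -/
theorem map_of_cokernel_π_eq_zero {x : G.obj Y} (hx : cokernel.π (G.map δ) x = 0) :
    G.map (t ≫ δ) x = x := by
  have w : G.map δ ≫ (𝟙 _ - G.map (t ≫ δ)) = 0 := by
    rw [Preadditive.comp_sub, Category.comp_id, ← G.map_comp, ← Category.assoc, h,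
      Category.id_comp, sub_self]
  have h₁ := ConcreteCategory.congr_hom (cokernel.π_desc (G.map δ) _ w) x
  have h₂ : (𝟙 (G.obj Y) - G.map (t ≫ δ)) x = 0 := by
    rw [← h₁, ConcreteCategory.comp_apply, hx]
    exact map_zero (cokernel.desc (G.map δ) _ w).hom
  exact (sub_eq_zero.1 h₂).symm

/-- Since δ = δ ≫ t ≫ δ, the idempotent can be moved across a and is then killed by the projection.
Only compatibility with idempotents on Y and Y' is needed, not a map between the groups of X and X'.
-/
theorem map_comp_comp_cokernel_π {D : Type u₂} [Category.{v₂} D] (H : D ⥤ AddCommGrpCat.{w})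
    {X' Y' : D} (δ' : X' ⟶ Y') (t' : Y' ⟶ X') {a : G.obj Y ⟶ H.obj Y'}
    (ha : G.map (t ≫ δ) ≫ a = a ≫ H.map (t' ≫ δ')) :
    G.map δ ≫ a ≫ cokernel.π (H.map δ') = 0 := by
  have h' : G.map δ = G.map δ ≫ G.map (t ≫ δ) := by
    rw [← G.map_comp, ← Category.assoc, h, Category.id_comp]
  rw [h', Category.assoc, ← Category.assoc (G.map (t ≫ δ)), ha, Category.assoc,
    map_comp_cokernel_π, comp_zero, comp_zero]

end

/-- Exactness passes to the quotients by the images of compatible idempotents. -/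
theorem exact_of_quotients {A B C A' B' C' : AddCommGrpCat.{w}} {f : A ⟶ B} {g : B ⟶ C}
    {f' : A' ⟶ B'} {g' : B' ⟶ C'} {p : A ⟶ A'} {q : B ⟶ B'} {r : C ⟶ C'}
    (h : Function.Exact f g) (hp : Function.Surjective p) (hq : Function.Surjective q)
    (hf : p ≫ f' = f ≫ q) (hg : q ≫ g' = g ≫ r) {e : B ⟶ B} {e' : C ⟶ C}
    (he : e ≫ g = g ≫ e') (hqe : e ≫ q = 0) (hr : ∀ z, r z = 0 → e' z = z) :
    Function.Exact f' g' := by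
  have hf := ConcreteCategory.congr_hom hf
  have hg := ConcreteCategory.congr_hom hg
  have he := ConcreteCategory.congr_hom he
  have hqe := ConcreteCategory.congr_hom hqe
  simp only [ConcreteCategory.comp_apply] at hf hg he hqe
  intro y
  constructor
  · intro hy
    obtain ⟨y, rfl⟩ := hq y
    -- Subtracting e y leaves the image under q unchanged and turns vanishing of g y modulo the
    -- kernel of r into vanishing of g (y - e y).
    obtain ⟨x, hx⟩ := (h (y - e y)).1 (by
      rw [map_sub, he, hr _ ((hg y).symm.trans hy), sub_self])
    refine ⟨p x, ?_⟩
    rw [hf, hx, map_sub, hqe]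
    exact sub_zero _
  · rintro ⟨x, rfl⟩
    obtain ⟨x, rfl⟩ := hp x
    rw [hf, hg, h.apply_apply_eq_zero, map_zero]

namespace GoodExact

/-! ### Maps from the groups of the last vertices -/

theorem vertexK1_surjective : ∀ (n : ℕ) (N : ConflationCat.{v, u}),
    Function.Surjective (vertexK1 n N)
  | 0, N => fun x => ⟨x, rfl⟩
  | n + 1, N => by
    have h₁ := vertexK1_surjective n (BqFunctor.obj N)
    have h₂ := cokernel_π_surjective ((K (n + 1)).map (diagNat.app N))
    exact (h₂.comp h₁ :)

theorem vertexKOmega_surjective : ∀ (n : ℕ) (F : Arrow ConflationCat.{v, u}),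
    Function.Surjective (vertexKOmega n F)
  | 0, F => fun x => ⟨x, rfl⟩
  | n + 1, F => by
    have h₁ := vertexKOmega_surjective n (BqFunctor.mapArrow.obj F)
    have h₂ := cokernel_π_surjective
      ((KOmega n).map (((Functor.mapArrowFunctor _ _).map diagNat).app F))
    exact (h₂.comp h₁ :)

/-- The projection `K_n (B^q N) ⟶ K_(n+1) N`. -/
def projK (n : ℕ) (N : ConflationCat.{v, u}) : (K n).obj (BqFunctor.obj N) ⟶ (K (n + 1)).obj N :=
  cokernel.π ((K n).map (diagNat.app N))

/-- The projection `(K_0 Ω)(Ω^n [B^q F]) ⟶ (K_0 Ω)(Ω^(n+1) [F])`. -/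
def projKOmega (n : ℕ) (F : Arrow ConflationCat.{v, u}) :
    (KOmega n).obj (BqFunctor.mapArrow.obj F) ⟶ (KOmega (n + 1)).obj F :=
  cokernel.π ((KOmega n).map (((Functor.mapArrowFunctor _ _).map diagNat).app F))

theorem projK_surjective (n : ℕ) (N : ConflationCat.{v, u}) : Function.Surjective (projK n N) :=
  cokernel_π_surjective _

theorem projKOmega_surjective (n : ℕ) (F : Arrow ConflationCat.{v, u}) :
    Function.Surjective (projKOmega n F) :=
  cokernel_π_surjective _

theorem projK_map (n : ℕ) {M N : ConflationCat.{v, u}} (F : M ⟶ N) :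
    projK n M ≫ (K (n + 1)).map F = (K n).map (BqFunctor.map F) ≫ projK n N :=
  cokernel.π_desc _ _ _

theorem projKOmega_map (n : ℕ) {F G : Arrow ConflationCat.{v, u}} (s : F ⟶ G) :
    projKOmega n F ≫ (KOmega (n + 1)).map s =
      (KOmega n).map (BqFunctor.mapArrow.map s) ≫ projKOmega n G :=
  cokernel.π_desc _ _ _

theorem vertexK_naturality : ∀ (n : ℕ) {M N : ConflationCat.{v, u}} (F : M ⟶ N),
    vertexK n M ≫ (K n).map F = K0.map ((BqIter n).map F) ≫ vertexK n N
  | 0, M, N, F => (Category.id_comp _).trans (Category.comp_id _).symm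
  | n + 1, M, N, F => by
    have h := vertexK_naturality n (BqFunctor.map F)
    change (vertexK n (BqFunctor.obj M) ≫ projK n M) ≫ _ = K0.map ((BqIter n).map (BqFunctor.map F)) ≫
      vertexK n (BqFunctor.obj N) ≫ projK n N
    rw [Category.assoc, projK_map, ← Category.assoc, ← Category.assoc]
    exact congrArg (fun z => z ≫ projK n N) h

theorem vertexK1_naturality : ∀ (n : ℕ) {M N : ConflationCat.{v, u}} (F : M ⟶ N),
    vertexK1 n M ≫ (K (n + 1)).map F = (K 1).map ((BqIter n).map F) ≫ vertexK1 n N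
  | 0, M, N, F => (Category.id_comp _).trans (Category.comp_id _).symm
  | n + 1, M, N, F => by
    have h := vertexK1_naturality n (BqFunctor.map F)
    change (vertexK1 n (BqFunctor.obj M) ≫ projK (n + 1) M) ≫ _ =
      (K 1).map ((BqIter n).map (BqFunctor.map F)) ≫ vertexK1 n (BqFunctor.obj N) ≫ projK (n + 1) N
    rw [Category.assoc, projK_map, ← Category.assoc, ← Category.assoc]
    exact congrArg (fun z => z ≫ projK (n + 1) N) h

theorem vertexKOmega_naturality : ∀ (n : ℕ) {F G : Arrow ConflationCat.{v, u}} (s : F ⟶ G),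
    vertexKOmega n F ≫ (KOmega n).map s =
      K0Omega.map ((BqIter n).mapArrow.map s) ≫ vertexKOmega n G
  | 0, F, G, s => (Category.id_comp _).trans (Category.comp_id _).symm
  | n + 1, F, G, s => by
    have h := vertexKOmega_naturality n (BqFunctor.mapArrow.map s)
    change (vertexKOmega n (BqFunctor.mapArrow.obj F) ≫ projKOmega n F) ≫ _ =
      K0Omega.map ((BqIter n).mapArrow.map (BqFunctor.mapArrow.map s)) ≫
        vertexKOmega n (BqFunctor.mapArrow.obj G) ≫ projKOmega n G
    rw [Category.assoc, projKOmega_map, ← Category.assoc, ← Category.assoc]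
    exact congrArg (fun z => z ≫ projKOmega n G) h

/-- The diagonal `[C^q F] ⟶ [B^q F]`. -/
def pairDiag (F : Arrow ConflationCat.{v, u}) :
    CqFunctor.mapArrow.obj F ⟶ BqFunctor.mapArrow.obj F :=
  ((Functor.mapArrowFunctor _ _).map diagNat).app F

/-- The functor `⊤`, as a map of pairs `[B^q F] ⟶ [C^q F]`. -/
def pairTop (F : Arrow ConflationCat.{v, u}) :
    BqFunctor.mapArrow.obj F ⟶ CqFunctor.mapArrow.obj F :=
  ((Functor.mapArrowFunctor _ _).map topNat).app F

theorem pairDiag_pairTop (F : Arrow ConflationCat.{v, u}) : pairDiag F ≫ pairTop F = 𝟙 _ :=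
  Arrow.hom_ext _ _ (diagNat_topNat _) (diagNat_topNat _)

theorem map_top_diag_projK (n : ℕ) (N : ConflationCat.{v, u}) :
    (K n).map (topNat.app N ≫ diagNat.app N) ≫ projK n N = 0 :=
  map_comp_cokernel_π _ _ _

theorem map_pairTop_pairDiag_projKOmega (n : ℕ) (F : Arrow ConflationCat.{v, u}) :
    (KOmega n).map (pairTop F ≫ pairDiag F) ≫ projKOmega n F = 0 :=
  map_comp_cokernel_π _ _ _

theorem map_top_diag_of_projK {n : ℕ} {N : ConflationCat.{v, u}}
    (x : (K n).obj (BqFunctor.obj N)) (h : projK n N x = 0) :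
    (K n).map (topNat.app N ≫ diagNat.app N) x = x :=
  map_of_cokernel_π_eq_zero _ _ _ (diagNat_topNat N) h

theorem map_pairTop_pairDiag_of_projKOmega {n : ℕ} {F : Arrow ConflationCat.{v, u}}
    (x : (KOmega n).obj (BqFunctor.mapArrow.obj F)) (h : projKOmega n F x = 0) :
    (KOmega n).map (pairTop F ≫ pairDiag F) x = x :=
  map_of_cokernel_π_eq_zero _ _ _ (pairDiag_pairTop F) h

/-! ### The long exact sequence -/

instance bqFunctor_goodExact (N : ConflationCat.{v, u}) [GoodExact N] :
    GoodExact (BqFunctor.obj N) := bq_goodExact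

instance bqIter_goodExact : ∀ (n : ℕ) (N : ConflationCat.{v, u}) [GoodExact N],
    GoodExact ((BqIter n).obj N)
  | 0, _, h => h
  | n + 1, N, _ => bqIter_goodExact n (Bq N)

/-- The `n`-th segment of the long exact sequence. -/
structure IsBoundary (n : ℕ) {M N : ConflationCat.{v, u}} (F : M ⟶ N)
    (a : (K (n + 1)).obj N ⟶ (KOmega n).obj (Arrow.mk F))
    (b : (KOmega n).obj (Arrow.mk F) ⟶ (K n).obj M) : Prop where
  -- Y ranges over all objects with zero sources, because functors do not preserve a chosen zero
  -- object on the nose; this keeps the formula stable under maps of pairs.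
  left_class : ∀ (X : BqObj ((BqIter n).obj N)) (Y : BPair ((BqIter n).map F)),
    (∀ i, IsZero (Y.srcTop.X i)) → (∀ i, IsZero (Y.srcBot.X i)) → Y.tar = X.obj →
    a (vertexK1 n N (vertexK 1 ((BqIter n).obj N) (K0Class (Bq ((BqIter n).obj N)) X))) =
      vertexKOmega n (Arrow.mk F) (K0OmegaClass Y)
  right_class : ∀ Y : BPair ((BqIter n).map F),
    b (vertexKOmega n (Arrow.mk F) (K0OmegaClass Y)) =
      vertexK n M (eulerChar ((BqIter n).obj M) Y.srcTop.X -
        eulerChar ((BqIter n).obj M) Y.srcBot.X)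
  exact₁ : Function.Exact ((K (n + 1)).map F) a
  exact₂ : Function.Exact a b
  exact₃ : Function.Exact b ((K n).map F)

/-- K_(n+1) N is a quotient of the free abelian group on the objects of B^q (B^q)^n N, so the
formula in `left_class` determines the boundary map. -/
theorem K_hom_ext {n : ℕ} {N : ConflationCat.{v, u}} {A : AddCommGrpCat}
    {f g : (K (n + 1)).obj N ⟶ A} (h : ∀ X : BqObj ((BqIter n).obj N),
      f (vertexK1 n N (vertexK 1 ((BqIter n).obj N) (K0Class (Bq ((BqIter n).obj N)) X))) =
      g (vertexK1 n N (vertexK 1 ((BqIter n).obj N) (K0Class (Bq ((BqIter n).obj N)) X)))) :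
    f = g := by
  have key : vertexK 1 ((BqIter n).obj N) ≫ vertexK1 n N ≫ f =
      vertexK 1 ((BqIter n).obj N) ≫ vertexK1 n N ≫ g :=
    AddCommGrpCat.hom_ext (QuotientAddGroup.addMonoidHom_ext _
      (FreeAbelianGroup.lift_ext _ _ fun X => h X))
  ext x
  obtain ⟨x, rfl⟩ := vertexK1_surjective n N x
  obtain ⟨x, rfl⟩ := vertexK_surjective 1 _ x
  exact ConcreteCategory.congr_hom key x

theorem KOmega_hom_ext {n : ℕ} {M N : ConflationCat.{v, u}} {F : M ⟶ N} {A : AddCommGrpCat}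
    {f g : (KOmega n).obj (Arrow.mk F) ⟶ A} (h : ∀ Y : BPair ((BqIter n).map F),
      f (vertexKOmega n (Arrow.mk F) (K0OmegaClass Y)) =
      g (vertexKOmega n (Arrow.mk F) (K0OmegaClass Y))) :
    f = g := by
  have key : vertexKOmega n (Arrow.mk F) ≫ f = vertexKOmega n (Arrow.mk F) ≫ g :=
    AddCommGrpCat.hom_ext (QuotientAddGroup.addMonoidHom_ext _ (QuotientAddGroup.addMonoidHom_ext _
      (FreeAbelianGroup.lift_ext _ _ fun X => h X)))
  ext x
  obtain ⟨x, rfl⟩ := vertexKOmega_surjective n _ x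
  exact ConcreteCategory.congr_hom key x

/-! ### Naturality of the segments and the inductive step -/

section

variable {M N : ConflationCat.{v, u}} [GoodExact M] [GoodExact N] {F : M ⟶ N} {n : ℕ}
variable {M' N' : ConflationCat.{v, u}} [GoodExact M'] [GoodExact N'] {F' : M' ⟶ N'}

/-- Naturality follows from the formula on objects alone. It is needed for one endomorphism of the
pair B^q F, the idempotent Δ⊤. -/
theorem IsBoundary.naturality_left {a b a' b'} (h : IsBoundary n F a b)
    (h' : IsBoundary n F' a' b') (s : Arrow.mk F ⟶ Arrow.mk F') :
    (K (n + 1)).map s.right ≫ a' = a ≫ (KOmega n).map s := by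
  refine K_hom_ext fun X => ?_
  let Y : BPair ((BqIter n).map F) := bpOfBq ((BqIter n).map F) X.obj X.property
  have hY : ∀ i, IsZero (Y.srcTop.X i) := fun i => isZero_zero _
  have hY' : ∀ i, IsZero (Y.srcBot.X i) := fun i => isZero_zero _
  let s' := (BqIter n).mapArrow.map s
  let Y' : BPair ((BqIter n).map F') := (BPair.map s').obj Y
  have h₁ := h.left_class X Y hY hY' rfl
  have h₂ := h'.left_class ((BqObj.map s'.right).obj X) Y' (fun i => (fn s'.left).map_isZero (hY i))
    (fun i => (fn s'.left).map_isZero (hY' i)) rfl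
  have h₃ := ConcreteCategory.congr_hom (vertexK1_naturality n s.right)
    (vertexK 1 _ (K0Class (Bq ((BqIter n).obj N)) X))
  have h₄ := ConcreteCategory.congr_hom (vertexK_naturality 1 s'.right)
    (K0Class (Bq ((BqIter n).obj N)) X)
  have h₅ := ConcreteCategory.congr_hom (vertexKOmega_naturality n s) (K0OmegaClass Y)
  refine (congrArg a' (h₃.trans (congrArg (vertexK1 n N') h₄))).trans (h₂.trans ?_)
  exact h₅.symm.trans (congrArg ((KOmega n).map s) h₁.symm)

theorem IsBoundary.naturality_right {a b a' b'} (h : IsBoundary n F a b)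
    (h' : IsBoundary n F' a' b') (s : Arrow.mk F ⟶ Arrow.mk F') :
    (KOmega n).map s ≫ b' = b ≫ (K n).map s.left := by
  refine KOmega_hom_ext fun Y => ?_
  let s' := (BqIter n).mapArrow.map s
  let Y' : BPair ((BqIter n).map F') := (BPair.map s').obj Y
  have h₁ := h.right_class Y
  have h₂ := h'.right_class Y'
  have h₃ := ConcreteCategory.congr_hom (vertexKOmega_naturality n s) (K0OmegaClass Y)
  have h₄ := ConcreteCategory.congr_hom (vertexK_naturality n s.left)
    (eulerChar ((BqIter n).obj M) Y.srcTop.X - eulerChar ((BqIter n).obj M) Y.srcBot.X)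
  refine (congrArg b' h₃).trans (h₂.trans (Eq.trans (congrArg (vertexK n M') ?_)
    (h₄.symm.trans (congrArg ((K n).map s.left) h₁.symm))))
  refine Eq.trans ?_ (map_sub (K0.map ((BqIter n).map s.left)).hom _ _).symm
  exact congrArg₂ (fun a b => a - b) (map_eulerChar (M := (BqIter n).obj M) (N := (BqIter n).obj M') ((BqIter n).map s.left) Y.bounded_srcTop).symm
    (map_eulerChar (M := (BqIter n).obj M) (N := (BqIter n).obj M') ((BqIter n).map s.left) Y.bounded_srcBot).symm

theorem isBoundary_zero (F : M ⟶ N) : IsBoundary 0 F (AddCommGrpCat.ofHom (bdryOfBq F))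
    (AddCommGrpCat.ofHom (relEuler F)) where
  left_class X Y h₁ h₂ h := bdryOfBq_vertexK X Y h₁ h₂ h
  right_class Y := relEuler_class F Y
  exact₁ := exact_map_bdryOfBq F
  exact₂ := exact_bdryOfBq_relEuler F
  exact₃ := exact_relEuler_map F

/-- The groups of degree n + 1 are quotients of those of degree n for B^q F by split diagonals. The
maps commute with the resulting idempotents, hence descend, and their exactness descends by
`exact_of_quotients`. -/
theorem IsBoundary.exists_succ {a b} (h : IsBoundary n (BqFunctor.map F) a b) :
    ∃ a' b', IsBoundary (n + 1) F a' b' := by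
  have ha := h.naturality_left h (pairTop (Arrow.mk F) ≫ pairDiag (Arrow.mk F))
  have hb := h.naturality_right h (pairTop (Arrow.mk F) ≫ pairDiag (Arrow.mk F))
  have wa : (K (n + 1)).map (diagNat.app N) ≫ a ≫ projKOmega n (Arrow.mk F) = 0 :=
    map_comp_comp_cokernel_π (K (n + 1)) (diagNat.app N) (topNat.app N) (diagNat_topNat N)
      (KOmega n) (pairDiag (Arrow.mk F)) (pairTop (Arrow.mk F)) ha
  have wb : (KOmega n).map (pairDiag (Arrow.mk F)) ≫ b ≫ projK n M = 0 :=
    map_comp_comp_cokernel_π (KOmega n) (pairDiag (Arrow.mk F)) (pairTop (Arrow.mk F))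
      (pairDiag_pairTop _) (K n) (diagNat.app M) (topNat.app M) hb
  obtain ⟨a', ha'⟩ : ∃ a' : (K (n + 1 + 1)).obj N ⟶ (KOmega (n + 1)).obj (Arrow.mk F),
      projK (n + 1) N ≫ a' = a ≫ projKOmega n (Arrow.mk F) :=
    ⟨cokernel.desc ((K (n + 1)).map (diagNat.app N)) _ wa, cokernel.π_desc _ _ _⟩
  obtain ⟨b', hb'⟩ : ∃ b' : (KOmega (n + 1)).obj (Arrow.mk F) ⟶ (K (n + 1)).obj M,
      projKOmega n (Arrow.mk F) ≫ b' = b ≫ projK n M :=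
    ⟨cokernel.desc ((KOmega n).map (pairDiag (Arrow.mk F))) _ wb, cokernel.π_desc _ _ _⟩
  have ha'' := ConcreteCategory.congr_hom ha'
  have hb'' := ConcreteCategory.congr_hom hb'
  refine ⟨a', b', fun X Y h₁ h₂ h₃ => ?_, fun Y => ?_, ?_, ?_, ?_⟩
  · exact (ha'' _).trans (congrArg (projKOmega n (Arrow.mk F)) (h.left_class X Y h₁ h₂ h₃))
  · exact (hb'' _).trans (congrArg (projK n M) (h.right_class Y))
  · exact exact_of_quotients h.exact₁ (projK_surjective (n + 1) M) (projK_surjective (n + 1) N)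
      (projK_map (n + 1) F) ha' ha (map_top_diag_projK (n + 1) N)
      (map_pairTop_pairDiag_of_projKOmega (n := n) (F := Arrow.mk F))
  · exact exact_of_quotients h.exact₂ (projK_surjective (n + 1) N) (projKOmega_surjective n _)
      ha' hb' hb (map_pairTop_pairDiag_projKOmega n _) map_top_diag_of_projK
  · have hnat : (K n).map (topNat.app M ≫ diagNat.app M) ≫ (K n).map (BqFunctor.map F) =
        (K n).map (BqFunctor.map F) ≫ (K n).map (topNat.app N ≫ diagNat.app N) :=
      ((K n).map_comp _ _).symm.trans
        ((K n).map_comp (BqFunctor.map F) (topNat.app N ≫ diagNat.app N))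
    exact exact_of_quotients h.exact₃ (projKOmega_surjective n _) (projK_surjective n M) hb'
      (projK_map n F) hnat (map_top_diag_projK n M) map_top_diag_of_projK

end

/-- The functor F varies in the induction: the segment n + 1 of F is deduced from the segment n of
B^q F, whose categories again satisfy the hypotheses. -/
theorem exists_isBoundary : ∀ (n : ℕ) {M N : ConflationCat.{v, u}} [GoodExact M] [GoodExact N]
    (F : M ⟶ N), ∃ a b, IsBoundary n F a b
  | 0, _, _, _, _, F => ⟨_, _, isBoundary_zero F⟩
  | n + 1, _, _, _, _, F => by
    obtain ⟨a, b, h⟩ := exists_isBoundary n (BqFunctor.map F)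
    exact h.exists_succ

end GoodExact

end

theorem mainTheorem3 (M N : ConflationCat.{v, u})
    (hM : M.IsExactCategory) (hM' : M.SupportsLongExactSequences)
    (hN : N.IsExactCategory) (hN' : N.SupportsLongExactSequences) (F : M ⟶ N) :
    ∃ (a : ∀ n : ℕ, (K (n + 1)).obj N ⟶ (KOmega n).obj (Arrow.mk F))
      (b : ∀ n : ℕ, (KOmega n).obj (Arrow.mk F) ⟶ (K n).obj M),
      -- `a n` is induced by `[X] ↦ [(0, X, 0)]`
      (∀ (n : ℕ) (X : BqObj ((BqIter n).obj N)) (Y : BPair ((BqIter n).map F)),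
        (∀ i, IsZero (Y.srcTop.X i)) → (∀ i, IsZero (Y.srcBot.X i)) → Y.tar = X.obj →
        a n (vertexK1 n N (vertexK 1 ((BqIter n).obj N) (K0Class (Bq ((BqIter n).obj N)) X))) =
          vertexKOmega n (Arrow.mk F) (K0OmegaClass Y)) ∧
      -- `b n` is induced by `[(X, Y, u)] ↦ χ(⊤ X) - χ(⊥ X)`
      (∀ (n : ℕ) (Y : BPair ((BqIter n).map F)),
        b n (vertexKOmega n (Arrow.mk F) (K0OmegaClass Y)) =
          vertexK n M (eulerChar ((BqIter n).obj M) Y.srcTop.X -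
            eulerChar ((BqIter n).obj M) Y.srcBot.X)) ∧
      -- the sequence `⋯ ⟶ K_(n+1) M ⟶ K_(n+1) N ⟶ (K_0 Ω)(Ω^n [F]) ⟶ K_n M ⟶ K_n N ⟶ ⋯` is exact
      (∀ n : ℕ, Function.Exact ((K (n + 1)).map F) (a n)) ∧
      (∀ n : ℕ, Function.Exact (a n) (b n)) ∧
      (∀ n : ℕ, Function.Exact (b n) ((K n).map F)) := by
  have : GoodExact M := ⟨hM, hM'⟩
  have : GoodExact N := ⟨hN, hN'⟩
  choose a b h using fun n => GoodExact.exists_isBoundary n F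
  exact ⟨a, b, fun n => (h n).left_class, fun n => (h n).right_class, fun n => (h n).exact₁,
    fun n => (h n).exact₂, fun n => (h n).exact₃⟩
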